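/- All trees are finite. For rooted trees $T_1,\dots,T_k$ let $[T_1,\dots,T_k]$ be the rooted tree obtained by joining a new root to the roots of $T_1,\dots,T_k$ ($k\ge 0$; $\bullet=[\,]$ is the single-vertex tree). If $v\ne w$ are leaves (vertices of degree 1) of a tree $H$, let $[L_1,\dots,L_k]vHw[R_1,\dots,R_\ell]$ be the tree obtained from $H$ by merging the root of $[L_1,\dots,L_k]$ with $v$ and the root of $[R_1,\dots,R_\ell]$ with $w$. Degree sequences are written in non-increasing order; $B=(b_1,\dots,b_n)$ majorises $D=(d_1,\dots,d_n)$ (written $D\triangleleft B$) if both have the same sum and $d_1+\dots+d_k\le b_1+\dots+b_k$ for $1\le k<n$. Let $\rho$ be a real-valued invariant of rooted trees with $\rho([T_1,\dots,T_k])=f(\rho(T_1),\dots,\rho(T_k))$ for a symmetric function $f$. Call $\rho$ *of type I* if $f$ is (on values of $\rho$) strictly increasing in each variable and under addition of further variables, and $\rho(\bullet)<\rho(T)$ for every rooted tree $T$ with more than one vertex. Call $\rho$ *of type II* if the same holds with "decreasing" and $\rho(\bullet)>\rho(T)$. A real-valued tree invariant $I$ is *maximum-$\rho$-compatible* if for every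 tree $H$, any two distinct leaves $v,w$ of $H$, all rooted trees with $\rho(T_1)\ge\dots\ge\rho(T_r)$ and every integer $s$ with $r/2\le s\le r$, the maximum of $I$ over all trees $[T_{\sigma(1)},\dots,T_{\sigma(k)}]vHw[T_{\sigma(k+1)},\dots,T_{\sigma(r)}]$ ($\sigma$ a permutation of $1,\dots,r$, and $r-s\le k\le s$) is attained by at least one of $[T_1,\dots,T_s]vHw[T_{s+1},\dots,T_r]$ and $[T_{s+1},\dots,T_r]vHw[T_1,\dots,T_s]$. *Minimum-$\rho$-compatible* is defined with "minimum" instead of "maximum". For a degree sequence $B=(b_1,\dots,b_n)$ of a tree, the greedy tree $\mathcal G(B)$ is the tree on vertices $1,\dots,n$ in which vertex $i$ has degree $b_i$, the neighbours of $1$ are the next $b_1$ vertices, and then, for $i=2,3,\dots$ in turn, the next $b_i-1$ vertices not yet used are joined to $i$. The tree $\mathcal M(B)$ depends only on the entries $d_1\ge\dots\ge d_t\ge 2$ of $B$ that are at least $2$ (if $t=0$, it is the only tree with degree sequence $B$), and is constructed together with labels $v_1,v_2,\dots$ of some vertices. Write $[d]$ for the star with $d$ vertices rooted at its centre. If $t\le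 d_t+1$, then $\mathcal M(d_1,\dots,d_t)=[[d_1],\dots,[d_{t-1}],[1],\dots,[1]]$ with root $v_1$ of degree $d_t$, and $v_2,\dots,v_t$ are the roots of $[d_{t-1}],\dots,[d_1]$. If $t\ge d_t+2$, take $\mathcal M(d_{d_t},\dots,d_{t-1})$ with its labels $v_1,\dots,v_\ell$, let $s$ be the least index such that $v_s$ is adjacent to a leaf, and merge a leaf adjacent to $v_s$ with the root of $[[d_1],\dots,[d_{d_t-1}]]$; the roots of $[d_{d_t-1}],\dots,[d_1]$ get the labels $v_{\ell+1},\dots,v_{\ell+d_t-1}$ in this order. **Corollary.** Let $\mathbb A$ be a class of trees with $n$ vertices and $B$ a degree sequence of a tree such that the degree sequence $D$ of every $T\in\mathbb A$ satisfies $D\triangleleft B$. If $I$ is maximum-$\rho$-compatible, then - $\max\{I(T):T\in\mathbb A\}=I(\mathcal G(B))$ if $\rho$ is of type I and $\mathcal G(B)\in\mathbb A$; - $\max\{I(T):T\in\mathbb A\}=I(\mathcal M(B))$ if $\rho$ is of type II and $\mathcal M(B)\in\mathbb A$. If $I$ is minimum-$\rho$-compatible, the same holds with $\min$ instead of $\max$.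 **Applications.** Let $SW_k(T)$ be the Steiner $k$-Wiener index of $T$: the sum, over all $k$-element sets $S$ of vertices, of the number of edges of a smallest subtree of $T$ containing $S$. Let $W(T)$ be the Wiener index, the sum of the distances over all unordered pairs of vertices. Let $s(T)$ be the solvability: the number of pairs $(a,b)$ of vectors in $\mathbb F_2^{V(T)}$ for which $(A+\operatorname{diag}(a))x=b$ has a solution $x$, where $A$ is the adjacency matrix of $T$. 1. Let $n\ge 2$, $1\le r<d$, $r\equiv n-1 \pmod{d-1}$ and $B=(d,\dots,d,r,1,\dots,1)$ with $\frac{n-1-r}{d-1}$ copies of $d$ at the beginning, and length $n$. Among all $n$-vertex trees with all degrees at most $d$, the tree $\mathcal G(B)$ (which is one of them) minimises $SW_k$ for every $k\ge 2$, and $\mathcal M(B)$ (which is one of them) minimises $s$. 2. Let $2\le\ell<n$ and $B=(\ell,2,\dots,2,1,\dots,1)$ with $n-\ell-1$ copies of $2$ and $\ell$ copies of $1$. Among all $n$-vertex trees with exactly $\ell$ leaves, $\mathcal G(B)$ (which is one of them) minimises $SW_k$ for every $k\ge 2$, and $\mathcal M(B)$ (which is one of them) minimises $s$. 3. Let $r\ge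 1$, $n\ge 2r+2$ and $B=(n-2r+1,3,\dots,3,1,\dots,1)$ with $r-1$ copies of $3$ and $n-r$ copies of $1$. Among all $n$-vertex trees with exactly $r$ vertices of degree at least $3$, $\mathcal G(B)$ (which is one of them) minimises $W$. -/

import Mathlib

/-- A finite tree. -/
structure FinTree where
  /-- the vertices -/
  V : Type
  [fintype : Fintype V]
  /-- the graph -/
  graph : SimpleGraph V
  isTree : graph.IsTree

attribute [instance] FinTree.fintype

/-- A finite rooted tree. -/
structure FinRootedTree extends FinTree where
  /-- the root -/
  root : V

/-- The number of vertices of a tree. -/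
def FinTree.order (T : FinTree) : ℕ := Fintype.card T.V

/-- The degree of a vertex. -/
noncomputable def FinTree.deg (T : FinTree) (v : T.V) : ℕ := (T.graph.neighborSet v).ncard

/-- The degree sequence of a tree, in non-increasing order. -/
noncomputable def FinTree.degSeq (T : FinTree) : List ℕ :=
  (Finset.univ.val.map T.deg).sort (· ≥ ·)

/-- `B` is the (non-increasing) degree sequence of some tree. -/
def IsTreeDegSeq (B : List ℕ) : Prop := ∃ T : FinTree, T.degSeq = B

/-- `B` majorises `D`. -/
def Majorises (B D : List ℕ) : Prop :=
  B.length = D.length ∧ B.sum = D.sum ∧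
    ∀ k, 1 ≤ k → k < B.length → (D.take k).sum ≤ (B.take k).sum

/-! ### Attaching rooted trees -/

/-- The edges (each listed in at least one direction) of the graph that arises from `H` and
disjoint rooted trees `T i` by joining the root of each `T i` to the vertex `a i` of `H`. -/
inductive GraftRel {V : Type} (H : SimpleGraph V) {ι : Type} (T : ι → FinRootedTree) (a : ι → V) :
    V ⊕ (Σ i, (T i).V) → V ⊕ (Σ i, (T i).V) → Prop
  | base (x y : V) (h : H.Adj x y) : GraftRel H T a (Sum.inl x) (Sum.inl y)
  | branch (i : ι) (x y : (T i).V) (h : (T i).graph.Adj x y) :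
      GraftRel H T a (Sum.inr ⟨i, x⟩) (Sum.inr ⟨i, y⟩)
  | join (i : ι) : GraftRel H T a (Sum.inl (a i)) (Sum.inr ⟨i, (T i).root⟩)

/-- The graph that arises from `H` and disjoint rooted trees `T i` by joining the root of each
`T i` to the vertex `a i` of `H`. -/
def graft {V : Type} (H : SimpleGraph V) {ι : Type} (T : ι → FinRootedTree) (a : ι → V) :
    SimpleGraph (V ⊕ (Σ i, (T i).V)) :=
  SimpleGraph.fromRel (GraftRel H T a)

/-- `T = [T₁, …, T_k]` (up to isomorphism of rooted trees): the root of `T` is joined to the roots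
of `T₁, …, T_k`. The empty list gives the single vertex tree. -/
def FinRootedTree.IsBranching (T : FinRootedTree) (Ts : List FinRootedTree) : Prop :=
  ∃ φ : T.graph ≃g graft (⊥ : SimpleGraph Unit) Ts.get (fun _ => ()), φ T.root = Sum.inl ()

/-- `T = [L₁, …, L_k] v H w [R₁, …, R_l]` (up to isomorphism): the root of `[L₁, …, L_k]` is
merged with `v` and the root of `[R₁, …, R_l]` is merged with `w`. -/
def FinTree.IsDecomp (T : FinTree) (L : List FinRootedTree) (H : FinTree) (v w : H.V)
    (R : List FinRootedTree) : Prop :=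
  Nonempty (T.graph ≃g
    graft H.graph (ι := Fin L.length ⊕ Fin R.length) (Sum.elim L.get R.get)
      (Sum.elim (fun _ => v) (fun _ => w)))

/-! ### Invariants -/

/-- `I` depends only on the isomorphism type of the tree. -/
def IsTreeInvariant (I : FinTree → ℝ) : Prop :=
  ∀ T T' : FinTree, Nonempty (T.graph ≃g T'.graph) → I T = I T'

/-- `ρ([T₁, …, T_k]) = f(ρ(T₁), …, ρ(T_k))`; the recurrence rule `f` is symmetric since it is a
function of the multiset of its arguments. (In particular, `ρ` depends only on the isomorphism
type of the rooted tree.) -/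
def HasRecurrence (ρ : FinRootedTree → ℝ) (f : Multiset ℝ → ℝ) : Prop :=
  ∀ (T : FinRootedTree) (Ts : List FinRootedTree), T.IsBranching Ts → ρ T = f (Ts.map ρ : List ℝ)

/-- `ρ` has a symmetric recurrence rule which, on the values taken by `ρ`, is strictly increasing
in each variable and under addition of further variables, and the single vertex tree is the
unique minimum of `ρ`. -/
def IncreasingRule (ρ : FinRootedTree → ℝ) : Prop :=
  ∃ f : Multiset ℝ → ℝ, HasRecurrence ρ f ∧
    (∀ (S : Multiset FinRootedTree) (X Y : FinRootedTree), ρ X < ρ Y →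
      f (ρ X ::ₘ S.map ρ) < f (ρ Y ::ₘ S.map ρ)) ∧
    (∀ (S : Multiset FinRootedTree) (X : FinRootedTree), f (S.map ρ) < f (ρ X ::ₘ S.map ρ)) ∧
    (∀ T₀ T : FinRootedTree, T₀.order = 1 → 1 < T.order → ρ T₀ < ρ T)

/-- `ρ` has a symmetric recurrence rule which, on the values taken by `ρ`, is strictly decreasing
in each variable and under addition of further variables, and the single vertex tree is the
unique maximum of `ρ`. -/
def DecreasingRule (ρ : FinRootedTree → ℝ) : Prop :=
  ∃ f : Multiset ℝ → ℝ, HasRecurrence ρ f ∧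
    (∀ (S : Multiset FinRootedTree) (X Y : FinRootedTree), ρ X < ρ Y →
      f (ρ Y ::ₘ S.map ρ) < f (ρ X ::ₘ S.map ρ)) ∧
    (∀ (S : Multiset FinRootedTree) (X : FinRootedTree), f (ρ X ::ₘ S.map ρ) < f (S.map ρ)) ∧
    (∀ T₀ T : FinRootedTree, T₀.order = 1 → 1 < T.order → ρ T < ρ T₀)

/-- The set `𝕂_s` of all trees that arise by distributing the rooted trees `Ts = [T₁, …, T_r]`
among the vertices `v` and `w` of `H`, so that `v` receives at least `r - s` and at most `s` of
them. -/
def distributions (H : FinTree) (v w : H.V) (Ts : List FinRootedTree) (s : ℕ) : Set FinTree :=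
  {T | ∃ L R : List FinRootedTree, (L ++ R).Perm Ts ∧ Ts.length - s ≤ L.length ∧ L.length ≤ s ∧
    T.IsDecomp L H v w R}

/-- `I` is maximum-`ρ`-compatible. -/
def MaxCompatible (ρ : FinRootedTree → ℝ) (I : FinTree → ℝ) : Prop :=
  ∀ (H : FinTree) (v w : H.V), v ≠ w → H.deg v = 1 → H.deg w = 1 →
    ∀ Ts : List FinRootedTree, Ts.Pairwise (fun X Y => ρ X ≥ ρ Y) →
      ∀ s : ℕ, Ts.length ≤ 2 * s → s ≤ Ts.length →
        ∃ T : FinTree,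
          (T.IsDecomp (Ts.take s) H v w (Ts.drop s) ∨ T.IsDecomp (Ts.drop s) H v w (Ts.take s)) ∧
          IsGreatest (I '' distributions H v w Ts s) (I T)

/-- `I` is minimum-`ρ`-compatible. -/
def MinCompatible (ρ : FinRootedTree → ℝ) (I : FinTree → ℝ) : Prop :=
  ∀ (H : FinTree) (v w : H.V), v ≠ w → H.deg v = 1 → H.deg w = 1 →
    ∀ Ts : List FinRootedTree, Ts.Pairwise (fun X Y => ρ X ≥ ρ Y) →
      ∀ s : ℕ, Ts.length ≤ 2 * s → s ≤ Ts.length →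
        ∃ T : FinTree,
          (T.IsDecomp (Ts.take s) H v w (Ts.drop s) ∨ T.IsDecomp (Ts.drop s) H v w (Ts.take s)) ∧
          IsLeast (I '' distributions H v w Ts s) (I T)

/-! ### Greedy trees and `𝓜`-trees -/

/-- The graph on `0, 1, …, p.length - 1` in which every `j ≥ 1` is joined to its parent `p[j]`
(the entry `p[0] = 0` of the root is irrelevant). -/
def parentGraph (p : List ℕ) : SimpleGraph (Fin p.length) :=
  SimpleGraph.fromRel (fun i j => p.get j = i.val)

/-- The parents in the greedy tree of `B = [b₀, b₁, …]` (non-increasing): the vertices are numbered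
in the order in which they are labelled, vertex `i` has degree `bᵢ`, the root `0` has the children
`1, …, b₀`, the next `b₁ - 1` vertices are the children of `1`, the next `b₂ - 1` vertices are the
children of `2`, and so on. -/
def greedyParents (B : List ℕ) : List ℕ :=
  0 :: (B.mapIdx (fun i b => List.replicate (if i = 0 then b else b - 1) i)).flatten

/-- `T` is the greedy tree `𝒢(B)`. -/
def IsGreedyTree (B : List ℕ) (T : FinTree) : Prop :=
  Nonempty (T.graph ≃g parentGraph (greedyParents B))

/-- A rooted tree on `0, 1, …` (root `0`) given by the list of parents, with some of its vertices
labelled `v₁, v₂, …`. -/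
structure LabelledTree where
  /-- the parents -/
  parents : List ℕ
  /-- the labelled vertices `v₁, v₂, …`, in this order -/
  labels : List ℕ

/-- Join the vertex `x` to the roots of new pseudo-leaf branches `[c]`, for `c` in the list
(`[c]` is a star with `c` vertices, rooted at its centre), and label their roots, in this order,
with the next free labels. -/
def LabelledTree.hang (S : LabelledTree) (x : ℕ) (cs : List ℕ) : LabelledTree :=
  cs.foldl (fun S c =>
    ⟨S.parents ++ x :: List.replicate (c - 1) S.parents.length,
      S.labels ++ [S.parents.length]⟩) S

/-- The first leaf (a vertex without children) which is a child of the vertex `v`, if any. -/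
def LabelledTree.leafAt (S : LabelledTree) (v : ℕ) : Option ℕ :=
  (List.range S.parents.length).find? (fun y => S.parents[y]? = some v ∧ y ∉ S.parents)

/-- A leaf adjacent to `v_s`, where `s` is the smallest index such that `v_s` is adjacent to
a leaf. -/
def LabelledTree.freeLeaf (S : LabelledTree) : ℕ :=
  (S.labels.findSome? S.leafAt).getD 0

/-- The labelled `𝓜`-tree of a nonempty reduced degree sequence `(d₁, …, d_t)`, which is given here
in non-decreasing order, as `d_t :: [d_{t-1}, …, d₁]`.
* If `t ≤ d_t + 1`, it is `[[d₁], …, [d_{t-1}], [1], …, [1]]` with root `v₁` of degree `d_t` and with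
  `v₂, …, v_t` the roots of `[d_{t-1}], …, [d₁]`.
* Otherwise, it arises from the labelled `𝓜`-tree of `(d_{d_t}, …, d_{t-1})` by merging a leaf
  adjacent to `v_s` (with `s` as small as possible) with the root of `[[d₁], …, [d_{d_t - 1}]]`,
  whose pseudo-leaves get the next labels, in non-decreasing order of the degrees. -/
def mTreeAux : List ℕ → LabelledTree
  | [] => ⟨[0], []⟩
  | c :: e =>
    if e.length ≤ c then
      let S := LabelledTree.hang ⟨[0], [0]⟩ 0 e
      ⟨S.parents ++ List.replicate (c - e.length) 0, S.labels⟩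
    else
      let S := mTreeAux (e.take (e.length - (c - 1)))
      S.hang S.freeLeaf (e.drop (e.length - (c - 1)))
termination_by l => l.length
decreasing_by simp

/-- The parents in the `𝓜`-tree of `B` (non-increasing). If `B` has no entry `≥ 2`, i.e.
`B = (0)` or `B = (1, 1)`, this is the only tree with degree sequence `B`. -/
def mParents (B : List ℕ) : List ℕ :=
  if ∀ b ∈ B, b < 2 then List.replicate B.length 0
  else (mTreeAux (B.filter (2 ≤ ·)).reverse).parents

/-- `T` is the `𝓜`-tree `𝓜(B)`. -/
def IsMTree (B : List ℕ) (T : FinTree) : Prop :=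
  Nonempty (T.graph ≃g parentGraph (mParents B))

/-! ### Concrete invariants and classes of trees -/

open Classical in
/-- The Wiener index: the sum of the distances over all unordered pairs of vertices. -/
noncomputable def wienerIndex (T : FinTree) : ℕ :=
  ∑ e : Sym2 T.V, Sym2.lift ⟨fun u v => T.graph.dist u v, fun _ _ => T.graph.dist_comm⟩ e

/-- The Steiner distance of a set of vertices: the number of edges in a smallest subtree which
contains all of them. -/
noncomputable def steinerDist (T : FinTree) (S : Finset T.V) : ℕ :=
  sInf {m | ∃ K : T.graph.Subgraph, K.coe.IsTree ∧ (S : Set T.V) ⊆ K.verts ∧ K.edgeSet.ncard = m}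

/-- The Steiner `k`-Wiener index: the sum of the Steiner distances of all `k`-element sets of
vertices. -/
noncomputable def steinerWiener (k : ℕ) (T : FinTree) : ℕ :=
  ∑ S ∈ (Finset.univ : Finset T.V).powersetCard k, steinerDist T S

open Classical in
/-- The solvability: the number of pairs `(a, b)` of vectors over `𝔽₂` such that
`(A + diag a) x = b` has a solution `x`, where `A` is the adjacency matrix. -/
noncomputable def solvability (T : FinTree) : ℕ :=
  Nat.card {p : (T.V → ZMod 2) × (T.V → ZMod 2) //
    ∃ x : T.V → ZMod 2,
      (T.graph.adjMatrix (ZMod 2) + Matrix.diagonal p.1).mulVec x = p.2}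

/-- The trees with `n` vertices whose vertex degrees are at most `d`. -/
def boundedDegreeTrees (n d : ℕ) : Set FinTree :=
  {T | T.order = n ∧ ∀ v, T.deg v ≤ d}

/-- The trees with `n` vertices and exactly `l` leaves. -/
def treesWithLeaves (n l : ℕ) : Set FinTree :=
  {T | T.order = n ∧ {v | T.deg v = 1}.ncard = l}

/-- The trees with `n` vertices and exactly `r` branching vertices (of degree at least 3). -/
def treesWithBranching (n r : ℕ) : Set FinTree :=
  {T | T.order = n ∧ {v | 3 ≤ T.deg v}.ncard = r}

/-- The sequence `(d, …, d, r, 1, …, 1)` of length `n` with sum `2n - 2`, where `1 ≤ r < d` and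
`r ≡ n - 1` modulo `d - 1`. -/
def boundedDegreeSeq (n d r : ℕ) : List ℕ :=
  List.replicate ((n - 1 - r) / (d - 1)) d ++ r :: List.replicate (n - 1 - (n - 1 - r) / (d - 1)) 1

/-- The sequence `(l, 2, …, 2, 1, …, 1)` with `n - l - 1` copies of `2` and `l` copies of `1`. -/
def leavesSeq (n l : ℕ) : List ℕ :=
  l :: (List.replicate (n - l - 1) 2 ++ List.replicate l 1)

/-- The sequence `(n - 2r + 1, 3, …, 3, 1, …, 1)` with `r - 1` copies of `3` and `n - r` copies
of `1`. -/
def branchingSeq (n r : ℕ) : List ℕ :=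
  (n + 1 - 2 * r) :: (List.replicate (r - 1) 3 ++ List.replicate (n - r) 1)

/-! ### Joining two rooted graphs by an edge -/

namespace SimpleGraph

variable {V W V' W' U : Type}

/-- The disjoint union of two graphs together with an edge joining `v` to `u`. -/
def bridge (G : SimpleGraph V) (v : V) (X : SimpleGraph W) (u : W) : SimpleGraph (V ⊕ W) where
  Adj
    | .inl a, .inl b => G.Adj a b
    | .inr a, .inr b => X.Adj a b
    | .inl a, .inr b => a = v ∧ b = u
    | .inr b, .inl a => a = v ∧ b = u
  symm := ⟨by
    rintro (a | a) (b | b) h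
    · exact h.symm
    · exact h
    · exact h
    · exact h.symm⟩
  loopless := ⟨by
    rintro (a | a) h
    · exact G.loopless.irrefl a h
    · exact X.loopless.irrefl a h⟩

section
variable {G : SimpleGraph V} {v : V} {X : SimpleGraph W} {u : W}

@[simp] lemma bridge_inl_inl {a b : V} :
    (bridge G v X u).Adj (.inl a) (.inl b) ↔ G.Adj a b := Iff.rfl

@[simp] lemma bridge_inr_inr {a b : W} :
    (bridge G v X u).Adj (.inr a) (.inr b) ↔ X.Adj a b := Iff.rfl

@[simp] lemma bridge_inl_inr {a : V} {b : W} :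
    (bridge G v X u).Adj (.inl a) (.inr b) ↔ a = v ∧ b = u := Iff.rfl

@[simp] lemma bridge_inr_inl {a : V} {b : W} :
    (bridge G v X u).Adj (.inr b) (.inl a) ↔ a = v ∧ b = u := Iff.rfl

end

/-- `bridge` respects isomorphisms. -/
def bridgeCongr {G : SimpleGraph V} {G' : SimpleGraph V'} {X : SimpleGraph W}
    {X' : SimpleGraph W'} (e : G ≃g G') (f : X ≃g X') {v : V} {u : W} {v' : V'} {u' : W'}
    (hv : e v = v') (hu : f u = u') : bridge G v X u ≃g bridge G' v' X' u' where
  toEquiv := Equiv.sumCongr e.toEquiv f.toEquiv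
  map_rel_iff' := by
    subst hv hu
    rintro (a | a) (b | b)
    · exact e.map_adj_iff
    · exact and_congr e.injective.eq_iff f.injective.eq_iff
    · exact and_congr e.injective.eq_iff f.injective.eq_iff
    · exact f.map_adj_iff

/-- `bridge` is commutative. -/
def bridgeComm (G : SimpleGraph V) (v : V) (X : SimpleGraph W) (u : W) :
    bridge G v X u ≃g bridge X u G v where
  toEquiv := Equiv.sumComm V W
  map_rel_iff' := by
    rintro (a | a) (b | b)
    · exact Iff.rfl
    · exact and_comm
    · exact and_comm
    · exact Iff.rfl

/-- Two graphs joined to the same graph can be joined in either order. -/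
def bridgeRightComm (G : SimpleGraph V) (v w : V) (X : SimpleGraph W) (u : W)
    (Y : SimpleGraph U) (y : U) :
    bridge (bridge G v X u) (.inl w) Y y ≃g bridge (bridge G w Y y) (.inl v) X u where
  toEquiv := (Equiv.sumAssoc V W U).trans
    ((Equiv.sumCongr (Equiv.refl V) (Equiv.sumComm W U)).trans (Equiv.sumAssoc V U W).symm)
  map_rel_iff' := by
    rintro ((a | a) | a) ((b | b) | b) <;> simp

/-- Joining a graph to the second part of a bridge. -/
def bridgeAssoc (G : SimpleGraph V) (v : V) (X : SimpleGraph W) (u x : W)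
    (Y : SimpleGraph U) (y : U) :
    bridge (bridge G v X u) (.inr x) Y y ≃g bridge G v (bridge X x Y y) (.inl u) where
  toEquiv := Equiv.sumAssoc V W U
  map_rel_iff' := by
    rintro ((a | a) | a) ((b | b) | b) <;> simp

lemma ncard_neighborSet_bridge_inl [Finite V] [Finite W] [DecidableEq V] (G : SimpleGraph V)
    (v : V) (X : SimpleGraph W) (u : W) (x : V) :
    ((bridge G v X u).neighborSet (.inl x)).ncard =
      (G.neighborSet x).ncard + if x = v then 1 else 0 := by
  have h : (bridge G v X u).neighborSet (.inl x) =
      Sum.inl '' G.neighborSet x ∪ (if x = v then {Sum.inr u} else ∅) := by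
    ext (a | a)
    · split_ifs <;> simp
    · split_ifs with hx <;> simp [hx]
  rw [h, Set.ncard_union_eq]
  · rw [Set.ncard_image_of_injective _ Sum.inl_injective]
    split_ifs <;> simp
  · rw [Set.disjoint_left]
    rintro _ ⟨a, -, rfl⟩
    split_ifs <;> simp

lemma Iso.ncard_neighborSet {G : SimpleGraph V} {X : SimpleGraph W} (e : G ≃g X) (x : V) :
    (X.neighborSet (e x)).ncard = (G.neighborSet x).ncard := by
  have h : X.neighborSet (e x) = e '' G.neighborSet x := by
    ext y
    obtain ⟨z, rfl⟩ := e.surjective y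
    simp [e.map_adj_iff]
  rw [h, Set.ncard_image_of_injective _ e.injective]

lemma ncard_neighborSet_bridge_inr [Finite V] [Finite W] [DecidableEq W] (G : SimpleGraph V)
    (v : V) (X : SimpleGraph W) (u : W) (x : W) :
    ((bridge G v X u).neighborSet (.inr x)).ncard =
      (X.neighborSet x).ncard + if x = u then 1 else 0 := by
  rw [← ncard_neighborSet_bridge_inl X u G v x,
    ← (bridgeComm X u G v).ncard_neighborSet]
  rfl

lemma sum_ncard_neighborSet [Fintype V] (G : SimpleGraph V) :
    ∑ x, (G.neighborSet x).ncard = 2 * Nat.card G.edgeSet := by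
  classical
  rw [Nat.card_eq_fintype_card, ← SimpleGraph.edgeFinset_card, ← G.sum_degrees_eq_twice_card_edges]
  refine Finset.sum_congr rfl fun x _ => ?_
  rw [Set.ncard_eq_toFinset_card']
  rfl

/-- The new edge adds one to the degrees of `v` and `u` only, so the degree sums show that the
number of edges is the sum of the two numbers plus one. A connected graph with one vertex more than
edges is a tree. -/
lemma IsTree.bridge [Finite V] [Finite W] {G : SimpleGraph V} {X : SimpleGraph W}
    (hG : G.IsTree) (hX : X.IsTree) (v : V) (u : W) : (bridge G v X u).IsTree := by
  classical
  have := Fintype.ofFinite V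
  have := Fintype.ofFinite W
  rw [isTree_iff_connected_and_card] at hG hX ⊢
  constructor
  · have hl : ∀ a b : V, (SimpleGraph.bridge G v X u).Reachable (.inl a) (.inl b) := fun a b =>
      (hG.1.preconnected a b).map ⟨Sum.inl, fun h => h⟩
    have hr : ∀ a b : W, (SimpleGraph.bridge G v X u).Reachable (.inr a) (.inr b) := fun a b =>
      (hX.1.preconnected a b).map ⟨Sum.inr, fun h => h⟩
    have hb : (SimpleGraph.bridge G v X u).Adj (.inl v) (.inr u) := ⟨rfl, rfl⟩
    have key : ∀ a : V ⊕ W, (SimpleGraph.bridge G v X u).Reachable a (.inl v) := by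
      rintro (a | a)
      · exact hl _ _
      · exact (hr a u).trans hb.symm.reachable
    have : Nonempty (V ⊕ W) := ⟨.inl v⟩
    exact ⟨fun a b => (key a).trans (key b).symm⟩
  · have h := sum_ncard_neighborSet (SimpleGraph.bridge G v X u)
    rw [Fintype.sum_sum_type] at h
    simp only [ncard_neighborSet_bridge_inl, ncard_neighborSet_bridge_inr,
      Finset.sum_add_distrib, sum_ncard_neighborSet] at h
    simp only [Finset.sum_ite_eq', Finset.mem_univ, if_true] at h
    rw [Nat.card_sum, ← hG.2, ← hX.2]
    omega

end SimpleGraph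

/-! ### Rooted trees, built up by attaching branches to the root -/

/-- A rooted ordered tree: either a single vertex, or a tree `t` with a further branch `c`
attached to its root. -/
inductive RTree
  | leaf : RTree
  | attach (t c : RTree) : RTree

namespace RTree

open SimpleGraph

noncomputable instance : DecidableEq RTree := Classical.decEq _

/-- The vertices. -/
def Vert : RTree → Type
  | leaf => Unit
  | attach t c => t.Vert ⊕ c.Vert

instance instFintypeVert : (t : RTree) → Fintype t.Vert
  | leaf => inferInstanceAs (Fintype Unit)
  | attach t c =>
    letI := instFintypeVert t
    letI := instFintypeVert c
    inferInstanceAs (Fintype (t.Vert ⊕ c.Vert))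

instance instDecidableEqVert : (t : RTree) → DecidableEq t.Vert
  | leaf => inferInstanceAs (DecidableEq Unit)
  | attach t c =>
    letI := instDecidableEqVert t
    letI := instDecidableEqVert c
    inferInstanceAs (DecidableEq (t.Vert ⊕ c.Vert))

/-- The root. -/
def root : (t : RTree) → t.Vert
  | leaf => ()
  | attach t _ => Sum.inl t.root

/-- The underlying graph. -/
def graph : (t : RTree) → SimpleGraph t.Vert
  | leaf => (⊥ : SimpleGraph Unit)
  | attach t c => bridge t.graph t.root c.graph c.root

/-- The number of vertices. -/
def size : RTree → ℕ
  | leaf => 1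
  | attach t c => t.size + c.size

lemma size_pos : ∀ t : RTree, 0 < t.size
  | leaf => Nat.one_pos
  | attach t _ => Nat.add_pos_left t.size_pos _

lemma card_vert : ∀ t : RTree, Fintype.card t.Vert = t.size
  | leaf => rfl
  | attach t c => by
    rw [size, ← card_vert t, ← card_vert c]
    exact Fintype.card_sum

lemma isTree_graph : ∀ t : RTree, t.graph.IsTree
  | leaf => by
    have : Subsingleton leaf.Vert := inferInstanceAs (Subsingleton Unit)
    have : Nonempty leaf.Vert := ⟨leaf.root⟩
    exact IsTree.of_subsingleton
  | attach t c => (isTree_graph t).bridge (isTree_graph c) _ _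

/-- The underlying tree. -/
def toFinTree (t : RTree) : FinTree := ⟨t.Vert, t.graph, t.isTree_graph⟩

/-- The rooted tree. -/
def toFinRooted (t : RTree) : FinRootedTree := ⟨t.toFinTree, t.root⟩

/-- The list of branches is `ts`. -/
def node : List RTree → RTree
  | [] => leaf
  | c :: ts => attach (node ts) c

/-- The branches. -/
def children : RTree → List RTree
  | leaf => []
  | attach t c => c :: t.children

@[simp] lemma node_children : ∀ t : RTree, node t.children = t
  | leaf => rfl
  | attach t c => by simp [children, node, node_children t]

@[simp] lemma children_node : ∀ ts : List RTree, (node ts).children = ts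
  | [] => rfl
  | c :: ts => by simp [children, node, children_node ts]

/-- Isomorphism of rooted trees. -/
def Iso (t s : RTree) : Prop := ∃ φ : t.graph ≃g s.graph, φ t.root = s.root

lemma Iso.refl (t : RTree) : t.Iso t := ⟨RelIso.refl _, rfl⟩

lemma Iso.trans {t s r : RTree} : t.Iso s → s.Iso r → t.Iso r := by
  rintro ⟨φ, h⟩ ⟨ψ, h'⟩
  exact ⟨φ.trans ψ, by rw [← h', ← h]; rfl⟩

lemma Iso.attach {t s c d : RTree} : t.Iso s → c.Iso d → (attach t c).Iso (attach s d) := by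
  rintro ⟨φ, h⟩ ⟨ψ, h'⟩
  exact ⟨bridgeCongr φ ψ h h', congrArg Sum.inl h⟩

lemma Iso.swap (t c d : RTree) :
    (RTree.attach (RTree.attach t c) d).Iso (RTree.attach (RTree.attach t d) c) :=
  ⟨bridgeRightComm _ _ _ _ _ _ _, rfl⟩

lemma Iso.node_perm {ts us : List RTree} (h : ts.Perm us) : (node ts).Iso (node us) := by
  induction h with
  | nil => exact Iso.refl _
  | cons x _ ih => exact ih.attach (Iso.refl _)
  | swap x y l => exact Iso.swap _ _ _
  | trans _ _ ih ih' => exact ih.trans ih'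

lemma Iso.node_forall₂ {ts us : List RTree} (h : List.Forall₂ Iso ts us) :
    (node ts).Iso (node us) := by
  induction h with
  | nil => exact Iso.refl _
  | cons h _ ih => exact ih.attach h

lemma Iso.size_eq {t s : RTree} : t.Iso s → t.size = s.size := by
  rintro ⟨φ, -⟩
  rw [← card_vert, ← card_vert]
  exact Fintype.card_congr φ.toEquiv

/-- Attach the branch `c` to the vertex `x`. -/
def addAt : (t : RTree) → t.Vert → RTree → RTree
  | leaf, _, c => attach leaf c
  | attach t a, .inl x, c => attach (t.addAt x c) a
  | attach t a, .inr x, c => attach t (a.addAt x c)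

/-- The constructor `attach` joins a branch to the root only. A branch at a deeper vertex is brought
there by commuting or reassociating bridges along the way from the root, which leaves the root in
place. -/
lemma exists_bridge_iso_addAt : ∀ (t : RTree) (x : t.Vert) (c : RTree),
    ∃ φ : bridge t.graph x c.graph c.root ≃g (t.addAt x c).graph,
      φ (.inl t.root) = (t.addAt x c).root
  | leaf, _, c => ⟨RelIso.refl _, rfl⟩
  | attach t a, .inl x, c => by
    obtain ⟨φ, h⟩ := exists_bridge_iso_addAt t x c
    exact ⟨(bridgeRightComm t.graph t.root x a.graph a.root c.graph c.root).trans
      (bridgeCongr φ (RelIso.refl _) h rfl), congrArg Sum.inl h⟩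
  | attach t a, .inr x, c => by
    obtain ⟨φ, h⟩ := exists_bridge_iso_addAt a x c
    exact ⟨(bridgeAssoc t.graph t.root a.graph a.root x c.graph c.root).trans
      (bridgeCongr (RelIso.refl _) φ rfl h), rfl⟩

/-- A tree is obtained from the tree without a leaf by joining the leaf to its neighbour. -/
lemma exists_iso_bridge_leaf {V : Type} {G : SimpleGraph V} {v : V}
    (x : ({v}ᶜ : Set V)) (hx : ∀ y, G.Adj v y ↔ y = x) :
    ∃ φ : G ≃g bridge (G.induce {v}ᶜ) x leaf.graph leaf.root,
      ∀ y : ({v}ᶜ : Set V), φ y = .inl y := by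
  classical
  let e : V ≃ ({v}ᶜ : Set V) ⊕ leaf.Vert :=
    { toFun := fun y => if h : y = v then .inr leaf.root else .inl ⟨y, h⟩
      invFun := Sum.elim Subtype.val fun _ => v
      left_inv := fun y => by
        by_cases h : y = v <;> simp [h]
      right_inv := by
        rintro (⟨y, hy⟩ | y)
        · have : y ≠ v := hy
          simp [this]
        · simp
          rfl }
  have hl : ∀ y : ({v}ᶜ : Set V), e y = .inl y := fun ⟨y, hy⟩ => by
    have : y ≠ v := hy
    simp [e, this]
  have hr : e v = .inr leaf.root := by simp [e]
  refine ⟨⟨e, ?_⟩, hl⟩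
  intro a b
  by_cases ha : a = v <;> by_cases hb : b = v
  · subst ha hb
    simp
  · subst ha
    lift b to ({a}ᶜ : Set V) using hb
    rw [hr, hl, bridge_inr_inl, hx]
    simp [Subtype.ext_iff]
  · subst hb
    lift a to ({b}ᶜ : Set V) using ha
    rw [hr, hl, bridge_inl_inr, G.adj_comm, hx]
    simp [Subtype.ext_iff]
  · lift a to ({v}ᶜ : Set V) using ha
    lift b to ({v}ᶜ : Set V) using hb
    rw [hl, hl, bridge_inl_inl]
    simp

/-- Every finite tree with a root is isomorphic to some `RTree`. -/
theorem exists_iso_of_isTree : ∀ (n : ℕ) {V : Type} [Fintype V] (G : SimpleGraph V),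
    G.IsTree → Fintype.card V = n → ∀ r : V, ∃ (t : RTree) (φ : G ≃g t.graph), φ r = t.root := by
  intro n
  induction n with
  | zero =>
    intro V _ G _ hn r
    exact absurd hn (Fintype.card_pos_iff.2 ⟨r⟩).ne'
  | succ n ih =>
    intro V _ G hG hn r
    classical
    by_cases h1 : n = 0
    · have hs : Subsingleton V := by
        rw [← Fintype.card_le_one_iff_subsingleton]
        omega
      have : Unique V := ⟨⟨r⟩, fun a => Subsingleton.elim a r⟩
      refine ⟨leaf, ⟨⟨fun _ => (), fun _ => r, fun _ => Subsingleton.elim _ _,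
        fun _ => rfl⟩, ?_⟩, rfl⟩
      intro a b
      rw [Subsingleton.elim a b]
      simp
    · have : Nontrivial V := Fintype.one_lt_card_iff_nontrivial.1 (by omega)
      -- A tree with at least two vertices has two leaves, so one of them is not the prescribed root
      -- and can be removed.
      obtain ⟨v, hvr, hv⟩ : ∃ v, r ≠ v ∧ G.degree v = 1 := by
        obtain ⟨a, b, hab, ha, hb⟩ := hG.exists_ne_and_degree_eq_one
        by_cases h : r = a
        · exact ⟨b, h ▸ hab, hb⟩
        · exact ⟨a, h, ha⟩
      have hT : (G.induce {v}ᶜ).IsTree :=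
        ⟨hG.1.induce_compl_singleton_of_degree_eq_one hv, hG.2.induce _⟩
      obtain ⟨x, hx, hx'⟩ := degree_eq_one_iff_existsUnique_adj.1 hv
      have hxv : x ∈ ({v}ᶜ : Set V) := fun h => G.ne_of_adj hx (Set.mem_singleton_iff.1 h).symm
      have hrv : r ∈ ({v}ᶜ : Set V) := fun h => hvr (Set.mem_singleton_iff.1 h)
      have hcard : Fintype.card ({v}ᶜ : Set V) = n := by
        rw [Fintype.card_compl_set, hn]
        simp
      obtain ⟨t, φ, hφ⟩ := ih (G.induce {v}ᶜ) hT hcard ⟨r, hrv⟩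
      obtain ⟨ψ, hψ⟩ := exists_iso_bridge_leaf (G := G) ⟨x, hxv⟩
        (fun y => ⟨fun h => hx' y h, fun h => h ▸ hx⟩)
      obtain ⟨χ, hχ⟩ := exists_bridge_iso_addAt t (φ ⟨x, hxv⟩) leaf
      refine ⟨_, (ψ.trans (bridgeCongr φ (RelIso.refl _) rfl rfl)).trans χ, ?_⟩
      rw [← hχ, ← hφ]
      change χ (bridgeCongr φ (RelIso.refl _) rfl rfl (ψ ((⟨r, hrv⟩ : ({v}ᶜ : Set V)) : V))) = _
      rw [hψ]
      rfl

lemma exists_iso (X : FinRootedTree) : ∃ (t : RTree) (φ : X.graph ≃g t.graph), φ X.root = t.root :=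
  exists_iso_of_isTree _ X.graph X.isTree rfl X.root

end RTree

/-! ### Grafts and decompositions -/

section Graft

open SimpleGraph

variable {V : Type} (H : SimpleGraph V) {ι κ : Type} (T : ι → FinRootedTree) (a : ι → V)

lemma graft_inl_inl {x y : V} : (graft H T a).Adj (.inl x) (.inl y) ↔ H.Adj x y := by
  rw [graft, SimpleGraph.fromRel_adj]
  constructor
  · rintro ⟨-, h | h⟩
    · cases h; assumption
    · cases h; exact SimpleGraph.Adj.symm (by assumption)
  · intro h
    exact ⟨fun e => h.ne (Sum.inl_injective e), Or.inl (GraftRel.base _ _ h)⟩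

lemma graft_inl_inr {x : V} {i : ι} {y : (T i).V} :
    (graft H T a).Adj (.inl x) (.inr ⟨i, y⟩) ↔ x = a i ∧ y = (T i).root := by
  rw [graft, SimpleGraph.fromRel_adj]
  constructor
  · rintro ⟨-, h | h⟩
    · cases h; exact ⟨rfl, rfl⟩
    · cases h
  · rintro ⟨rfl, rfl⟩
    exact ⟨Sum.inl_ne_inr, Or.inl (GraftRel.join i)⟩

lemma graft_inr_inl {x : V} {i : ι} {y : (T i).V} :
    (graft H T a).Adj (.inr ⟨i, y⟩) (.inl x) ↔ x = a i ∧ y = (T i).root := by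
  rw [SimpleGraph.adj_comm, graft_inl_inr]

lemma graft_inr_inr {i : ι} {x y : (T i).V} :
    (graft H T a).Adj (.inr ⟨i, x⟩) (.inr ⟨i, y⟩) ↔ (T i).graph.Adj x y := by
  rw [graft, SimpleGraph.fromRel_adj]
  constructor
  · rintro ⟨-, h | h⟩
    · cases h; assumption
    · cases h; exact SimpleGraph.Adj.symm (by assumption)
  · intro h
    refine ⟨fun e => h.ne ?_, Or.inl (GraftRel.branch _ _ _ h)⟩
    simpa using e

lemma not_graft_inr_inr {i j : ι} (hij : i ≠ j) {x : (T i).V} {y : (T j).V} :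
    ¬ (graft H T a).Adj (.inr ⟨i, x⟩) (.inr ⟨j, y⟩) := by
  rw [graft, SimpleGraph.fromRel_adj]
  rintro ⟨-, h | h⟩
  · cases h; exact hij rfl
  · cases h; exact hij rfl

/-- Reindexing a graft. -/
def graftReindex (e : κ ≃ ι) : graft H (fun k => T (e k)) (fun k => a (e k)) ≃g graft H T a where
  toEquiv := Equiv.sumCongr (Equiv.refl V) (Equiv.sigmaCongrLeft (β := fun i => (T i).V) e)
  map_rel_iff' := by
    rintro (x | ⟨i, x⟩) (y | ⟨j, y⟩)
    · exact (graft_inl_inl H T a).trans (graft_inl_inl H _ _).symm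
    · exact (graft_inl_inr H T a).trans (graft_inl_inr H (fun k => T (e k)) (fun k => a (e k))).symm
    · exact (graft_inr_inl H T a).trans (graft_inr_inl H (fun k => T (e k)) (fun k => a (e k))).symm
    · by_cases hij : i = j
      · subst hij
        exact (graft_inr_inr H T a).trans
          (graft_inr_inr H (fun k => T (e k)) (fun k => a (e k))).symm
      · exact iff_of_false (not_graft_inr_inr H T a (e.injective.ne hij))
          (not_graft_inr_inr H (fun k => T (e k)) _ hij)

/-- A graft of an `Option`-indexed family arises by a bridge. -/
def graftOption (T : Option κ → FinRootedTree) (a : Option κ → V) :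
    graft H T a ≃g bridge (graft H (fun k => T (some k)) (fun k => a (some k)))
      (.inl (a none)) (T none).graph (T none).root where
  toFun
    | .inl x => .inl (.inl x)
    | .inr ⟨some k, x⟩ => .inl (.inr ⟨k, x⟩)
    | .inr ⟨none, x⟩ => .inr x
  invFun
    | .inl (.inl x) => .inl x
    | .inl (.inr ⟨k, x⟩) => .inr ⟨some k, x⟩
    | .inr x => .inr ⟨none, x⟩
  left_inv := by rintro (x | ⟨_ | k, x⟩) <;> rfl
  right_inv := by rintro ((x | ⟨k, x⟩) | x) <;> rfl
  map_rel_iff' := by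
    rintro (x | ⟨_ | i, x⟩) (y | ⟨_ | j, y⟩)
    · exact (graft_inl_inl H _ _).trans (graft_inl_inl H _ _).symm
    · refine Iff.trans ?_ (graft_inl_inr H T a).symm
      exact and_congr_left fun _ => Sum.inl_injective.eq_iff
    · exact (graft_inl_inr H (fun k => T (some k)) _).trans (graft_inl_inr H T a).symm
    · refine Iff.trans ?_ (graft_inr_inl H T a).symm
      exact and_congr_left fun _ => Sum.inl_injective.eq_iff
    · exact (graft_inr_inr H T a).symm
    · refine iff_of_false ?_ (not_graft_inr_inr H T a (by simp))
      rintro ⟨h, -⟩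
      exact Sum.inr_ne_inl h
    · exact (graft_inr_inl H (fun k => T (some k)) _).trans (graft_inr_inl H T a).symm
    · refine iff_of_false ?_ (not_graft_inr_inr H T a (by simp))
      rintro ⟨h, -⟩
      exact Sum.inr_ne_inl h
    · by_cases hij : i = j
      · subst hij
        exact (graft_inr_inr H (fun k => T (some k)) _).trans (graft_inr_inr H T a).symm
      · exact iff_of_false (not_graft_inr_inr H (fun k => T (some k)) _ hij)
          (not_graft_inr_inr H T a (by simpa using hij))

/-- A graft of an empty family. -/
def graftEmpty [IsEmpty ι] : graft H T a ≃g H where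
  toEquiv := Equiv.sumEmpty _ _
  map_rel_iff' := by
    rintro (x | ⟨i, x⟩) (y | ⟨j, y⟩)
    · exact (graft_inl_inl H T a).symm
    · exact (IsEmpty.false j).elim
    · exact (IsEmpty.false i).elim
    · exact (IsEmpty.false i).elim

/-- A graft of a family with one more member arises by a bridge. -/
lemma exists_graft_iso_bridge (e : Option κ ≃ ι) {T' : κ → FinRootedTree} {a' : κ → V}
    (hT : ∀ k, T (e (some k)) = T' k) (ha : ∀ k, a (e (some k)) = a' k) :
    ∃ g : graft H T a ≃g bridge (graft H T' a') (.inl (a (e none))) (T (e none)).graph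
      (T (e none)).root, ∀ z, g (.inl z) = .inl (.inl z) := by
  obtain rfl : (fun k => T (e (some k))) = T' := funext hT
  obtain rfl : (fun k => a (e (some k))) = a' := funext ha
  exact ⟨(graftReindex H T a e).symm.trans
    (graftOption H (fun k => T (e k)) (fun k => a (e k))), fun _ => rfl⟩

end Graft

namespace FinRootedTree

/-- The rooted tree `X` is isomorphic to `t`. -/
def IsoTo (X : FinRootedTree) (t : RTree) : Prop :=
  ∃ φ : X.graph ≃g t.graph, φ X.root = t.root

lemma isoTo_toFinRooted (t : RTree) : t.toFinRooted.IsoTo t := ⟨RelIso.refl _, rfl⟩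

lemma forall₂_isoTo_map (ts : List RTree) :
    List.Forall₂ IsoTo (ts.map RTree.toFinRooted) ts :=
  List.forall₂_map_left_iff.2 (List.forall₂_same.2 fun t _ => isoTo_toFinRooted t)

end FinRootedTree

namespace RTree

open SimpleGraph FinRootedTree

/-- Links the branchings of the statement to the recursive trees: reindexing by `Option` peels off
the first branch, which becomes the last bridge. -/
lemma graft_iso_node {Ts : List FinRootedTree} {ts : List RTree} (h : List.Forall₂ IsoTo Ts ts) :
    ∃ ψ : graft (⊥ : SimpleGraph Unit) Ts.get (fun _ => ()) ≃g (node ts).graph,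
      ψ (.inl ()) = (node ts).root := by
  induction h with
  | nil => exact ⟨graftEmpty (ι := Fin 0) _ _ _, rfl⟩
  | @cons X t Ts ts hX _ ih =>
    obtain ⟨ψ, hψ⟩ := ih
    obtain ⟨φ, hφ⟩ := hX
    obtain ⟨g, hg⟩ := exists_graft_iso_bridge (⊥ : SimpleGraph Unit) (X :: Ts).get (fun _ => ())
      (finSuccEquiv Ts.length).symm (T' := Ts.get) (a' := fun _ => ()) (fun _ => rfl)
      (fun _ => rfl)
    refine ⟨g.trans (bridgeCongr ψ φ hψ hφ), ?_⟩
    change bridgeCongr ψ φ hψ hφ (g (.inl ())) = _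
    rw [hg]
    exact congrArg Sum.inl hψ

lemma isBranching_iff_iso {X : FinRootedTree} {Ts : List FinRootedTree} {ts : List RTree}
    (h : List.Forall₂ IsoTo Ts ts) : X.IsBranching Ts ↔ X.IsoTo (node ts) := by
  obtain ⟨ψ, hψ⟩ := graft_iso_node h
  constructor
  · rintro ⟨φ, hφ⟩
    exact ⟨φ.trans ψ, by rw [← hψ, ← hφ]; rfl⟩
  · rintro ⟨φ, hφ⟩
    exact ⟨φ.trans ψ.symm, (ψ.symm_apply_eq).2 (hφ.trans hψ.symm)⟩

/-! ### Trees with two distinguished vertices -/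

/-- The tree `x` inside a sequence of nested branchings; the entries of the list are the
additional branches at the vertices on the path from the root to the root of `x`. -/
def plug : List (List RTree) → RTree → RTree
  | [], x => x
  | F :: Fs, x => attach (node F) (plug Fs x)

/-- The vertex of `plug F x` which corresponds to the root of `x`. -/
def hole : (F : List (List RTree)) → (x : RTree) → (plug F x).Vert
  | [], x => x.root
  | _ :: Fs, x => .inr (hole Fs x)

/-- The path from the root to `w` is unrolled into frames. If `w` lies in `t`, the branch `a` of the
root is still unaccounted for: it joins the branches at `w` when `w` is the root, and otherwise the
first frame. -/
lemma exists_iso_plug : ∀ (c : RTree) (w : c.Vert), ∃ (F : List (List RTree)) (R : List RTree)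
    (φ : c.graph ≃g (plug F (node R)).graph), φ c.root = (plug F (node R)).root ∧
      φ w = hole F (node R)
  | leaf, _ => ⟨[], [], RelIso.refl _, rfl, rfl⟩
  | attach t a, .inr w => by
    obtain ⟨F, R, φ, h1, h2⟩ := exists_iso_plug a w
    obtain ⟨ψ, h3⟩ : t.Iso (node t.children) := by rw [node_children]; exact Iso.refl t
    exact ⟨t.children :: F, R, bridgeCongr ψ φ h3 h1, congrArg Sum.inl h3, congrArg Sum.inr h2⟩
  | attach t a, .inl w => by
    obtain ⟨F, R, φ, h1, h2⟩ := exists_iso_plug t w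
    cases F with
    | nil =>
      exact ⟨[], a :: R, bridgeCongr φ (RelIso.refl a.graph.Adj) h1 rfl, congrArg Sum.inl h1,
        congrArg Sum.inl h2⟩
    | cons F Fs =>
      let ω := bridgeRightComm (node F).graph (node F).root (node F).root
        (plug Fs (node R)).graph (plug Fs (node R)).root a.graph a.root
      let χ : (attach t a).graph ≃g (attach (attach (node F) (plug Fs (node R))) a).graph :=
        bridgeCongr φ (RelIso.refl a.graph.Adj) h1 rfl
      refine ⟨(a :: F) :: Fs, R, χ.trans ω, ?_, ?_⟩
      · change ω (Sum.inl (φ t.root)) = _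
        rw [h1]
        rfl
      · change ω (Sum.inl (φ w)) = _
        rw [h2]
        rfl

lemma exists_bridge_hole_iso : ∀ (F : List (List RTree)) (x c : RTree),
    ∃ φ : bridge (plug F x).graph (hole F x) c.graph c.root ≃g (plug F (attach x c)).graph,
      φ (.inl (plug F x).root) = (plug F (attach x c)).root ∧
      φ (.inl (hole F x)) = hole F (attach x c)
  | [], _, _ => ⟨RelIso.refl _, rfl, rfl⟩
  | F :: Fs, x, c => by
    obtain ⟨φ, h1, h2⟩ := exists_bridge_hole_iso Fs x c
    exact ⟨(bridgeAssoc _ _ _ _ _ _ _).trans (bridgeCongr (RelIso.refl _) φ rfl h1), rfl,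
      congrArg Sum.inr h2⟩

/-- Branches grafted at `v` and `w` are prepended to the lists at the two ends of the path. The
lists `L₀` and `R₀`, which belong to `H` itself, are empty precisely when `v` and `w` are leaves of
`H`. -/
lemma graft_iso_plug {V : Type} {H : SimpleGraph V} {v w : V} {F : List (List RTree)}
    {L₀ R₀ : List RTree} (φ : H ≃g (plug (L₀ :: F) (node R₀)).graph)
    (hv : φ v = (plug (L₀ :: F) (node R₀)).root) (hw : φ w = hole (L₀ :: F) (node R₀))
    {L R : List FinRootedTree} {l r : List RTree} (hL : List.Forall₂ IsoTo L l)
    (hR : List.Forall₂ IsoTo R r) :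
    ∃ ψ : graft H (ι := Fin L.length ⊕ Fin R.length) (Sum.elim L.get R.get)
        (Sum.elim (fun _ => v) (fun _ => w)) ≃g (plug ((l ++ L₀) :: F) (node (r ++ R₀))).graph,
      ψ (.inl v) = (plug ((l ++ L₀) :: F) (node (r ++ R₀))).root ∧
      ψ (.inl w) = hole ((l ++ L₀) :: F) (node (r ++ R₀)) := by
  induction hL with
  | nil =>
    induction hR with
    | nil => exact ⟨(graftEmpty (ι := Fin 0 ⊕ Fin 0) H _ _).trans φ, hv, hw⟩
    | @cons X t R r hX _ ih =>
      obtain ⟨ψ, h1, h2⟩ := ih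
      obtain ⟨χ, h3⟩ := hX
      obtain ⟨ω, h4, h5⟩ := exists_bridge_hole_iso (([] ++ L₀) :: F) (node (r ++ R₀)) t
      let e : Option (Fin 0 ⊕ Fin R.length) ≃ Fin 0 ⊕ Fin (R.length + 1) :=
        { toFun := fun o => o.elim (.inr 0) (Sum.map id Fin.succ)
          invFun := Sum.elim (fun i => i.elim0)
            (Fin.cases none fun i => some (.inr i))
          left_inv := by rintro (_ | i | i) <;> first | rfl | exact i.elim0
          right_inv := by
            rintro (i | i)
            · exact i.elim0
            · refine Fin.cases ?_ (fun i => ?_) i <;> rfl }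
      obtain ⟨g, hg⟩ := exists_graft_iso_bridge H (Sum.elim (List.get []) (X :: R).get)
        (Sum.elim (fun _ => v) (fun _ => w)) e (T' := Sum.elim (List.get []) R.get)
        (a' := Sum.elim (fun _ => v) (fun _ => w))
        (by rintro (k | k) <;> rfl)
        (by rintro (k | k) <;> rfl)
      refine ⟨g.trans ((bridgeCongr ψ χ h2 h3).trans ω), ?_, ?_⟩
      · change ω (bridgeCongr ψ χ h2 h3 (g (.inl v))) = _
        rw [hg]
        change ω (.inl (ψ (.inl v))) = _
        rw [h1, h4]
        rfl
      · change ω (bridgeCongr ψ χ h2 h3 (g (.inl w))) = _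
        rw [hg]
        change ω (.inl (ψ (.inl w))) = _
        rw [h2, h5]
        rfl
  | @cons X t L l hX _ ih =>
    obtain ⟨ψ, h1, h2⟩ := ih
    obtain ⟨χ, h3⟩ := hX
    let e : Option (Fin L.length ⊕ Fin R.length) ≃ Fin (L.length + 1) ⊕ Fin R.length :=
      { toFun := fun o => o.elim (.inl 0) (Sum.map Fin.succ id)
        invFun := Sum.elim (Fin.cases none fun i => some (.inl i))
          (fun i => some (.inr i))
        left_inv := by rintro (_ | i | i) <;> rfl
        right_inv := by
          rintro (i | i)
          · refine Fin.cases ?_ (fun i => ?_) i <;> rfl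
          · rfl }
    obtain ⟨g, hg⟩ := exists_graft_iso_bridge H (Sum.elim (X :: L).get R.get)
      (Sum.elim (fun _ => v) (fun _ => w)) e (T' := Sum.elim L.get R.get)
      (a' := Sum.elim (fun _ => v) (fun _ => w))
      (by rintro (k | k) <;> rfl) (by rintro (k | k) <;> rfl)
    let ω := bridgeRightComm (node (l ++ L₀)).graph (node (l ++ L₀)).root (node (l ++ L₀)).root
      (plug F (node (r ++ R₀))).graph (plug F (node (r ++ R₀))).root t.graph t.root
    refine ⟨g.trans ((bridgeCongr ψ χ h1 h3).trans ω), ?_, ?_⟩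
    · change ω (bridgeCongr ψ χ h1 h3 (g (.inl v))) = _
      rw [hg]
      change ω (.inl (ψ (.inl v))) = _
      rw [h1]
      rfl
    · change ω (bridgeCongr ψ χ h1 h3 (g (.inl w))) = _
      rw [hg]
      change ω (.inl (ψ (.inl w))) = _
      rw [h2]
      rfl

/-! ### Degrees -/

lemma sum_deg_bridge {V W : Type} [Fintype V] [Fintype W] [DecidableEq V] [DecidableEq W]
    (G : SimpleGraph V) (v : V) (X : SimpleGraph W) (u : W) (e : ℕ) :
    ∑ x, ({((bridge G v X u).neighborSet x).ncard + if x = .inl v then e else 0} : Multiset ℕ) =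
      ∑ x, {(G.neighborSet x).ncard + if x = v then e + 1 else 0} +
        ∑ x, {(X.neighborSet x).ncard + if x = u then 1 else 0} := by
  rw [Fintype.sum_sum_type]
  congr 1
  · refine Finset.sum_congr rfl fun x _ => ?_
    rw [ncard_neighborSet_bridge_inl]
    simp only [Sum.inl.injEq]
    split_ifs <;> simp [add_assoc, add_comm]
  · refine Finset.sum_congr rfl fun x _ => ?_
    rw [ncard_neighborSet_bridge_inr]
    simp

/-- The multiset of the degrees of the vertices other than the root. -/
def innerDegs : RTree → Multiset ℕ
  | leaf => 0
  | attach t c => t.innerDegs + ((c.children.length + 1) ::ₘ c.innerDegs)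

/-- The surplus `e` at the root is what makes the induction work: within `attach t c` the root of
`t` has one neighbour more than within `t`, and the root of `c` one more than within `c`. -/
lemma sum_deg_add_root : ∀ (t : RTree) (e : ℕ),
    ∑ v, ({(t.graph.neighborSet v).ncard + if v = t.root then e else 0} : Multiset ℕ) =
      (t.children.length + e) ::ₘ t.innerDegs
  | leaf, e => by
    have h : leaf.graph.neighborSet leaf.root = ∅ := by
      ext x
      exact iff_of_false (fun h => h) (fun h => h)
    have h2 : (Finset.univ : Finset leaf.Vert) = {leaf.root} := rfl
    rw [h2, Finset.sum_singleton, h]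
    simp [children, innerDegs]
  | attach t c, e => by
    refine (sum_deg_bridge t.graph t.root c.graph c.root e).trans ?_
    rw [sum_deg_add_root t (e + 1), sum_deg_add_root c 1]
    simp only [children, innerDegs, List.length_cons, Multiset.cons_add]
    congr 1
    ring

/-- The multiset of all degrees. -/
def degs (t : RTree) : Multiset ℕ := t.children.length ::ₘ t.innerDegs

lemma degSeq_toFinTree (t : RTree) : t.toFinTree.degSeq = t.degs.sort (· ≥ ·) := by
  have h := sum_deg_add_root t 0
  simp only [ite_self, add_zero] at h
  rw [FinTree.degSeq, degs, ← h, ← Multiset.sum_map_singleton (Multiset.map _ _),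
    Multiset.map_map]
  rfl

lemma ncard_neighborSet_root : ∀ t : RTree, (t.graph.neighborSet t.root).ncard = t.children.length
  | leaf => by
    have h : leaf.graph.neighborSet leaf.root = ∅ := by
      ext x
      exact iff_of_false (fun h => h) (fun h => h)
    rw [h]
    simp [children]
  | attach t c => by
    refine (ncard_neighborSet_bridge_inl t.graph t.root c.graph c.root t.root).trans ?_
    rw [ncard_neighborSet_root t]
    simp [children]

lemma ncard_neighborSet_hole (x : RTree) : ∀ (Fs : List (List RTree)) (F : List RTree),
    ((plug (F :: Fs) x).graph.neighborSet (hole (F :: Fs) x)).ncard = x.children.length + 1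
  | [], F => by
    refine (ncard_neighborSet_bridge_inr (node F).graph (node F).root x.graph x.root x.root).trans ?_
    rw [ncard_neighborSet_root x]
    simp
  | F' :: Fs, F => by
    refine (ncard_neighborSet_bridge_inr (node F).graph (node F).root (plug (F' :: Fs) x).graph
      (plug (F' :: Fs) x).root (hole (F' :: Fs) x)).trans ?_
    rw [ncard_neighborSet_hole x Fs F', if_neg]
    exact Sum.inr_ne_inl

/-! ### Compatibility as an exchange property of ordered trees -/

lemma isDecomp_plug (F : List (List RTree)) {L R : List FinRootedTree} {l r : List RTree}
    (hL : List.Forall₂ IsoTo L l) (hR : List.Forall₂ IsoTo R r) (T : FinTree) :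
    T.IsDecomp L (plug ([] :: F) leaf).toFinTree (plug ([] :: F) leaf).root (hole ([] :: F) leaf) R
      ↔ Nonempty (T.graph ≃g (plug (l :: F) (node r)).graph) := by
  have key := graft_iso_plug (H := (plug ([] :: F) leaf).graph) (F := F) (L₀ := [])
    (R₀ := []) (RelIso.refl _) rfl rfl hL hR
  rw [List.append_nil, List.append_nil] at key
  obtain ⟨ψ, -, -⟩ := key
  exact ⟨fun ⟨φ⟩ => ⟨φ.trans ψ⟩, fun ⟨φ⟩ => ⟨φ.trans ψ.symm⟩⟩

lemma exists_iso_plug_cons (H : FinTree) (v w : H.V) (hvw : v ≠ w) :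
    ∃ (L₀ : List RTree) (F : List (List RTree)) (R₀ : List RTree)
      (φ : H.graph ≃g (plug (L₀ :: F) (node R₀)).graph),
      φ v = (plug (L₀ :: F) (node R₀)).root ∧ φ w = hole (L₀ :: F) (node R₀) := by
  obtain ⟨t, φ, hφ⟩ := exists_iso ⟨H, v⟩
  obtain ⟨F, R, ψ, h1, h2⟩ := exists_iso_plug t (φ w)
  have h3 : (φ.trans ψ) v = (plug F (node R)).root := by
    rw [← h1, ← hφ]
    rfl
  have h4 : (φ.trans ψ) w = hole F (node R) := h2
  cases F with
  | nil => exact absurd ((φ.trans ψ).injective (h3.trans h4.symm)) hvw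
  | cons L₀ F => exact ⟨L₀, F, R, φ.trans ψ, h3, h4⟩

/-- The exchange property of a maximum-compatible invariant, in terms of ordered trees. -/
theorem exchange_of_maxCompatible {ρ : FinRootedTree → ℝ} {I : FinTree → ℝ}
    (hI : IsTreeInvariant I) (h : MaxCompatible ρ I) (F : List (List RTree))
    {L R Ts : List RTree} {s : ℕ} (hp : (L ++ R).Perm Ts)
    (hs : Ts.Pairwise fun X Y => ρ X.toFinRooted ≥ ρ Y.toFinRooted) (h1 : Ts.length ≤ 2 * s)
    (h2 : s ≤ Ts.length) (h3 : Ts.length - s ≤ L.length) (h4 : L.length ≤ s) :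
    I (plug (L :: F) (node R)).toFinTree ≤ I (plug (Ts.take s :: F) (node (Ts.drop s))).toFinTree ∨
    I (plug (L :: F) (node R)).toFinTree ≤
      I (plug (Ts.drop s :: F) (node (Ts.take s))).toFinTree := by
  have hne : (plug ([] :: F) leaf).root ≠ hole ([] :: F) leaf := Sum.inl_ne_inr
  obtain ⟨T, hT, hmax⟩ := h (plug ([] :: F) leaf).toFinTree (plug ([] :: F) leaf).root
    (hole ([] :: F) leaf) hne (ncard_neighborSet_root (plug ([] :: F) leaf))
    (ncard_neighborSet_hole leaf F []) (Ts.map toFinRooted) (List.pairwise_map.2 hs) s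
    (by simpa using h1) (by simpa using h2)
  have hle : I (plug (L :: F) (node R)).toFinTree ≤ I T := by
    refine hmax.2 ⟨_, ⟨L.map toFinRooted, R.map toFinRooted, ?_, ?_, ?_, ?_⟩, rfl⟩
    · rw [← List.map_append]
      exact hp.map _
    · simpa using h3
    · simpa using h4
    · exact (isDecomp_plug F (forall₂_isoTo_map L) (forall₂_isoTo_map R) _).2 ⟨RelIso.refl _⟩
  rw [← List.map_take, ← List.map_drop,
    isDecomp_plug F (forall₂_isoTo_map _) (forall₂_isoTo_map _),
    isDecomp_plug F (forall₂_isoTo_map _) (forall₂_isoTo_map _)] at hT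
  rcases hT with hT | hT
  · exact Or.inl (hle.trans_eq (hI _ _ hT))
  · exact Or.inr (hle.trans_eq (hI _ _ hT))

end RTree

namespace RTree

/-! ### Assembling trees from given branches and vertices of given degrees -/

/-- The forest `ts` consists of the items `A` together with trees that are assembled from the items
`I` and further vertices whose degrees (including the edge to the parent) are given by `D`. -/
inductive Assembled : Multiset RTree → Multiset RTree → Multiset ℕ → List RTree → Prop
  | nil : Assembled 0 0 0 []
  | item (a : RTree) {A I : Multiset RTree} {D : Multiset ℕ} {ts : List RTree}
      (h : Assembled A I D ts) : Assembled ({a} + A) I D (a :: ts)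
  -- The items `A'` among the children of the new vertex are no longer on the top level, so they
  -- join the inner items.
  | node {A I A' I' : Multiset RTree} {D D' : Multiset ℕ} {ts us : List RTree}
      (h : Assembled A I D ts) (h' : Assembled A' I' D' us) :
      Assembled A (I + (A' + I')) (D + ({us.length + 1} + D')) (RTree.node us :: ts)

namespace Assembled

variable {A A' I I' : Multiset RTree} {D D' : Multiset ℕ} {ts us : List RTree}

lemma congr (h : Assembled A I D ts) (hA : A = A') (hI : I = I') (hD : D = D') :
    Assembled A' I' D' ts := by
  subst hA hI hD
  exact h

lemma append (h : Assembled A I D ts) (h' : Assembled A' I' D' us) :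
    Assembled (A + A') (I + I') (D + D') (ts ++ us) := by
  induction h with
  | nil => simpa using h'
  | item a _ ih => exact (item a ih).congr (by abel) rfl rfl
  | node _ h ih _ => exact (node ih h).congr rfl (by abel) (by abel)

lemma of_list (l : List RTree) : Assembled l 0 0 l := by
  induction l with
  | nil => exact nil
  | cons a l ih => exact item a ih

lemma eq_zero_of_nil (h : Assembled A I D []) : A = 0 ∧ I = 0 ∧ D = 0 := by
  cases h
  exact ⟨rfl, rfl, rfl⟩

lemma exists_split : ∀ {ts us : List RTree} {A I : Multiset RTree} {D : Multiset ℕ},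
    Assembled A I D (ts ++ us) → ∃ A₁ I₁ D₁ A₂ I₂ D₂, Assembled A₁ I₁ D₁ ts ∧
      Assembled A₂ I₂ D₂ us ∧ A = A₁ + A₂ ∧ I = I₁ + I₂ ∧ D = D₁ + D₂
  | [], _, _, _, _, h => ⟨0, 0, 0, _, _, _, nil, h, by simp, by simp, by simp⟩
  | t :: ts, us, _, _, _, h => by
    rw [List.cons_append] at h
    cases h with
    | item a h =>
      obtain ⟨A₁, I₁, D₁, A₂, I₂, D₂, h1, h2, rfl, rfl, rfl⟩ := exists_split h
      exact ⟨_, _, _, _, _, _, item _ h1, h2, by abel, rfl, rfl⟩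
    | node h h' =>
      obtain ⟨A₁, I₁, D₁, A₂, I₂, D₂, h1, h2, rfl, rfl, rfl⟩ := exists_split h
      exact ⟨_, _, _, _, _, _, node h1 h', h2, rfl, by abel, by abel⟩

lemma perm (h : Assembled A I D ts) (hp : ts.Perm us) : Assembled A I D us := by
  induction hp generalizing A I D with
  | nil => exact h
  | cons x _ ih =>
    cases h with
    | item _ h => exact item _ (ih h)
    | node h h' => exact node (ih h) h'
  | swap x y l =>
    obtain ⟨A₁, I₁, D₁, A₂, I₂, D₂, h1, h2, rfl, rfl, rfl⟩ := exists_split (ts := [y]) h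
    obtain ⟨A₃, I₃, D₃, A₄, I₄, D₄, h3, h4, rfl, rfl, rfl⟩ := exists_split (ts := [x]) h2
    exact (h3.append (h1.append h4)).congr (by abel) (by abel) (by abel)
  | trans _ _ ih ih' => exact ih' (ih h)

/-- The items can be separated from the assembled trees. -/
lemma exists_perm (h : Assembled A I D ts) :
    ∀ l : List RTree, (l : Multiset RTree) = A → ∃ N, ts.Perm (l ++ N) ∧ Assembled 0 I D N := by
  induction h with
  | nil =>
    intro l hl
    rw [Multiset.coe_eq_zero] at hl
    subst hl
    exact ⟨[], List.Perm.refl _, nil⟩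
  | @item a A I D ts _ ih =>
    intro l hl
    obtain ⟨N, h1, h2⟩ := ih A.toList (Multiset.coe_toList A)
    refine ⟨N, ?_, h2⟩
    have h3 : (a :: A.toList).Perm l := by
      rw [← Multiset.coe_eq_coe, hl, ← Multiset.cons_coe, Multiset.coe_toList]
      rfl
    exact (h1.cons a).trans (h3.append_right N)
  | node _ h ih _ =>
    intro l hl
    obtain ⟨N, h1, h2⟩ := ih l hl
    exact ⟨_, (h1.cons _).trans List.perm_middle.symm, node h2 h⟩

/-- Count the objects (items and further vertices) that are not on the top level: each is a child of
one of the vertices counted by `D`, and a vertex of degree `x` has `x - 1` children. -/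
lemma card_eq (h : Assembled A I D ts) :
    (A + I).card + 2 * D.card = D.sum + ts.length := by
  induction h with
  | nil => simp
  | item a _ ih => simp at ih ⊢; omega
  | node _ _ ih ih' => simp at ih ih' ⊢; omega

lemma eq_zero_of_card_eq_zero (h : Assembled A I D ts) (hD : D = 0) :
    I = 0 ∧ (ts : Multiset RTree) = A := by
  induction h with
  | nil => simp
  | item a _ ih =>
    obtain ⟨h1, h2⟩ := ih hD
    exact ⟨h1, by rw [← h2]; rfl⟩
  | node _ _ _ _ =>
    have := congrArg Multiset.card hD
    simp at this

/-- An invariant of the items and the assembled branches. -/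
lemma forall_mem (h : Assembled A I D ts) {P Q : RTree → Prop} (hA : ∀ a ∈ A + I, P a)
    (hQ : ∀ us : List RTree, us.length + 1 ∈ D → (∀ u ∈ us, P u ∨ Q u) → Q (RTree.node us)) :
    ∀ t ∈ ts, t ∈ A ∨ Q t := by
  induction h with
  | nil => simp
  | @item a A I D ts _ ih =>
    intro t ht
    rcases List.mem_cons.1 ht with rfl | ht
    · exact Or.inl (by simp)
    · rcases ih (fun b hb => hA b (by simp at hb ⊢; tauto)) hQ t ht with h | h
      · exact Or.inl (by simp [h])
      · exact Or.inr h
  | @node A I A' I' D D' ts us _ _ ih ih' =>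
    have h1 := ih' (fun b hb => hA b (by simp at hb ⊢; tauto))
      (fun vs hvs => hQ vs (by simp at hvs ⊢; tauto))
    intro t ht
    rcases List.mem_cons.1 ht with rfl | ht
    · refine Or.inr (hQ us (by simp) fun u hu => (h1 u hu).imp_left fun hu => hA u ?_)
      simp [hu]
    · exact ih (fun b hb => hA b (by simp at hb ⊢; tauto))
        (fun vs hvs => hQ vs (by simp at hvs ⊢; tauto)) t ht

/-- The degrees of the vertices on the path described by `F`. -/
def _root_.RTree.pathDegs (F : List (List RTree)) : Multiset ℕ :=
  (F.map fun K => K.length + 2 : List ℕ)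

lemma plug {A₂ I₂ : Multiset RTree} {D₂ : Multiset ℕ} {R : List RTree}
    (hR : Assembled A₂ I₂ D₂ R) : ∀ {F : List (List RTree)} {A₁ I₁ D₁},
    Assembled A₁ I₁ D₁ F.flatten →
    Assembled 0 (A₁ + I₁ + (A₂ + I₂)) (D₁ + pathDegs F + ({R.length + 1} + D₂))
      [RTree.plug F (RTree.node R)]
  | [], _, _, _, h => by
    obtain ⟨rfl, rfl, rfl⟩ := h.eq_zero_of_nil
    exact (node nil hR).congr rfl (by simp) (by simp [pathDegs])
  | F₀ :: F, _, _, _, h => by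
    rw [List.flatten_cons] at h
    obtain ⟨A₃, I₃, D₃, A₄, I₄, D₄, h3, h4, rfl, rfl, rfl⟩ := exists_split h
    have h5 := (plug hR h4).append h3
    refine (node nil h5).congr rfl (by abel) ?_
    have h6 : pathDegs (F₀ :: F) = {F₀.length + 2} + pathDegs F := rfl
    rw [h6, zero_add]
    have h7 : (([RTree.plug F (RTree.node R)] ++ F₀).length + 1) = F₀.length + 2 := by simp
    rw [h7]
    abel

/-- An item that is not on the top level, or an inner vertex of given degree, can be located. -/
lemma locate (h : Assembled A I D ts) (z : RTree ⊕ ℕ) (hz : Sum.elim (· ∈ I) (· ∈ D) z) :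
    ∃ (L : List RTree) (F : List (List RTree)) (R : List RTree)
      (AF IF AR IR IL : Multiset RTree) (DF DR DL : Multiset ℕ),
      (RTree.node ts).Iso (RTree.plug (L :: F) (RTree.node R)) ∧ L.length + 1 = ts.length ∧
      Assembled A IL DL L ∧ Assembled AF IF DF F.flatten ∧ Assembled AR IR DR R ∧
      Sum.elim (· ∈ AR) (· = R.length + 1) z ∧ I = IL + (AF + IF) + (AR + IR) ∧
      D = DL + (DF + pathDegs F) + ({R.length + 1} + DR) := by
  induction h with
  | nil => rcases z with z | z <;> simp at hz
  | item a h ih =>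
    obtain ⟨L, F, R, AF, IF, AR, IR, IL, DF, DR, DL, h1, h2, h3, h4, h5, h6, h7, h8⟩ := ih hz
    exact ⟨a :: L, F, R, AF, IF, AR, IR, IL, DF, DR, DL,
      (h1.attach (Iso.refl a)).trans (Iso.swap _ _ _), by simp [h2], item a h3, h4, h5, h6, h7, h8⟩
  | @node A I A' I' D D' ts us h h' ih ih' =>
    have hz' : Sum.elim (· ∈ I) (· ∈ D) z ∨ Sum.elim (· ∈ A') (· = us.length + 1) z ∨
        Sum.elim (· ∈ I') (· ∈ D') z := by
      rcases z with z | z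
      · simpa using hz
      · simp at hz ⊢
        tauto
    rcases hz' with hz' | hz' | hz'
    · obtain ⟨L, F, R, AF, IF, AR, IR, IL, DF, DR, DL, h1, h2, h3, h4, h5, h6, h7, h8⟩ := ih hz'
      exact ⟨RTree.node us :: L, F, R, AF, IF, AR, IR, _, DF, DR, _,
        (h1.attach (Iso.refl _)).trans (Iso.swap _ _ _), by simp [h2], node h3 h', h4, h5, h6,
        by rw [h7]; abel, by rw [h8]; abel⟩
    · exact ⟨ts, [], us, 0, 0, A', I', I, 0, D', D, Iso.refl _, rfl, h, nil, h', hz', by abel, by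
        simp [pathDegs]⟩
    · obtain ⟨L, F, R, AF, IF, AR, IR, IL, DF, DR, DL, h1, h2, h3, h4, h5, h6, h7, h8⟩ := ih' hz'
      refine ⟨ts, L :: F, R, A' + AF, IL + IF, AR, IR, I, DL + DF, DR, D,
        (Iso.refl _).attach h1, rfl, h, h3.append h4, h5, h6, by rw [h7]; abel, ?_⟩
      have h9 : pathDegs (L :: F) = {L.length + 2} + pathDegs F := rfl
      rw [h8, h9, ← h2]
      abel

end Assembled

/-- The tree with branches `ts` at its root is assembled from the items `I` and vertices whose
degrees are given by `D`. -/
def Whole (I : Multiset RTree) (D : Multiset ℕ) (ts : List RTree) : Prop :=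
  ∃ A I' D', Assembled A I' D' ts ∧ I = A + I' ∧ D = {ts.length} + D'

/-- The root has no parent edge, which accounts for the constant `2`. This identity is what
guarantees later that a queue contains sufficiently many items. -/
lemma Whole.card_eq {I : Multiset RTree} {D : Multiset ℕ} {ts : List RTree} (h : Whole I D ts) :
    I.card + 2 * D.card = D.sum + 2 := by
  obtain ⟨A, I', D', h, rfl, rfl⟩ := h
  have := h.card_eq
  simp at this ⊢
  omega

lemma whole_plug {L R : List RTree} {F : List (List RTree)} {AL IL AF IF AR IR : Multiset RTree}
    {DL DF DR : Multiset ℕ} (hL : Assembled AL IL DL L) (hF : Assembled AF IF DF F.flatten)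
    (hR : Assembled AR IR DR R) :
    Whole (AL + IL + (AF + IF) + (AR + IR))
      ({L.length + 1} + DL + (DF + pathDegs F) + ({R.length + 1} + DR))
      (plug F (node R) :: L) := by
  refine ⟨_, _, _, (hR.plug hF).append hL, by abel, ?_⟩
  rw [List.length_cons]
  abel

lemma Assembled.reverse_frames {A I : Multiset RTree} {D : Multiset ℕ} {F : List (List RTree)}
    (h : Assembled A I D F.flatten) : Assembled A I D F.reverse.flatten :=
  h.perm (List.Perm.flatten F.reverse_perm.symm)

lemma pathDegs_reverse (F : List (List RTree)) : pathDegs F.reverse = pathDegs F := by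
  rw [pathDegs, pathDegs, Multiset.coe_eq_coe]
  exact F.reverse_perm.map _

lemma plug_append_singleton (F₀ : List RTree) (x : RTree) : ∀ F : List (List RTree),
    RTree.plug (F ++ [F₀]) x = RTree.plug F (RTree.attach (RTree.node F₀) x)
  | [] => rfl
  | F :: Fs => congrArg (RTree.attach (RTree.node F)) (plug_append_singleton F₀ x Fs)

/-! ### Exchanging branches -/

/-- `J` is an invariant of (unrooted) trees with the exchange property with respect to `ρ`. -/
structure Exchangeable (ρ J : RTree → ℝ) : Prop where
  iso : ∀ {t s : RTree}, t.Iso s → J t = J s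
  comm : ∀ t s : RTree, J (attach t s) = J (attach s t)
  exchange : ∀ (F : List (List RTree)) {L R Ts : List RTree} {s : ℕ}, (L ++ R).Perm Ts →
    Ts.Pairwise (fun X Y => ρ X ≥ ρ Y) → Ts.length ≤ 2 * s → s ≤ Ts.length →
    Ts.length - s ≤ L.length → L.length ≤ s →
    J (plug (L :: F) (node R)) ≤ J (plug (Ts.take s :: F) (node (Ts.drop s))) ∨
    J (plug (L :: F) (node R)) ≤ J (plug (Ts.drop s :: F) (node (Ts.take s)))

namespace Exchangeable

variable {ρ J : RTree → ℝ} (E : Exchangeable ρ J)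
include E

/-- The root travels along the path to the other end. Each application of `comm` crosses one edge
and turns the part left behind into a branch at the next vertex. -/
theorem reverse (R : List RTree) : ∀ (F : List (List RTree)) (L : List RTree),
    J (plug (L :: F) (node R)) = J (plug (R :: F.reverse) (node L))
  | [], L => E.comm _ _
  | F₀ :: F, L => by
    have h := reverse R F (node L :: F₀)
    rw [List.reverse_cons, ← List.cons_append, plug_append_singleton]
    refine Eq.trans ?_ h
    exact (E.comm _ _).trans (E.iso (Iso.swap _ _ _))

lemma perm_root {L L' : List RTree} (h : L.Perm L') (F : List (List RTree)) (x : RTree) :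
    J (plug (L :: F) x) = J (plug (L' :: F) x) :=
  E.iso ((Iso.node_perm h).attach (Iso.refl _))

/-- Since `J` does not see the root, a vertex of any prescribed degree in `D` can be made the root
by reversing the path to it. -/
lemma exists_root {I : Multiset RTree} {D : Multiset ℕ} {ts : List RTree} (h : Whole I D ts)
    {d : ℕ} (hd : d ∈ D) : ∃ ts', ts'.length = d ∧ Whole I D ts' ∧ J (node ts) = J (node ts') := by
  obtain ⟨A, I', D', h, rfl, rfl⟩ := h
  rcases Multiset.mem_add.1 hd with hd | hd
  · exact ⟨ts, (Multiset.mem_singleton.1 hd).symm, ⟨A, I', D', h, rfl, rfl⟩, rfl⟩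
  · obtain ⟨L, F, R, AF, IF, AR, IR, IL, DF, DR, DL, h1, h2, h3, h4, h5, h6, rfl, rfl⟩ :=
      h.locate (.inr d) hd
    have h7 : d = R.length + 1 := h6
    refine ⟨plug F.reverse (node L) :: R, by simp [h7], ?_, ?_⟩
    · convert whole_plug h5 h4.reverse_frames h3 using 1
      · abel
      · rw [h2, pathDegs_reverse]
        abel
    · rw [E.iso h1, E.reverse]
      rfl

end Exchangeable

lemma exists_sorted (ρ : RTree → ℝ) (l : List RTree) :
    ∃ l', l.Perm l' ∧ l'.Pairwise fun X Y => ρ X ≥ ρ Y := by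
  classical
  let r : RTree → RTree → Prop := fun X Y => ρ X ≥ ρ Y
  have : Std.Total r := ⟨fun a b => le_total (ρ b) (ρ a)⟩
  have : IsTrans RTree r := ⟨fun a b c h h' => le_trans (show ρ c ≤ ρ b from h') h⟩
  exact ⟨l.insertionSort r, (List.perm_insertionSort r l).symm, List.pairwise_insertionSort r l⟩

/-- Branches at a vertex of degree `d` can be collected from the vertex and another one, preferring
the ones that are better. -/
def Collects (J : RTree → ℝ) (better : RTree → RTree → Prop) (D : Multiset ℕ) (d : ℕ) : Prop :=
  ∀ (F : List (List RTree)) (L R U V : List RTree), L.length + 1 = d → R.length + 1 ∈ D →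
    (L ++ R).Perm (U ++ V) → U.length ≤ L.length → (∀ a ∈ U, ∀ b ∈ V, better a b) →
    ∃ (Z Y : List RTree) (F' : List (List RTree)), V.Perm (Z ++ Y) ∧ (F' = F ∨ F' = F.reverse) ∧
      (U ++ Z).length = L.length ∧
      J (plug (L :: F) (node R)) ≤ J (plug ((U ++ Z) :: F') (node Y))

namespace Exchangeable

variable {ρ J : RTree → ℝ} (E : Exchangeable ρ J)
include E

/-- A vertex of maximal degree has at least as many branches as the other vertex, so the exchange
with `s = L.length` is available: the largest branches, namely `U` and the largest members of `V`,
move to one vertex. If this is the far end of the path, the path is reversed. -/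
lemma collects_of_max {D : Multiset ℕ} {d : ℕ} (hd : ∀ x ∈ D, x ≤ d) :
    Collects J (fun a b => ρ b ≤ ρ a) D d := by
  intro F L R U V hL hR hp hU hb
  obtain ⟨U', hU', hsU⟩ := exists_sorted ρ U
  obtain ⟨V', hV', hsV⟩ := exists_sorted ρ V
  have hRL : R.length ≤ L.length := by
    have := hd _ hR
    omega
  have hp' : (L ++ R).Perm (U' ++ V') := hp.trans (hU'.append hV')
  have hlen := hp'.length_eq
  have hlU := hU'.length_eq
  have hlV := hV'.length_eq
  simp only [List.length_append] at hlen
  have hsort : (U' ++ V').Pairwise fun X Y => ρ X ≥ ρ Y :=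
    List.pairwise_append.2 ⟨hsU, hsV, fun a ha b hb' =>
      hb a (hU'.mem_iff.2 ha) b (hV'.mem_iff.2 hb')⟩
  have htake : (U' ++ V').take L.length = U' ++ V'.take (L.length - U'.length) := by
    rw [List.take_append, List.take_of_length_le (by omega)]
  have hdrop : (U' ++ V').drop L.length = V'.drop (L.length - U'.length) := by
    rw [List.drop_append, List.drop_of_length_le (by omega), List.nil_append]
  have hex := E.exchange F hp' hsort (s := L.length) (by simp; omega) (by simp; omega)
    (by simp; omega) le_rfl
  rw [htake, hdrop] at hex
  have hpU : (U' ++ V'.take (L.length - U'.length)).Perm (U ++ V'.take (L.length - U'.length)) :=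
    hU'.symm.append_right _
  refine ⟨V'.take (L.length - U'.length), V'.drop (L.length - U'.length), ?_⟩
  have hV'' : V.Perm (V'.take (L.length - U'.length) ++ V'.drop (L.length - U'.length)) := by
    rwa [List.take_append_drop]
  have hl : (U ++ V'.take (L.length - U'.length)).length = L.length := by
    simp
    omega
  rcases hex with hex | hex
  · exact ⟨F, hV'', Or.inl rfl, hl, hex.trans_eq (E.perm_root hpU F _)⟩
  · exact ⟨F.reverse, hV'', Or.inr rfl, hl,
      hex.trans_eq ((E.reverse _ _ _).trans (E.perm_root hpU _ _))⟩

/-- Dual to the case of maximal degree: the exchange with `s = R.length` moves the largest branches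
to one vertex, and the smallest ones, which include `U`, are what the vertex with `L.length`
branches retains. -/
lemma collects_of_min {D : Multiset ℕ} {d : ℕ} (hd : ∀ x ∈ D, d ≤ x) :
    Collects J (fun a b => ρ a ≤ ρ b) D d := by
  intro F L R U V hL hR hp hU hb
  obtain ⟨U', hU', hsU⟩ := exists_sorted ρ U
  obtain ⟨V', hV', hsV⟩ := exists_sorted ρ V
  have hRL : L.length ≤ R.length := by
    have := hd _ hR
    omega
  have hp' : (L ++ R).Perm (V' ++ U') :=
    (hp.trans (hU'.append hV')).trans List.perm_append_comm
  have hlen := hp'.length_eq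
  have hlU := hU'.length_eq
  have hlV := hV'.length_eq
  simp only [List.length_append] at hlen
  have hsort : (V' ++ U').Pairwise fun X Y => ρ X ≥ ρ Y :=
    List.pairwise_append.2 ⟨hsV, hsU, fun a ha b hb' =>
      hb b (hU'.mem_iff.2 hb') a (hV'.mem_iff.2 ha)⟩
  have htake : (V' ++ U').take R.length = V'.take R.length := by
    rw [List.take_append_of_le_length (by omega)]
  have hdrop : (V' ++ U').drop R.length = V'.drop R.length ++ U' := by
    rw [List.drop_append_of_le_length (by omega)]
  have hex := E.exchange F hp' hsort (s := R.length) (by simp; omega) (by simp; omega)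
    (by simp; omega) hRL
  rw [htake, hdrop] at hex
  have hpU : (V'.drop R.length ++ U').Perm (U ++ V'.drop R.length) :=
    List.perm_append_comm.trans (hU'.symm.append_right _)
  refine ⟨V'.drop R.length, V'.take R.length, ?_⟩
  have hV'' : V.Perm (V'.drop R.length ++ V'.take R.length) :=
    (hV'.trans (by rw [List.take_append_drop])).trans List.perm_append_comm
  have hl : (U ++ V'.drop R.length).length = L.length := by
    simp
    omega
  rcases hex with hex | hex
  · exact ⟨F.reverse, hV'', Or.inr rfl, hl,
      hex.trans_eq ((E.reverse _ _ _).trans (E.perm_root hpU _ _))⟩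
  · exact ⟨F, hV'', Or.inl rfl, hl, hex.trans_eq (E.perm_root hpU F _)⟩

/-- If the items `K` are better than all other branches, they can be collected at one vertex of
degree `d`. -/
theorem collect {better : RTree → RTree → Prop} {D : Multiset ℕ} {d : ℕ}
    (hc : Collects J better D d) (hd : d ∈ D) (hD : 2 ≤ D.card) {I : Multiset RTree}
    {K : List RTree} (hK : (K : Multiset RTree) ≤ I) (hKd : K.length + 1 = d)
    (hbI : ∀ a ∈ K, ∀ b ∈ I - (K : Multiset RTree), better a b)
    (hbN : ∀ {I' D' N}, Assembled 0 I' D' N → I' ≤ I → D' ≤ D → ∀ a ∈ K, ∀ b ∈ N, better a b)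
    {ts : List RTree} (hts : Whole I D ts) :
    ∃ ts', Whole ({node K} + (I - (K : Multiset RTree))) (D.erase d) ts' ∧ J (node ts) ≤ J (node ts') := by
  obtain ⟨ts₀, h0, h, h1⟩ := E.exists_root hts hd
  rw [h1]
  obtain ⟨A, I', D', h, hAI, hDD⟩ := h
  clear h1 hts
  -- Induction on the number of members of `K` that are not yet branches at the root.
  obtain ⟨m, hm⟩ : ∃ m, K.length - (A ∩ (K : Multiset RTree)).card = m := ⟨_, rfl⟩
  induction m using Nat.strong_induction_on generalizing A I' D' ts₀ with
  | _ m ih =>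
  by_cases hKA : (K : Multiset RTree) ≤ A
  · clear ih hc hbI hbN
    subst hAI hDD
    obtain ⟨N, hN, hN'⟩ := h.exists_perm A.toList (Multiset.coe_toList A)
    have hl := hN.length_eq
    simp only [List.length_append, Multiset.length_toList] at hl
    have hKc := Multiset.card_le_card hKA
    rw [Multiset.coe_card] at hKc
    -- The root has `K.length + 1` branches, and `N` lists those that are not items. It cannot be
    -- empty, as only one degree would be left then. So the items at the root are exactly those in
    -- `K`, and there is exactly one further branch.
    match N, hN', hl with
    | [], hN', hl =>
      obtain ⟨-, -, rfl⟩ := hN'.eq_zero_of_nil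
      simp at hD
    | x :: N, hN', hl =>
      simp only [List.length_cons] at hl
      have hAK : (K : Multiset RTree) = A :=
        Multiset.eq_of_le_of_card_le hKA (by rw [Multiset.coe_card]; omega)
      have hNl : N.length = 0 := by omega
      obtain rfl := List.length_eq_zero_iff.1 hNl
      have hKp : ts₀.Perm (x :: K) := by
        refine hN.trans (List.perm_append_comm.trans ?_)
        rw [List.singleton_append, List.perm_cons, ← Multiset.coe_eq_coe, hAK,
          Multiset.coe_toList]
      generalize hA0 : (0 : Multiset RTree) = A0 at hN'
      cases hN' with
      | item a _ => exact absurd (congrArg Multiset.card hA0) (by simp)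
      | @node _ I₁ A' I₂ D₁ D₂ _ us h₁ h₂ =>
        obtain ⟨-, rfl, rfl⟩ := h₁.eq_zero_of_nil
        -- The root moves across the edge to the further branch `node us`; the old root together
        -- with `K` becomes an item there.
        refine ⟨node K :: us, ⟨_, _, _, Assembled.item (node K) h₂, ?_, ?_⟩, ?_⟩
        · rw [hAK, add_tsub_cancel_left]
          abel
        · rw [hKp.length_eq, List.length_cons, hKd, Multiset.singleton_add,
            Multiset.erase_cons_head]
          simp
        · rw [E.iso (Iso.node_perm hKp)]
          exact (E.comm _ _).le
  -- Some copy of a member `q` of `K` is missing at the root, so it is an inner item, and its parent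
  -- serves as the second vertex of an exchange.
  · obtain ⟨q, hq⟩ : ∃ q, A.count q < (K : Multiset RTree).count q := by
      by_contra hcon
      push Not at hcon
      exact hKA (Multiset.le_iff_count.2 hcon)
    have hqI : q ∈ I' := by
      rw [← Multiset.count_pos]
      have := Multiset.le_iff_count.1 hK q
      rw [hAI, Multiset.count_add] at this
      omega
    obtain ⟨L, F, R, AF, IF, AR, IR, IL, DF, DR, DL, h1, h2, h3, h4, h5, h6, rfl, rfl⟩ :=
      h.locate (.inl q) hqI
    have h6 : q ∈ AR := h6
    -- All members of `K` found at the root or at the parent of `q`. Because of `q` there are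
    -- strictly more of them than at the root alone, so the induction measure drops.
    obtain ⟨U, hU⟩ : ∃ U : List RTree, (U : Multiset RTree) = (A + AR) ∩ K :=
      ⟨_, Multiset.coe_toList _⟩
    obtain ⟨W, hW⟩ : ∃ W : List RTree, (W : Multiset RTree) = (A + AR) - K :=
      ⟨_, Multiset.coe_toList _⟩
    have hUW : ((U ++ W : List RTree) : Multiset RTree) = A + AR := by
      rw [← Multiset.coe_add, hU, hW, add_comm]
      exact Multiset.sub_add_inter _ _
    obtain ⟨N, hN, hN'⟩ := (h3.append h5).exists_perm (U ++ W) hUW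
    have hUK : (U : Multiset RTree) ≤ K := hU ▸ Multiset.inter_le_right
    have hUl : U.length ≤ L.length := by
      have := Multiset.card_le_card hUK
      simp only [Multiset.coe_card] at this
      omega
    rw [List.append_assoc] at hN
    obtain ⟨Z, Y, F', h7, h8, h9, h10⟩ := hc F L R U (W ++ N) (by omega) (by rw [hDD]; simp) hN hUl (by
      intro a ha b hb
      have ha' : a ∈ K := Multiset.mem_coe.1 (Multiset.mem_of_le hUK ha)
      rcases List.mem_append.1 hb with hb | hb
      · refine hbI a ha' b (Multiset.mem_of_le ?_ (Multiset.mem_coe.2 hb))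
        rw [hW, hAI]
        refine tsub_le_tsub_right ?_ _
        exact (Multiset.le_add_right (A + AR) (IL + (AF + IF) + IR)).trans
          (le_of_eq (by abel))
      · refine hbN hN' ?_ ?_ a ha' b hb
        · rw [hAI]
          exact (Multiset.le_add_right (IL + IR) (A + AF + IF + AR)).trans
            (le_of_eq (by abel))
        · rw [hDD]
          exact le_trans (Multiset.le_add_right (DL + DR)
            ({ts₀.length} + DF + pathDegs F + {R.length + 1})) (le_of_eq (by abel)))
    have hF : Assembled AF IF DF F'.flatten ∧ pathDegs F' = pathDegs F := by
      rcases h8 with rfl | rfl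
      · exact ⟨h4, rfl⟩
      · exact ⟨h4.reverse_frames, pathDegs_reverse F⟩
    have hWN : Assembled W (IL + IR) (DL + DR) (W ++ N) :=
      ((Assembled.of_list W).append hN').congr (by simp) (by simp) (by simp)
    obtain ⟨A₁, I₁, D₁, A₂, I₂, D₂, hZ, hY, e1, e2, e3⟩ := (hWN.perm h7).exists_split
    have hX := (Assembled.of_list U).append hZ
    have hRl : R.length = Y.length := by
      have a1 := hN.length_eq
      have a2 := h7.length_eq
      simp only [List.length_append] at a1 a2 h9
      omega
    have hlt : (A ∩ (K : Multiset RTree)).card < ((U + A₁) ∩ (K : Multiset RTree)).card := by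
      have b1 : q ::ₘ (A ∩ (K : Multiset RTree)) ≤ U := by
        rw [hU, Multiset.le_iff_count]
        intro x
        have b2 := Multiset.one_le_count_iff_mem.2 h6
        rw [Multiset.count_cons, Multiset.count_inter, Multiset.count_inter, Multiset.count_add]
        split_ifs with hx
        · subst hx
          omega
        · omega
      have b3 : (U : Multiset RTree) ≤ (U + A₁) ∩ (K : Multiset RTree) :=
        le_inf (Multiset.le_add_right _ _) hUK
      have b4 := Multiset.card_le_card (b1.trans b3)
      rw [Multiset.card_cons] at b4
      omega
    have hle : ((U + A₁) ∩ (K : Multiset RTree)).card ≤ K.length :=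
      Multiset.card_le_card Multiset.inter_le_right
    obtain ⟨ts', h11, h12⟩ := ih _ (by omega) (plug F' (node Y) :: (U ++ Z))
      (by simp only [List.length_cons]; omega) (U + A₁) _ _
      (((hY.plug hF.1).append hX).congr (zero_add _) rfl rfl) (by
        have e4 : (A + AR : Multiset RTree) = U + (A₁ + A₂) := by
          rw [← hUW, ← e1]
          rfl
        rw [hAI]
        calc _ = (A + AR) + (IL + IR) + (AF + IF) := by abel
          _ = _ := by rw [e4, e2]; abel) (by
        have e5 : (plug F' (node Y) :: (U ++ Z)).length = ts₀.length := by
          simp only [List.length_cons]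
          omega
        rw [hDD, e5, hF.2, hRl]
        calc _ = {ts₀.length} + (DL + DR) + (DF + pathDegs F + {Y.length + 1}) := by abel
          _ = _ := by rw [e3]; abel) rfl
    exact ⟨ts', h11, ((E.iso h1).le.trans h10).trans h12⟩

end Exchangeable

end RTree

namespace RTree

/-! ### Monotone recurrence rules -/

/-- `ρ` is weakly increasing in the branches, and under addition of further branches. -/
structure Inc (ρ : RTree → ℝ) : Prop where
  mono : ∀ {K M : List RTree}, K.length ≤ M.length → (∀ k ∈ K, ∀ m ∈ M, ρ k ≤ ρ m) →
    ρ (node K) ≤ ρ (node M)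
  leaf_le : ∀ M, ρ leaf ≤ ρ (node M)

/-- `ρ` is weakly decreasing in the branches, and under addition of further branches. -/
structure Dec (ρ : RTree → ℝ) : Prop where
  anti : ∀ {K M : List RTree}, K.length ≤ M.length → (∀ k ∈ K, ∀ m ∈ M, ρ k ≤ ρ m) →
    ρ (node M) ≤ ρ (node K)
  le_leaf : ∀ M, ρ (node M) ≤ ρ leaf

/-- The members of `K` are replaced by members of `M` one at a time, and the surplus of `M` is added
at the end; `S` keeps what has been replaced. Equal values of `ρ` leave the argument of `f`
unchanged, so the strict rules yield a weak inequality. -/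
lemma mono_of_rule {ρ : RTree → ℝ} {f : Multiset ℝ → ℝ}
    (h1 : ∀ (S : Multiset RTree) (X Y : RTree), ρ X < ρ Y →
      f (ρ X ::ₘ S.map ρ) < f (ρ Y ::ₘ S.map ρ))
    (h2 : ∀ (S : Multiset RTree) (X : RTree), f (S.map ρ) < f (ρ X ::ₘ S.map ρ)) :
    ∀ {K M : List RTree} (S : Multiset RTree), K.length ≤ M.length →
      (∀ k ∈ K, ∀ m ∈ M, ρ k ≤ ρ m) →
      f (Multiset.map ρ (K + S)) ≤ f (Multiset.map ρ (M + S))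
  | [], [], _, _, _ => le_rfl
  | [], m :: M, S, _, _ => by
    refine (mono_of_rule h1 h2 (K := []) (M := M) S (by simp) (by simp)).trans ?_
    rw [← Multiset.cons_coe, Multiset.cons_add, Multiset.map_cons]
    exact (h2 _ _).le
  | _ :: _, [], _, hl, _ => by simp at hl
  | k :: K, m :: M, S, hl, h => by
    have h3 : f (Multiset.map ρ ((k :: K : List RTree) + S)) ≤
        f (Multiset.map ρ (K + (m ::ₘ S))) := by
      rw [← Multiset.cons_coe, Multiset.cons_add, Multiset.map_cons, Multiset.add_cons,
        Multiset.map_cons]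
      rcases (h k (by simp) m (by simp)).lt_or_eq with hlt | heq
      · exact (h1 _ _ _ hlt).le
      · rw [heq]
    refine h3.trans ((mono_of_rule h1 h2 (m ::ₘ S) (by simpa using hl) fun k hk m' hm' =>
      h k (by simp [hk]) m' (by simp [hm'])).trans (le_of_eq ?_))
    rw [← Multiset.cons_coe, Multiset.cons_add, Multiset.add_cons]

lemma recurrence_node {ρ : FinRootedTree → ℝ} {f : Multiset ℝ → ℝ} (h : HasRecurrence ρ f)
    (ts : List RTree) : ρ (node ts).toFinRooted =
      f (Multiset.map (fun t : RTree => ρ t.toFinRooted) ts) := by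
  rw [h _ _ ((isBranching_iff_iso (FinRootedTree.forall₂_isoTo_map ts)).2
    (FinRootedTree.isoTo_toFinRooted _)), List.map_map]
  rfl

lemma leaf_or_size (M : List RTree) : node M = leaf ∨ 1 < (node M).size := by
  cases M with
  | nil => exact Or.inl rfl
  | cons a M =>
    have h1 := size_pos a
    have h2 := size_pos (node M)
    right
    simp only [node, size]
    omega

lemma order_toFinRooted (t : RTree) : t.toFinRooted.order = t.size := card_vert t

lemma map_toFinRooted (ρ : FinRootedTree → ℝ) (S : Multiset RTree) :
    (S.map toFinRooted).map ρ = S.map fun t => ρ t.toFinRooted := Multiset.map_map _ _ _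

lemma inc_of_increasingRule {ρ : FinRootedTree → ℝ} (h : IncreasingRule ρ) :
    Inc fun t => ρ t.toFinRooted := by
  obtain ⟨f, hf, h1, h2, h3⟩ := h
  refine ⟨fun {K M} hl hKM => ?_, fun M => ?_⟩
  · rw [recurrence_node hf, recurrence_node hf]
    have := mono_of_rule (f := f) (ρ := fun t => ρ t.toFinRooted)
      (fun S X Y hXY => by simpa only [map_toFinRooted] using h1 (S.map toFinRooted) _ _ hXY)
      (fun S X => by simpa only [map_toFinRooted] using h2 (S.map toFinRooted) X.toFinRooted)
      0 hl hKM
    simpa using this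
  · rcases leaf_or_size M with h | h
    · rw [h]
    · exact (h3 _ _ (order_toFinRooted leaf) (by rwa [order_toFinRooted])).le

lemma dec_of_decreasingRule {ρ : FinRootedTree → ℝ} (h : DecreasingRule ρ) :
    Dec fun t => ρ t.toFinRooted := by
  obtain ⟨f, hf, h1, h2, h3⟩ := h
  refine ⟨fun {K M} hl hKM => ?_, fun M => ?_⟩
  · rw [recurrence_node hf, recurrence_node hf]
    have := mono_of_rule (f := fun x => - f x) (ρ := fun t => ρ t.toFinRooted)
      (fun S X Y hXY => neg_lt_neg (by
        simpa only [map_toFinRooted] using h1 (S.map toFinRooted) _ _ hXY))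
      (fun S X => neg_lt_neg (by
        simpa only [map_toFinRooted] using h2 (S.map toFinRooted) X.toFinRooted))
      0 hl hKM
    simpa using this
  · rcases leaf_or_size M with h | h
    · rw [h]
    · exact (h3 _ _ (order_toFinRooted leaf) (by rwa [order_toFinRooted])).le

/-! ### Merging branches at the end of a queue -/

/-- Merge the last `d - 1` trees in the queue to a branching, put it in front of the queue, and
continue with the next degree `d`, until only one degree is left. -/
def mergeBack (q : List RTree) : List ℕ → RTree
  | [] => node q
  | [_] => node q
  | d :: e :: ds =>
    mergeBack (node (q.drop (q.length - (d - 1))) :: q.take (q.length - (d - 1))) (e :: ds)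

lemma two_mul_length_le_sum {l : List ℕ} (h : ∀ x ∈ l, 2 ≤ x) : 2 * l.length ≤ l.sum := by
  rw [mul_comm]
  simpa using List.card_nsmul_le_sum l 2 h

lemma Whole.eq_node {ρ J : RTree → ℝ} (E : Exchangeable ρ J) {I : Multiset RTree} {d : ℕ}
    {ts us : List RTree} (h : Whole I {d} ts) (hI : I = us) : J (node ts) = J (node us) := by
  obtain ⟨A, I', D', h, rfl, hD⟩ := h
  have h0 : D' = 0 := by
    have := congrArg Multiset.card hD
    simp at this
    exact this
  obtain ⟨rfl, rfl⟩ := h.eq_zero_of_card_eq_zero h0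
  rw [add_zero, Multiset.coe_eq_coe] at hI
  exact E.iso (Iso.node_perm hI)

/-- The number `β` separates items from other branches: every item has value at most `β`, and every
branching that can still be formed from the remaining degrees has value at least `β`. Hence the last
`d - 1` items `K` of the queue are smallest among all branches and can be collected at a vertex of
the smallest degree `d`. Afterwards `ρ (node K)` takes over the role of `β`: a later branching has
at least as many branches as `K`, none of them smaller than a member of `K`, so monotonicity bounds
its value from below by `ρ (node K)`. -/
theorem Exchangeable.le_mergeBack {ρ J : RTree → ℝ} (E : Exchangeable ρ J) (hρ : Inc ρ) :
    ∀ {ds : List ℕ} {q : List RTree} {β : ℝ} {ts : List RTree}, ds ≠ [] → ds.Pairwise (· ≤ ·) →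
      (∀ x ∈ ds, 2 ≤ x) → q.Pairwise (fun X Y => ρ X ≥ ρ Y) → (∀ a ∈ q, ρ a ≤ β) →
      (∀ M : List RTree, (∃ x ∈ ds, x ≤ M.length + 1) → (∀ m ∈ M, m ∈ q ∨ β ≤ ρ m) →
        β ≤ ρ (node M)) →
      Whole q ds ts → J (node ts) ≤ J (mergeBack q ds)
  | [], _, _, _, h, _, _, _, _, _, _ => absurd rfl h
  | [d], q, β, ts, _, _, _, _, _, _, h => (h.eq_node E rfl).le
  | d :: e :: ds, q, β, ts, _, hds, h2, hq, hβ, hM, h => by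
    have hcard := h.card_eq
    have hsum := two_mul_length_le_sum (l := e :: ds) fun x hx => h2 x (by simp_all)
    simp only [Multiset.coe_card, List.length_cons, Multiset.sum_coe, List.sum_cons] at hcard hsum
    have hd2 := h2 d (by simp)
    set n := q.length - (d - 1) with hn
    have hqn : (q.take n ++ q.drop n) = q := List.take_append_drop n q
    -- By the count `hcard`, with all other degrees at least `2`, the queue has at least `d - 1`
    -- entries.
    have hKl : (q.drop n).length + 1 = d := by
      simp
      omega
    have hmin : ∀ x ∈ ((d :: e :: ds : List ℕ) : Multiset ℕ), d ≤ x := by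
      intro x hx
      rcases List.mem_cons.1 (Multiset.mem_coe.1 hx) with rfl | hx
      · exact le_rfl
      · exact List.rel_of_pairwise_cons hds hx
    have hq' := hq
    rw [← hqn, List.pairwise_append] at hq'
    have hsub : (q : Multiset RTree) - (q.drop n : List RTree) = (q.take n : List RTree) := by
      refine tsub_eq_of_eq_add ?_
      rw [Multiset.coe_add, hqn]
    obtain ⟨ts', h3, h4⟩ := E.collect (E.collects_of_min hmin) (by simp) (by simp)
      (K := q.drop n) (List.Sublist.subperm (List.drop_sublist n q)) hKl
      (fun a ha b hb => by
        rw [hsub] at hb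
        exact hq'.2.2 b (Multiset.mem_coe.1 hb) a ha)
      (fun {I' D' N} hN hI hD a ha b hb => by
        have := hN.forall_mem (P := (· ∈ q)) (Q := fun b => β ≤ ρ b)
          (fun a ha => Multiset.mem_coe.1 (Multiset.mem_of_le hI (by simpa using ha)))
          (fun us hus hu => hM us ⟨d, by simp, hmin _ (Multiset.mem_of_le hD hus)⟩ hu) b hb
        rcases this with h | h
        · simp at h
        · exact (hβ a (List.mem_of_mem_drop ha)).trans h) h
    rw [hsub] at h3
    refine h4.trans (le_mergeBack E hρ (ds := e :: ds)
      (q := node (q.drop n) :: q.take n) (β := ρ (node (q.drop n))) (by simp) hds.of_cons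
      (fun x hx => h2 x (List.mem_cons_of_mem _ hx)) ?_ ?_ ?_ ?_)
    · have hβK : β ≤ ρ (node (q.drop n)) :=
        hM _ ⟨d, by simp, by omega⟩ fun m hm => Or.inl (List.mem_of_mem_drop hm)
      rw [List.pairwise_cons]
      exact ⟨fun a ha => (hβ a (List.mem_of_mem_take ha)).trans hβK, hq'.1⟩
    · have hβK : β ≤ ρ (node (q.drop n)) :=
        hM _ ⟨d, by simp, by omega⟩ fun m hm => Or.inl (List.mem_of_mem_drop hm)
      intro a ha
      rcases List.mem_cons.1 ha with rfl | ha
      · exact le_rfl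
      · exact (hβ a (List.mem_of_mem_take ha)).trans hβK
    · have hβK : β ≤ ρ (node (q.drop n)) :=
        hM _ ⟨d, by simp, by omega⟩ fun m hm => Or.inl (List.mem_of_mem_drop hm)
      rintro M ⟨x, hx, hxM⟩ hm
      have hdx := hmin x (Multiset.mem_coe.2 (List.mem_cons_of_mem _ hx))
      refine hρ.mono (by omega) fun k hk m hmM => ?_
      have hkβ := hβ k (List.mem_of_mem_drop hk)
      rcases hm m hmM with h | h
      · rcases List.mem_cons.1 h with rfl | h
        · exact hkβ.trans hβK
        · exact hq'.2.2 m h k hk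
      · exact (hkβ.trans hβK).trans h
    · convert h3 using 1
      · simp
      · rw [← Multiset.cons_coe d, Multiset.erase_cons_head]

/-! ### Merging branches at the beginning of a queue -/

/-- Form branchings with `d - 1` branches, for the given degrees `d`, from the beginning of the
queue. -/
def starsOf : List ℕ → List RTree → List RTree
  | [], _ => []
  | d :: g, q => node (q.take (d - 1)) :: starsOf g (q.drop (d - 1))

/-- The part of the queue that is not used by `starsOf`. -/
def starRest : List ℕ → List RTree → List RTree
  | [], q => q
  | d :: g, q => starRest g (q.drop (d - 1))

lemma length_starsOf : ∀ (g : List ℕ) (q : List RTree), (starsOf g q).length = g.length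
  | [], _ => rfl
  | _ :: g, _ => congrArg (· + 1) (length_starsOf g _)

lemma starRest_sublist : ∀ (g : List ℕ) (q : List RTree), (starRest g q).Sublist q
  | [], q => List.Sublist.refl q
  | _ :: g, q => (starRest_sublist g _).trans (List.drop_sublist _ q)

/-- Form branchings for the `c - 1` largest degrees `d` (where `c` is the smallest one), from the
beginning of the queue, join them to a vertex of degree `c`, put the resulting branch at the end of
the queue, and continue, until at most `c + 1` degrees are left. -/
def mergeFront (q : List RTree) : List ℕ → RTree
  | [] => node q
  | c :: e =>
    if e.length ≤ c then node (starsOf e.reverse q ++ starRest e.reverse q)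
    else mergeFront (starRest (e.drop (e.length - (c - 1))).reverse q ++
      [node (starsOf (e.drop (e.length - (c - 1))).reverse q)]) (e.take (e.length - (c - 1)))
termination_by l => l.length
decreasing_by simp

section

variable {ρ J : RTree → ℝ}

/-- Later stars receive smaller branches, and not more of them, so for a decreasing rule the last
star has the largest value. Its branches `K` bound from above whatever remains in the queue. -/
lemma exists_last_star (hρ : Dec ρ) : ∀ {g : List ℕ} {q : List RTree}, g ≠ [] →
    g.Pairwise (· ≥ ·) → (∀ y ∈ g, 1 ≤ y) → q.Pairwise (fun X Y => ρ X ≥ ρ Y) →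
    (g.map (· - 1)).sum ≤ q.length →
    ∃ K : List RTree, (∃ y ∈ g, K.length + 1 = y ∧ ∀ z ∈ g, y ≤ z) ∧ K ⊆ q ∧
      (∀ a ∈ starRest g q, ∀ k ∈ K, ρ a ≤ ρ k) ∧ node K ∈ starsOf g q ∧
      ∀ S ∈ starsOf g q, ρ S ≤ ρ (node K)
  | [], _, h, _, _, _, _ => absurd rfl h
  | [d], q, _, _, h1, hq, hl => by
    have hd := h1 d (by simp)
    simp at hl
    rw [← List.take_append_drop (d - 1) q, List.pairwise_append] at hq
    refine ⟨q.take (d - 1), ⟨d, by simp, ?_, by simp⟩, List.take_subset _ _, ?_, by simp [starsOf],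
      by simp [starsOf]⟩
    · rw [List.length_take]
      omega
    · intro a ha k hk
      exact hq.2.2 k hk a ha
  | d :: e :: g, q, _, hg, h1, hq, hl => by
    have hd := h1 d (by simp)
    rw [List.map_cons, List.sum_cons] at hl
    have hq' := hq
    rw [← List.take_append_drop (d - 1) q, List.pairwise_append] at hq'
    obtain ⟨K, ⟨y, hy, hKy, hyz⟩, hKq, h3, h4, h5⟩ := exists_last_star hρ (g := e :: g)
      (q := q.drop (d - 1)) (by simp) hg.of_cons (fun y hy => h1 y (List.mem_cons_of_mem _ hy))
      hq'.2.1 (by rw [List.length_drop]; omega)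
    have hyd : y ≤ d := List.rel_of_pairwise_cons hg hy
    refine ⟨K, ⟨y, List.mem_cons_of_mem _ hy, hKy, ?_⟩,
      fun k hk => List.mem_of_mem_drop (hKq hk), h3, List.mem_cons_of_mem _ h4, ?_⟩
    · intro z hz
      rcases List.mem_cons.1 hz with rfl | hz
      · exact hyd
      · exact hyz z hz
    · intro S hS
      rcases List.mem_cons.1 hS with rfl | hS
      · refine hρ.anti ?_ fun k hk m hm => hq'.2.2 m hm k (hKq hk)
        rw [List.length_take]
        omega
      · exact h5 S hS

lemma coe_sub_take (q l : List RTree) (n : ℕ) :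
    ((q ++ l : List RTree) : Multiset RTree) - (q.take n : List RTree) =
      (q.drop n ++ l : List RTree) := by
  refine tsub_eq_of_eq_add ?_
  rw [Multiset.coe_add, Multiset.coe_eq_coe]
  conv_lhs => rw [← List.take_append_drop n q, List.append_assoc]
  exact List.perm_append_comm

/-- The branchings of `starsOf` can be formed. -/
lemma Exchangeable.exists_stars (E : Exchangeable ρ J) {c : ℕ} {β γ κ : ℝ} (hc : 2 ≤ c)
    (hγβ : γ ≤ β) (hβκ : β ≤ κ) {D : Multiset ℕ} (hcD : c ∈ D) (hDc : ∀ x ∈ D, c ≤ x) :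
    ∀ {g : List ℕ} {q lows ts : List RTree},
      (∀ M : List RTree, c ≤ M.length + 1 → (∃ x ∈ (g : Multiset ℕ) + D, M.length + 1 ≤ x) →
        (∀ m ∈ M, γ ≤ ρ m ∧ ρ m ≤ κ) → γ ≤ ρ (node M) ∧ ρ (node M) ≤ β) →
      g.Pairwise (· ≥ ·) → (∀ y ∈ g, ∀ x ∈ D, x ≤ y) →
      q.Pairwise (fun X Y => ρ X ≥ ρ Y) → (∀ a ∈ q, β ≤ ρ a ∧ ρ a ≤ κ) →
      (∀ a ∈ lows, γ ≤ ρ a ∧ ρ a ≤ β) → lows.length + g.length ≤ c →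
      Whole (q ++ lows : List RTree) (g + D) ts →
      (∃ ts', Whole (starRest g q ++ (starsOf g q ++ lows) : List RTree) D ts' ∧
        J (node ts) ≤ J (node ts')) ∧ (g.map (· - 1)).sum ≤ q.length ∧
        ∀ S ∈ starsOf g q, γ ≤ ρ S ∧ ρ S ≤ β
  | [], q, lows, ts, _, _, _, _, _, _, _, h => by
    refine ⟨⟨ts, ?_, le_rfl⟩, by simp, by simp [starsOf]⟩
    simpa [starRest, starsOf] using h
  | d :: g, q, lows, ts, hM, hg, hgD, hq, hqβ, hlow, hlen, h => by
    have hcd : c ≤ d := hgD d (by simp) c hcD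
    -- Counting gives at least `d + c - 2` items in `q ++ lows`. Since `lows` has at most `c - 1`
    -- members, the required `d - 1` items can be taken from `q` alone.
    have hql : d - 1 ≤ q.length := by
      have hcard := h.card_eq
      have h1 := two_mul_length_le_sum (l := g) fun x hx =>
        hc.trans (hgD x (List.mem_cons_of_mem _ hx) c hcD)
      obtain ⟨D', rfl⟩ := Multiset.exists_cons_of_mem hcD
      have h2 : D'.card * 2 ≤ D'.sum := by
        simpa using Multiset.card_nsmul_le_sum (s := D') (a := 2) fun x hx =>
          hc.trans (hDc x (Multiset.mem_cons_of_mem hx))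
      simp only [Multiset.coe_card, Multiset.card_add, List.length_append, List.length_cons,
        Multiset.card_cons, Multiset.sum_add, Multiset.sum_coe, List.sum_cons,
        Multiset.sum_cons] at hcard hlen
      omega
    have hmax : ∀ x ∈ ((d :: g : List ℕ) : Multiset ℕ) + D, x ≤ d := by
      intro x hx
      rcases Multiset.mem_add.1 hx with hx | hx
      · rcases List.mem_cons.1 (Multiset.mem_coe.1 hx) with rfl | hx
        · exact le_rfl
        · exact List.rel_of_pairwise_cons hg hx
      · exact hgD d (by simp) x hx
    have hmin : ∀ x ∈ ((d :: g : List ℕ) : Multiset ℕ) + D, c ≤ x := by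
      intro x hx
      rcases Multiset.mem_add.1 hx with hx | hx
      · exact hgD x (Multiset.mem_coe.1 hx) c hcD
      · exact hDc x hx
    have hKl : (q.take (d - 1)).length + 1 = d := by
      rw [List.length_take]
      omega
    have hq' := hq
    rw [← List.take_append_drop (d - 1) q, List.pairwise_append] at hq'
    have hall : ∀ a ∈ q ++ lows, γ ≤ ρ a ∧ ρ a ≤ κ := by
      intro a ha
      rcases List.mem_append.1 ha with ha | ha
      · exact ⟨hγβ.trans (hqβ a ha).1, (hqβ a ha).2⟩
      · exact ⟨(hlow a ha).1, (hlow a ha).2.trans hβκ⟩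
    obtain ⟨ts', h3, h4⟩ := E.collect (E.collects_of_max hmax) (by simp) (by
        have := Multiset.card_pos_iff_exists_mem.2 ⟨c, hcD⟩
        simp
        omega)
      (K := q.take (d - 1))
      (List.Sublist.subperm ((List.take_sublist _ q).trans (List.sublist_append_left q lows))) hKl
      (fun a ha b hb => by
        rw [coe_sub_take] at hb
        rcases List.mem_append.1 (Multiset.mem_coe.1 hb) with hb | hb
        · exact hq'.2.2 a ha b hb
        · exact (hlow b hb).2.trans (hqβ a (List.mem_of_mem_take ha)).1)
      -- A branch that is not an item is a branching of admissible size, so its value is at most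
      -- `β`, which does not exceed any value in `q`.
      (fun {I' D' N} hN hI hD a ha b hb => by
        have := hN.forall_mem (P := fun b => γ ≤ ρ b ∧ ρ b ≤ κ)
          (Q := fun b => γ ≤ ρ b ∧ ρ b ≤ β)
          (fun a ha => hall a (Multiset.mem_coe.1 (Multiset.mem_of_le hI (by simpa using ha))))
          (fun us hus hu => hM us (hmin _ (Multiset.mem_of_le hD hus))
            ⟨_, Multiset.mem_of_le hD hus, le_rfl⟩ fun m hm => by
              rcases hu m hm with h | h
              · exact h
              · exact ⟨h.1, h.2.trans hβκ⟩) b hb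
        rcases this with h | h
        · simp at h
        · exact h.2.trans (hqβ a (List.mem_of_mem_take ha)).1) h
    have hnew := hM (q.take (d - 1)) (by omega) ⟨d, by simp, by omega⟩ fun m hm =>
      hall m (List.mem_append_left _ (List.mem_of_mem_take hm))
    obtain ⟨⟨ts'', h5, h6⟩, h7, h8⟩ := exists_stars E hc hγβ hβκ hcD hDc (g := g)
      (q := q.drop (d - 1)) (lows := node (q.take (d - 1)) :: lows) (ts := ts')
      (fun M h1 ⟨x, hx, h2⟩ => hM M h1 ⟨x, by
        rw [← Multiset.cons_coe, Multiset.cons_add]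
        exact Multiset.mem_cons_of_mem hx, h2⟩) hg.of_cons
      (fun y hy => hgD y (List.mem_cons_of_mem _ hy)) hq'.2.1
      (fun a ha => hqβ a (List.mem_of_mem_drop ha))
      (fun a ha => by
        rcases List.mem_cons.1 ha with rfl | ha
        · exact hnew
        · exact hlow a ha)
      (by simp at hlen ⊢; omega) (by
        convert h3 using 1
        · rw [coe_sub_take, ← Multiset.coe_singleton, Multiset.coe_add, Multiset.coe_eq_coe]
          simp
        · simp [← Multiset.cons_coe])
    refine ⟨⟨ts'', ?_, h4.trans h6⟩, ?_, ?_⟩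
    · convert h5 using 1
      rw [Multiset.coe_eq_coe]
      simp only [starRest, starsOf]
      refine List.Perm.append_left _ ?_
      exact List.perm_middle.symm
    · rw [List.length_drop] at h7
      simp only [List.map_cons, List.sum_cons]
      omega
    · intro S hS
      rcases List.mem_cons.1 hS with rfl | hS
      · exact hnew
      · exact h8 S hS

end

end RTree

namespace RTree

/-- The values fall into two layers: the items of the queue lie in `[β, κ]`, and every branching
that can be formed from branches with values in `[γ, κ]` lies in `[γ, β]`. Items are therefore at
least as large as all other branches, so the largest degrees can collect them from the front of the
queue. The resulting `c - 1` stars are in the lower layer; they are small enough to be collected by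
a vertex of the smallest degree `c`. This yields the branch `node S`, which is put at the end of the
queue because its value is at most `β`. The three bounds are then replaced by sharper ones, and the
argument is repeated with the degrees that are left. -/
theorem Exchangeable.le_mergeFront {ρ J : RTree → ℝ} (E : Exchangeable ρ J) (hρ : Dec ρ) :
    ∀ (n : ℕ) {ds : List ℕ} {q : List RTree} {β γ κ : ℝ} {ts : List RTree}, ds.length = n →
      ds ≠ [] → ds.Pairwise (· ≤ ·) → (∀ x ∈ ds, 2 ≤ x) → γ ≤ β → β ≤ κ →
      q.Pairwise (fun X Y => ρ X ≥ ρ Y) → (∀ a ∈ q, β ≤ ρ a ∧ ρ a ≤ κ) →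
      (∀ M : List RTree, (∃ x ∈ ds, x ≤ M.length + 1) → (∃ x ∈ ds, M.length + 1 ≤ x) →
        (∀ m ∈ M, γ ≤ ρ m ∧ ρ m ≤ κ) → γ ≤ ρ (node M) ∧ ρ (node M) ≤ β) →
      Whole q ds ts → J (node ts) ≤ J (mergeFront q ds) := by
  intro n
  induction n using Nat.strong_induction_on with
  | _ n ih =>
  intro ds q β γ κ ts hn hne hds h2 hγβ hβκ hq hqβ hM h
  match ds, hne with
  | c :: e, _ =>
  have hc2 := h2 c (by simp)
  have hce : ∀ x ∈ e, c ≤ x := fun x hx => List.rel_of_pairwise_cons hds hx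
  have hesort := hds.of_cons
  rw [mergeFront]
  split_ifs with hec
  · obtain ⟨⟨ts', h3, h4⟩, -, -⟩ := E.exists_stars (c := c) hc2 hγβ hβκ (D := {c}) (by simp)
      (by simp) (g := e.reverse) (q := q) (lows := []) (ts := ts)
      (fun M h1 ⟨x, hx, h2⟩ h3 => hM M ⟨c, by simp, h1⟩ ⟨x, by
        simp at hx ⊢
        tauto, h2⟩ h3)
      (List.pairwise_reverse.2 hesort) (by simpa using hce) hq hqβ (by simp) (by simpa using hec)
      (by
        convert h using 1
        · simp
        · rw [← Multiset.cons_coe, ← Multiset.coe_reverse e, add_comm]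
          simp)
    refine h4.trans (h3.eq_node E ?_).le
    rw [Multiset.coe_eq_coe, List.append_nil]
    exact List.perm_append_comm
  · set k := e.length - (c - 1) with hk
    obtain ⟨g, hg⟩ : ∃ g, g = (e.drop k).reverse := ⟨_, rfl⟩
    rw [← hg]
    have he : e.take k ++ e.drop k = e := List.take_append_drop k e
    have hgl : g.length + 1 = c := by
      rw [hg, List.length_reverse, List.length_drop]
      omega
    have htl : 2 ≤ (e.take k).length := by
      rw [List.length_take]
      omega
    have hge : ∀ x ∈ g, x ∈ e := fun x hx => by
      rw [hg, List.mem_reverse] at hx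
      exact List.mem_of_mem_drop hx
    have hsplit := hesort
    rw [← he, List.pairwise_append] at hsplit
    have hgsort : g.Pairwise (· ≥ ·) := hg ▸ List.pairwise_reverse.2 hsplit.2.1
    have htg : ∀ y ∈ g, ∀ x ∈ e.take k, x ≤ y := fun y hy x hx =>
      hsplit.2.2 x hx y (by rwa [hg, List.mem_reverse] at hy)
    have hcoe : (g : Multiset ℕ) + (c :: e.take k : List ℕ) = (c :: e : List ℕ) := by
      rw [hg, Multiset.coe_reverse, Multiset.coe_add, Multiset.coe_eq_coe]
      conv_rhs => rw [← he]
      exact List.perm_append_comm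
    obtain ⟨⟨ts', h3, h4⟩, h5, h6⟩ := E.exists_stars (c := c) hc2 hγβ hβκ
      (D := (c :: e.take k : List ℕ)) (by simp)
      (fun x hx => by
        rcases List.mem_cons.1 (Multiset.mem_coe.1 hx) with rfl | hx
        · exact le_rfl
        · exact hce x (List.mem_of_mem_take hx)) (g := g) (q := q) (lows := []) (ts := ts)
      (fun M h1 ⟨x, hx, h2⟩ h3 => hM M ⟨c, by simp, h1⟩ ⟨x, by
        rw [hcoe] at hx
        exact hx, h2⟩ h3) hgsort
      (fun y hy x hx => by
        rcases List.mem_cons.1 (Multiset.mem_coe.1 hx) with rfl | hx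
        · exact hce y (hge y hy)
        · exact htg y hy x hx) hq hqβ (by simp) (by simp; omega)
      (by
        rw [hcoe, List.append_nil]
        exact h)
    rw [List.append_nil] at h3
    have hg0 : g ≠ [] := by
      rintro rfl
      simp at hgl
      omega
    -- `K` consists of the branches of the last star, which has the largest value among the new
    -- stars; `y` is its degree.
    obtain ⟨K, ⟨y, hyg, hKy, hyz⟩, hKq, hKrest, hKmem, hKmax⟩ := exists_last_star hρ hg0 hgsort
      (fun y hy => (by decide : 1 ≤ 2).trans (h2 y (List.mem_cons_of_mem _ (hge y hy)))) hq h5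
    have hSl : (starsOf g q).length + 1 = c := by rw [length_starsOf, hgl]
    have hQq : (starRest g q).Sublist q := starRest_sublist g q
    generalize starsOf g q = S at *
    generalize starRest g q = Q at *
    have hcy : c ≤ y := hce y (hge y hyg)
    have hyt : ∀ x ∈ e.take k, x ≤ y := htg y hyg
    have hsub : ((Q ++ S : List RTree) : Multiset RTree) - (S : List RTree) = Q := by
      rw [← Multiset.coe_add, add_tsub_cancel_right]
    have hγK : γ ≤ ρ (node K) := (h6 _ hKmem).1
    obtain ⟨ts'', h7, h8⟩ := E.collect (E.collects_of_min (d := c) (fun x hx => by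
        rcases List.mem_cons.1 (Multiset.mem_coe.1 hx) with rfl | hx
        · exact le_rfl
        · exact hce x (List.mem_of_mem_take hx))) (by simp) (by
        simp only [Multiset.coe_card, List.length_cons]
        omega) (K := S)
      (List.Sublist.subperm (List.sublist_append_right Q S)) hSl
      (fun a ha b hb => by
        rw [hsub] at hb
        exact (h6 a ha).2.trans (hqβ b (hQq.subset (Multiset.mem_coe.1 hb))).1)
      (fun {I' D' N} hN hI hD a ha b hb => by
        -- A branching formed from the remaining degrees has at most `K.length` branches, none
        -- exceeding a member of `K`. Since `ρ` is decreasing, its value is at least `ρ (node K)`,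
        -- hence at least the value of every star in `S`.
        have := hN.forall_mem (P := fun b => (γ ≤ ρ b ∧ ρ b ≤ κ) ∧ ∀ k ∈ K, ρ b ≤ ρ k)
          (Q := fun b => ρ (node K) ≤ ρ b ∧ γ ≤ ρ b ∧ ρ b ≤ β)
          (fun a ha => by
            have ha := Multiset.mem_of_le hI (show a ∈ I' by simpa using ha)
            rcases List.mem_append.1 (Multiset.mem_coe.1 ha) with ha | ha
            · have := hqβ a (hQq.subset ha)
              exact ⟨⟨hγβ.trans this.1, this.2⟩, hKrest a ha⟩
            · have := h6 a ha
              exact ⟨⟨this.1, this.2.trans hβκ⟩, fun k hk => this.2.trans (hqβ k (hKq hk)).1⟩)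
          (fun us hus hu => by
            have hus' := Multiset.mem_coe.1 (Multiset.mem_of_le hD hus)
            have hu' : ∀ u ∈ us, (γ ≤ ρ u ∧ ρ u ≤ κ) ∧ ∀ k ∈ K, ρ u ≤ ρ k := fun u hum => by
              rcases hu u hum with h | h
              · exact h
              · exact ⟨⟨h.2.1, h.2.2.trans hβκ⟩, fun k hk => h.2.2.trans (hqβ k (hKq hk)).1⟩
            have husy : c ≤ us.length + 1 ∧ us.length + 1 ≤ y := by
              rcases List.mem_cons.1 hus' with h | h
              · omega
              · exact ⟨hce _ (List.mem_of_mem_take h), hyt _ h⟩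
            refine ⟨hρ.anti (by omega) fun u hum k hk => (hu' u hum).2 k hk, ?_⟩
            exact hM us ⟨c, by simp, husy.1⟩
              ⟨y, List.mem_cons_of_mem _ (hge y hyg), husy.2⟩ fun m hm => (hu' m hm).1) b hb
        rcases this with h | h
        · simp at h
        · exact (hKmax a ha).trans h.1) h3
    rw [hsub] at h7
    have hK0 : K ≠ [] := by
      rintro rfl
      simp at hKy
      omega
    obtain ⟨k₀, hk₀, hk₀min⟩ : ∃ k₀ ∈ K, ∀ k ∈ K, ρ k₀ ≤ ρ k := by
      obtain ⟨k, hk, hk'⟩ := K.toFinset.exists_min_image ρ (by simpa using hK0)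
      exact ⟨k, by simpa using hk, fun x hx => hk' x (by simpa using hx)⟩
    have hSβ : γ ≤ ρ (node S) ∧ ρ (node S) ≤ β :=
      hM S ⟨c, by simp, by omega⟩ ⟨c, by simp, by omega⟩ fun m hm =>
        ⟨(h6 m hm).1, (h6 m hm).2.trans hβκ⟩
    have hKS : ρ (node K) ≤ ρ (node S) :=
      hρ.anti (by omega) fun s hs k hk => (h6 s hs).2.trans (hqβ k (hKq hk)).1
    have hβk₀ : β ≤ ρ k₀ := (hqβ k₀ (hKq hk₀)).1
    -- Bounds for the next round: branchings lie between the largest star `node K` and the new item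
    -- `node S`, and items do not exceed the smallest branch `k₀` in `K`.
    refine (h4.trans h8).trans (ih (e.take k).length ?_ (ds := e.take k) (β := ρ (node S))
      (γ := ρ (node K)) (κ := ρ k₀) rfl ?_ hsplit.1 ?_ hKS (hSβ.2.trans hβk₀) ?_ ?_ ?_ ?_)
    · rw [← hn, List.length_take, List.length_cons]
      omega
    · intro h
      rw [h] at htl
      simp at htl
    · exact fun x hx => h2 x (List.mem_cons_of_mem _ (List.mem_of_mem_take hx))
    · rw [List.pairwise_append]
      refine ⟨hq.sublist hQq, by simp, fun a ha b hb => ?_⟩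
      rw [List.mem_singleton] at hb
      subst hb
      exact hSβ.2.trans (hqβ a (hQq.subset ha)).1
    · intro a ha
      rcases List.mem_append.1 ha with ha | ha
      · exact ⟨hSβ.2.trans (hqβ a (hQq.subset ha)).1, hKrest a ha k₀ hk₀⟩
      · rw [List.mem_singleton] at ha
        subst ha
        exact ⟨le_rfl, hSβ.2.trans hβk₀⟩
    · rintro M ⟨x, hx, hxM⟩ ⟨x', hx', hMx⟩ hm
      have a1 := hce x (List.mem_of_mem_take hx)
      have a2 := hyt x' hx'
      -- Compare `M` with `K` for the lower bound (at most `K.length` branches, each at most `ρ k₀`)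
      -- and with `S` for the upper bound (at least `c - 1` branches, each at least the largest
      -- star).
      refine ⟨hρ.anti (by omega) fun m hmM k hk => (hm m hmM).2.trans (hk₀min k hk), ?_⟩
      exact hρ.anti (by omega) fun s hs m hmM => (hKmax s hs).trans (hm m hmM).1
    · convert h7 using 1
      · rw [← Multiset.coe_add, Multiset.coe_singleton, add_comm]
      · rw [← Multiset.cons_coe, Multiset.erase_cons_head]

/-! ### Trees with given degrees -/

/-- A vertex of degree `1` inside a forest has no children, so it is the branch `node []` and can be
declared to be the item `leaf`. This removes precisely the degrees below `2`. -/
lemma Assembled.exists_filter {A I : Multiset RTree} {D : Multiset ℕ} {ts : List RTree}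
    (h : Assembled A I D ts) : ∃ A' I', (∀ a ∈ A' + I', a ∈ A + I ∨ a = leaf) ∧
      Assembled A' I' (D.filter (2 ≤ ·)) ts := by
  induction h with
  | nil => exact ⟨0, 0, by simp, Assembled.nil⟩
  | item a _ ih =>
    obtain ⟨A', I', h1, h2⟩ := ih
    refine ⟨_, _, fun b hb => ?_, Assembled.item a h2⟩
    have := h1 b
    simp at hb this ⊢
    tauto
  | @node A I B K D D' ts us _ h ih ih' =>
    obtain ⟨A', I', h1, h2⟩ := ih
    obtain ⟨A'', I'', h3, h4⟩ := ih'
    cases us with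
    | nil =>
      obtain ⟨rfl, rfl, rfl⟩ := h.eq_zero_of_nil
      refine ⟨_, _, fun b hb => ?_, (Assembled.item leaf h2).congr rfl rfl ?_⟩
      · have := h1 b
        simp at hb this ⊢
        tauto
      · simp [Multiset.filter_singleton]
    | cons u us =>
      refine ⟨_, _, fun b hb => ?_, (Assembled.node h2 h4).congr rfl rfl ?_⟩
      · have e1 := h1 b
        have e2 := h3 b
        simp only [Multiset.mem_add] at hb e1 e2 ⊢
        clear h1 h3
        tauto
      · simp

lemma assembled_innerDegs : ∀ t : RTree, Assembled 0 0 t.innerDegs t.children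
  | leaf => Assembled.nil
  | attach t c => by
    have h := Assembled.node (assembled_innerDegs t) (assembled_innerDegs c)
    rw [node_children] at h
    exact h.congr rfl (by simp) rfl

lemma whole_degs (t : RTree) : Whole 0 t.degs t.children :=
  ⟨0, 0, _, assembled_innerDegs t, by simp, rfl⟩

/-- The leaves of a tree can be considered as items. -/
lemma Whole.exists_filter {J ρ : RTree → ℝ} (E : Exchangeable ρ J) {D : Multiset ℕ}
    {ts : List RTree} (h : Whole 0 D ts) {d : ℕ} (hd : d ∈ D) (hd2 : 2 ≤ d) :
    ∃ (n : ℕ) (ts' : List RTree), Whole (List.replicate n leaf : List RTree) (D.filter (2 ≤ ·)) ts'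
      ∧ J (node ts) = J (node ts') := by
  -- The root is moved to a vertex of degree at least `2`, as a root of degree `1` cannot be turned
  -- into an item.
  obtain ⟨ts', h1, ⟨A, I, D', h2, h3, rfl⟩, h4⟩ := E.exists_root h hd
  obtain ⟨A', I', h5, h6⟩ := h2.exists_filter
  refine ⟨(A' + I').card, ts', ⟨A', I', _, h6, ?_, ?_⟩, h4⟩
  · rw [Multiset.coe_replicate, eq_comm, Multiset.eq_replicate]
    exact ⟨rfl, fun b hb => (h5 b hb).resolve_left (by rw [← h3]; simp)⟩
  · rw [Multiset.filter_add, Multiset.filter_singleton, if_pos (by omega)]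

namespace Exchangeable

variable {ρ J : RTree → ℝ} (E : Exchangeable ρ J)
include E

/-- Transferring a unit from a degree to a larger one does not decrease the maximum of `J`. -/
lemma exists_transfer {a b : ℕ} (hba : b ≤ a) (hb : 2 ≤ b) {X : Multiset ℕ} {ts : List RTree}
    (h : Whole 0 ({a} + ({b} + X)) ts) :
    ∃ ts', Whole 0 ({a + 1} + ({b - 1} + X)) ts' ∧ J (node ts) ≤ J (node ts') := by
  obtain ⟨ts₀, h1, ⟨A, I', D', h2, h3, h4⟩, h5⟩ := E.exists_root h (d := a) (by simp)
  rw [h1] at h4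
  obtain rfl := add_left_cancel h4
  obtain ⟨rfl, rfl⟩ : A = 0 ∧ I' = 0 := by
    have := add_eq_zero.1 h3.symm
    exact this
  obtain ⟨L, F, R, AF, IF, AR, IR, IL, DF, DR, DL, h6, h7, h8, h9, h10, h11, h12, h13⟩ :=
    h2.locate (.inr b) (by simp)
  have h11 : b = R.length + 1 := h11
  obtain ⟨Ts, hp, hs⟩ := exists_sorted ρ (L ++ R)
  have hlen := hp.length_eq
  rw [List.length_append] at hlen
  -- The vertices carry `a - 1` and `b - 1` branches apart from the path. With `s = a` they receive
  -- `a` and `b - 2`, so their degrees become `a + 1` and `b - 1`.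
  have hex := E.exchange F hp hs (s := a) (by omega) (by omega) (by omega) (by omega)
  have key : ∃ F', (F' = F ∨ F' = F.reverse) ∧
      J (plug (L :: F) (node R)) ≤ J (plug (Ts.take a :: F') (node (Ts.drop a))) := by
    rcases hex with hex | hex
    · exact ⟨F, Or.inl rfl, hex⟩
    · exact ⟨F.reverse, Or.inr rfl, hex.trans_eq (E.reverse _ _ _)⟩
  obtain ⟨F', hF', hJ⟩ := key
  have hF : Assembled AF IF DF F'.flatten ∧ pathDegs F' = pathDegs F := by
    rcases hF' with rfl | rfl
    · exact ⟨h9, rfl⟩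
    · exact ⟨h9.reverse_frames, pathDegs_reverse F⟩
  have hTs := (h8.append h10).perm hp
  rw [← List.take_append_drop a Ts] at hTs
  obtain ⟨A₁, I₁, D₁, A₂, I₂, D₂, hX, hY, e1, e2, e3⟩ := hTs.exists_split
  refine ⟨plug F' (node (Ts.drop a)) :: Ts.take a, ?_, (h5.trans (E.iso h6)).le.trans hJ⟩
  have hw := whole_plug hX hF.1 hY
  have l1 : (Ts.take a).length = a := by
    rw [List.length_take]
    omega
  have l2 : (Ts.drop a).length + 1 = b - 1 := by
    rw [List.length_drop]
    omega
  rw [l1, l2, hF.2] at hw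
  convert hw using 1
  · have h14 : (0 : Multiset RTree) = AR + (IL + IR + (AF + IF)) := by
      rw [h12]
      have : AR = 0 ∧ IR = 0 ∧ IL = 0 ∧ AF = 0 ∧ IF = 0 := by
        simp only [eq_comm (a := (0 : Multiset RTree)), add_eq_zero] at h12
        tauto
      simp [this]
    have h15 : A₁ + A₂ = AR := by rw [← e1, zero_add]
    rw [h14, ← h15, e2]
    abel
  · rw [h11] at h13
    have h14 : X = DL + DR + (DF + pathDegs F) := by
      have : {R.length + 1} + X = {R.length + 1} + (DL + DR + (DF + pathDegs F)) := by
        rw [h13]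
        abel
      exact add_left_cancel this
    rw [h14, e3]
    abel

end Exchangeable

end RTree

/-! ### Majorisation -/

/-- Majorisation of lists, with an additional amount `s` available at the beginning. -/
def MajorisedWith : ℕ → List ℕ → List ℕ → Prop
  | s, [], [] => s = 0
  | s, x :: D, y :: B => x ≤ y + s ∧ MajorisedWith (y + s - x) D B
  | _, _, _ => False

/-- The sum of the slacks in a majorisation. -/
def totalSlack : ℕ → List ℕ → List ℕ → ℕ
  | s, x :: D, y :: B => s + totalSlack (y + s - x) D B
  | s, _, _ => s

lemma majorisedWith_of_take : ∀ {s : ℕ} {D B : List ℕ}, B.length = D.length → s + B.sum = D.sum →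
    (∀ k, (D.take k).sum ≤ s + (B.take k).sum) → MajorisedWith s D B
  | s, [], [], _, h, _ => by simpa [MajorisedWith] using h
  | s, x :: D, y :: B, hl, h, hk => by
    have h1 := hk 1
    simp at h1 h hl
    refine ⟨by omega, majorisedWith_of_take hl (by omega) fun k => ?_⟩
    have := hk (k + 1)
    simp at this
    omega
  | _, [], _ :: _, hl, _, _ => by simp at hl
  | _, _ :: _, [], hl, _, _ => by simp at hl

lemma Majorises.majorisedWith {B D : List ℕ} (h : Majorises B D) : MajorisedWith 0 D B := by
  obtain ⟨h1, h2, h3⟩ := h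
  refine majorisedWith_of_take h1 (by simpa using h2) fun k => ?_
  rw [zero_add]
  rcases Nat.eq_zero_or_pos k with rfl | hk
  · simp
  · by_cases hkB : k < B.length
    · exact h3 k hk hkB
    · rw [List.take_of_length_le (by omega), List.take_of_length_le (by omega), h2]

lemma MajorisedWith.head_le {s : ℕ} {x y : ℕ} {D B : List ℕ}
    (h : MajorisedWith s (x :: D) (y :: B)) : x ≤ y + s := h.1

/-- The unit is taken from the first entry `b` after which no slack is left. It exceeds the entry of
`B` at its position, whereas the next entry is bounded by the next entry of `B`, so the list remains
sorted when `b` is lowered. The slack is reduced by one up to there and unchanged beyond. -/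
lemma MajorisedWith.exists_lower : ∀ {s : ℕ} {D B : List ℕ}, MajorisedWith s D B → 0 < s →
    D.Pairwise (· ≥ ·) → B.Pairwise (· ≥ ·) → (∀ y ∈ B, 1 ≤ y) →
    ∃ Q b S, D = Q ++ b :: S ∧ MajorisedWith (s - 1) (Q ++ (b - 1) :: S) B ∧ 2 ≤ b ∧
      (∀ z ∈ S, z ≤ b - 1) ∧ totalSlack (s - 1) (Q ++ (b - 1) :: S) B < totalSlack s D B
  | s, [], [], h, hs, _, _, _ => by
    simp [MajorisedWith] at h
    omega
  | s, x :: D, y :: B, h, hs, hD, hB, h1 => by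
    obtain ⟨h2, h3⟩ := h
    have hy := h1 y (by simp)
    rcases h2.eq_or_lt with h4 | h4
    · refine ⟨[], x, D, rfl, ⟨by omega, ?_⟩, by omega, ?_, ?_⟩
      · convert h3 using 1
        omega
      · have h5 : y + s - x = 0 := by omega
        rw [h5] at h3
        intro z hz
        match D, B, h3 with
        | x' :: D, y' :: B, h3 =>
          have h6 := h3.head_le
          have h7 : y' ≤ y := List.rel_of_pairwise_cons hB (by simp)
          have h8 : z ≤ x' := by
            rcases List.mem_cons.1 hz with rfl | hz
            · exact le_rfl
            · exact List.rel_of_pairwise_cons hD.of_cons hz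
          omega
      · simp only [List.nil_append, totalSlack]
        rw [show y + (s - 1) - (x - 1) = y + s - x by omega]
        omega
    · obtain ⟨Q, b, S, rfl, h5, h6, h7, h8⟩ := exists_lower h3 (by omega) hD.of_cons hB.of_cons
        fun z hz => h1 z (by simp [hz])
      have h9 : y + (s - 1) - x = y + s - x - 1 := by omega
      refine ⟨x :: Q, b, S, rfl, ⟨by omega, by rwa [h9]⟩, h6, h7, ?_⟩
      simp only [List.cons_append, totalSlack]
      rw [h9]
      omega

/-- A unit is added at the first position where the lists differ (there `D` is smaller than `B`) and
removed at the first later position where the slack is exhausted. All slacks in between decrease, so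
`totalSlack` measures the progress. -/
lemma MajorisedWith.exists_transfer : ∀ {D B : List ℕ}, MajorisedWith 0 D B → D ≠ B →
    D.Pairwise (· ≥ ·) → B.Pairwise (· ≥ ·) → (∀ y ∈ B, 1 ≤ y) →
    ∃ P a Q b S, D = P ++ a :: (Q ++ b :: S) ∧
      MajorisedWith 0 (P ++ (a + 1) :: (Q ++ (b - 1) :: S)) B ∧ 2 ≤ b ∧
      (∀ z ∈ S, z ≤ b - 1) ∧ (∃ a' ∈ B, a + 1 ≤ a') ∧ (∀ p ∈ P, a + 1 ≤ p) ∧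
      totalSlack 0 (P ++ (a + 1) :: (Q ++ (b - 1) :: S)) B < totalSlack 0 D B
  | [], [], _, hne, _, _, _ => absurd rfl hne
  | x :: D, y :: B, h, hne, hD, hB, h1 => by
    obtain ⟨h2, h3⟩ := h
    rcases h2.eq_or_lt with h4 | h4
    · rw [add_zero] at h4
      subst h4
      rw [add_zero, Nat.sub_self] at h3
      obtain ⟨P, a, Q, b, S, rfl, h5, h6, h7, ⟨a', ha', haa'⟩, h9, h10⟩ :=
        exists_transfer h3 (fun e => hne (by rw [e])) hD.of_cons hB.of_cons
          fun z hz => h1 z (by simp [hz])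
      have hax : a' ≤ x := List.rel_of_pairwise_cons hB ha'
      refine ⟨x :: P, a, Q, b, S, rfl, ⟨by omega, by simpa using h5⟩, h6, h7,
        ⟨a', by simp [ha'], haa'⟩, ?_, ?_⟩
      · intro p hp
        rcases List.mem_cons.1 hp with rfl | hp
        · omega
        · exact h9 p hp
      · simpa [totalSlack] using h10
    · obtain ⟨Q, b, S, rfl, h5, h6, h7, h8⟩ := MajorisedWith.exists_lower h3 (by omega) hD.of_cons
        hB.of_cons fun z hz => h1 z (by simp [hz])
      have h9 : y + 0 - (x + 1) = y + 0 - x - 1 := by omega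
      refine ⟨[], x, Q, b, S, rfl, ⟨by omega, by rwa [h9]⟩, h6, h7, ⟨y, by simp, by omega⟩, by simp,
        ?_⟩
      simp only [List.nil_append, totalSlack]
      rw [h9]
      omega

/-- Each unit transfer between lists is realised by an exchange in the tree; induction on the total
slack. -/
theorem RTree.Exchangeable.le_of_majorisedWith {ρ J : RTree → ℝ} (E : Exchangeable ρ J)
    {B : List ℕ} (hB : B.Pairwise (· ≥ ·)) (hB1 : ∀ y ∈ B, 1 ≤ y) :
    ∀ (n : ℕ) {D : List ℕ} {ts : List RTree}, totalSlack 0 D B = n → D.Pairwise (· ≥ ·) →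
      MajorisedWith 0 D B → Whole 0 D ts →
      ∃ ts', Whole 0 (B : List ℕ) ts' ∧ J (node ts) ≤ J (node ts') := by
  intro n
  induction n using Nat.strong_induction_on with
  | _ n ih =>
  intro D ts hn hD hDB h
  by_cases hne : D = B
  · subst hne
    exact ⟨ts, h, le_rfl⟩
  obtain ⟨P, a, Q, b, S, rfl, h1, h2, h3, -, h4, h5⟩ := hDB.exists_transfer hne hD hB hB1
  simp only [List.pairwise_append, List.pairwise_cons] at hD
  have hab : b ≤ a := hD.2.1.1 b (by simp)
  obtain ⟨ts', h6, h7⟩ := E.exists_transfer hab h2 (X := (P ++ (Q ++ S) : List ℕ)) (ts := ts) (by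
    convert h using 1
    simp only [← Multiset.coe_add, ← Multiset.cons_coe, ← Multiset.singleton_add]
    abel)
  obtain ⟨ts'', h8, h9⟩ := ih _ (by omega) rfl (by
    simp only [List.pairwise_append, List.pairwise_cons]
    refine ⟨hD.1, ⟨?_, hD.2.1.2.1, ⟨h3, hD.2.1.2.2.1.2⟩, ?_⟩, ?_⟩
    · intro z hz
      have a1 := hD.2.1.1 z
      simp at hz a1
      rcases hz with hz | rfl | hz
      · exact (a1 (Or.inl hz)).trans (by omega)
      · omega
      · exact (a1 (Or.inr (Or.inr hz))).trans (by omega)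
    · intro z hz w hw
      have a2 := hD.2.1.2.2.2 z hz
      rcases List.mem_cons.1 hw with rfl | hw
      · have := a2 b (by simp)
        omega
      · exact a2 w (by simp [hw])
    · intro p hp w hw
      have a3 := hD.2.2 p hp
      simp at hw a3
      rcases hw with rfl | hw | rfl | hw
      · exact h4 p hp
      · exact a3.2 w (Or.inl hw)
      · have := a3.2 b (by simp)
        omega
      · exact a3.2 w (Or.inr (Or.inr hw))) h1 (ts := ts') (by
    convert h6 using 1
    simp only [← Multiset.coe_add, ← Multiset.cons_coe, ← Multiset.singleton_add]
    abel)
  exact ⟨ts'', h8, h7.trans h9⟩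

/-! ### Contracting the vertices of a list of parents -/

open RTree in
/-- The vertices of `G` in the set `U` induce a copy of the tree `t` with root `r`. -/
def Spans {W : Type} (G : SimpleGraph W) (U : Set W) (r : W) (t : RTree) : Prop :=
  ∃ f : t.Vert → W, f.Injective ∧ Set.range f = U ∧ f t.root = r ∧
    ∀ a b, G.Adj (f a) (f b) ↔ t.graph.Adj a b

lemma Spans.congr {W : Type} {G : SimpleGraph W} {U : Set W} {r : W} {t s : RTree}
    (h : Spans G U r t) (e : t.Iso s) : Spans G U r s := by
  obtain ⟨f, h1, h2, h3, h4⟩ := h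
  obtain ⟨φ, hφ⟩ := e
  refine ⟨f ∘ φ.symm, h1.comp φ.symm.injective, ?_, ?_, fun a b => ?_⟩
  · rw [← h2]
    exact φ.symm.surjective.range_comp f
  · rw [← h3, ← hφ]
    simp
  · rw [Function.comp_apply, Function.comp_apply, h4, φ.symm.map_adj_iff]

/-- `G` arises from the tree given by the list of parents `p` by replacing every vertex `j` by
a copy of the rooted tree `δ j`, where edges join the roots. -/
def Fib {W : Type} (G : SimpleGraph W) (p : List ℕ) (δ : ℕ → RTree) : Prop :=
  ∃ (π : W → ℕ) (r : ℕ → W), (∀ w, π w < p.length) ∧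
    (∀ j < p.length, Spans G (π ⁻¹' {j}) (r j) (δ j)) ∧
    ∀ u w, π u < π w →
      (G.Adj u w ↔ u = r (π u) ∧ w = r (π w) ∧ p[π w]? = some (π u))

namespace Fib

variable {W : Type} {G : SimpleGraph W} {p : List ℕ} {δ δ' : ℕ → RTree}

lemma congr (h : Fib G p δ) (e : ∀ j < p.length, (δ j).Iso (δ' j)) : Fib G p δ' := by
  obtain ⟨π, r, h1, h2, h3⟩ := h
  exact ⟨π, r, h1, fun j hj => (h2 j hj).congr (e j hj), h3⟩

lemma nonempty_iso {x : ℕ} (h : Fib G [x] δ) : Nonempty (G ≃g (δ 0).graph) := by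
  obtain ⟨π, r, h1, h2, -⟩ := h
  obtain ⟨f, hf, hU, -, hadj⟩ := h2 0 (by simp)
  have hsurj : f.Surjective := by
    intro w
    have : w ∈ Set.range f := by
      rw [hU]
      simpa using h1 w
    exact this
  exact ⟨RelIso.symm ⟨Equiv.ofBijective f ⟨hf, hsurj⟩, by
    intro a b
    exact hadj a b⟩⟩

/-- The last vertex has no vertex below it, so its block can be absorbed into the block of its
parent `x`; the edge between the two roots becomes the edge of `attach`. -/
lemma merge {x : ℕ} (hx : x < p.length) (h : Fib G (p ++ [x]) δ) :
    Fib G p (Function.update δ x (.attach (δ x) (δ p.length))) := by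
  obtain ⟨π, r, h1, h2, h3⟩ := h
  have hr : ∀ j ≤ p.length, π (r j) = j := by
    intro j hj
    obtain ⟨f, -, hU, hf, -⟩ := h2 j (by simp; omega)
    have : r j ∈ π ⁻¹' {j} := by
      rw [← hU, ← hf]
      exact ⟨_, rfl⟩
    exact this
  have hlt : ∀ w, π w ≤ p.length := fun w => by
    have := h1 w
    simp at this
    omega
  refine ⟨fun w => if π w = p.length then x else π w, r, ?_, ?_, ?_⟩
  · intro w
    have := hlt w
    dsimp only
    split_ifs <;> omega
  · intro j hj
    by_cases hjx : j = x
    · subst hjx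
      rw [Function.update_self]
      obtain ⟨f, hf, hU, hfr, hfa⟩ := h2 j (by simp; omega)
      obtain ⟨g, hg, hV, hgr, hga⟩ := h2 p.length (by simp)
      have hfπ : ∀ a, π (f a) = j := fun a => by
        have : f a ∈ π ⁻¹' {j} := by
          rw [← hU]
          exact ⟨_, rfl⟩
        exact this
      have hgπ : ∀ a, π (g a) = p.length := fun a => by
        have : g a ∈ π ⁻¹' {p.length} := by
          rw [← hV]
          exact ⟨_, rfl⟩
        exact this
      have hfg : ∀ a b, G.Adj (f a) (g b) ↔ a = (δ j).root ∧ b = (δ p.length).root := by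
        intro a b
        rw [h3 _ _ (by rw [hfπ, hgπ]; exact hj), hfπ, hgπ, ← hfr, ← hgr, hf.eq_iff, hg.eq_iff]
        simp
      refine ⟨Sum.elim f g, ?_, ?_, hfr, ?_⟩
      · refine hf.sumElim hg fun a b hab => ?_
        have := hfπ a
        rw [hab, hgπ] at this
        omega
      · refine (Set.Sum.elim_range f g).trans ?_
        rw [hU, hV]
        ext w
        simp only [Set.mem_union, Set.mem_preimage, Set.mem_singleton_iff]
        split_ifs <;> omega
      · rintro (a | a) (b | b)
        · exact (hfa a b).trans (SimpleGraph.bridge_inl_inl).symm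
        · exact (hfg a b).trans (SimpleGraph.bridge_inl_inr).symm
        · rw [SimpleGraph.adj_comm]
          exact (hfg b a).trans (SimpleGraph.bridge_inr_inl).symm
        · exact (hga a b).trans (SimpleGraph.bridge_inr_inr).symm
    · rw [Function.update_of_ne hjx]
      convert h2 j (by simp; omega) using 1
      ext w
      simp only [Set.mem_preimage, Set.mem_singleton_iff]
      split_ifs <;> omega
  · intro u w huw
    have hu := hlt u
    have hw := hlt w
    dsimp only at huw ⊢
    split_ifs at huw ⊢ with hu' hw' hw'
    · omega
    · rw [SimpleGraph.adj_comm, h3 _ _ (by omega)]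
      constructor
      · rintro ⟨-, -, h⟩
        rw [hu'] at h
        simp at h
        omega
      · rintro ⟨h, -⟩
        rw [h, hr x hx.le] at hu'
        omega
    · rw [h3 _ _ (by omega)]
      constructor
      · rintro ⟨-, -, h⟩
        rw [hw'] at h
        simp at h
        omega
      · rintro ⟨-, h, -⟩
        rw [h, hr x hx.le] at hw'
        omega
    · rw [h3 _ _ huw, List.getElem?_append_left (by omega)]

/-- The children are absorbed from the last to the first, so they precede `ts` in the order of their
numbers. -/
lemma merge_replicate {x : ℕ} (hx : x < p.length) : ∀ {c : ℕ} {δ : ℕ → RTree} {ts : List RTree},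
    Fib G (p ++ List.replicate c x) δ → δ x = RTree.node ts →
    Fib G p (Function.update δ x (RTree.node ((List.range' p.length c).map δ ++ ts)))
  | 0, δ, ts, h, hts => by
    simpa [← hts] using h
  | c + 1, δ, ts, h, hts => by
    rw [List.replicate_succ', ← List.append_assoc] at h
    have h1 := merge (p := p ++ List.replicate c x) (by simp; omega) h
    have h2 := merge_replicate hx (ts := δ (p.length + c) :: ts) h1 (by
      rw [Function.update_self, hts]
      simp [RTree.node])
    rw [Function.update_idem] at h2
    convert h2 using 3
    rw [List.range'_concat]
    simp only [List.map_append, List.append_assoc, one_mul]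
    congr 1
    · apply List.map_congr_left
      intro j hj
      rw [Function.update_of_ne]
      rw [List.mem_range'_1] at hj
      omega

end Fib

/-- Lists of parents in which every parent precedes its children. -/
inductive IsParentList : List ℕ → Prop
  | single : IsParentList [0]
  | snoc {p : List ℕ} {x : ℕ} (h : IsParentList p) (hx : x < p.length) : IsParentList (p ++ [x])

namespace IsParentList

variable {p : List ℕ}

lemma append_replicate (h : IsParentList p) {x : ℕ} (hx : x < p.length) :
    ∀ c, IsParentList (p ++ List.replicate c x)
  | 0 => by simpa using h
  | c + 1 => by
    rw [List.replicate_succ', ← List.append_assoc]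
    exact (append_replicate h hx c).snoc (by simp; omega)

lemma length_pos (h : IsParentList p) : 0 < p.length := by
  induction h <;> simp

lemma lt_length (h : IsParentList p) : ∀ x ∈ p, x < p.length := by
  induction h with
  | single => simp
  | snoc h hx ih =>
    intro y hy
    simp at hy ⊢
    rcases hy with hy | rfl
    · exact (ih y hy).le
    · omega

lemma getElem?_lt (h : IsParentList p) {i j : ℕ} (hj : p[j]? = some i) : i < j ∨ i = 0 ∧ j = 0 := by
  induction h with
  | single =>
    rcases j with - | j
    · right
      simpa using hj.symm
    · simp at hj
  | @snoc p x h hx ih =>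
    rcases lt_trichotomy j p.length with hjl | rfl | hjl
    · rw [List.getElem?_append_left hjl] at hj
      exact ih hj
    · simp at hj
      omega
    · rw [List.getElem?_eq_none (by simp; omega)] at hj
      simp at hj

lemma fib (h : IsParentList p) : Fib (parentGraph p) p fun _ => RTree.leaf := by
  refine ⟨Fin.val, fun j => if hj : j < p.length then ⟨j, hj⟩ else ⟨0, h.length_pos⟩, fun w => w.2,
    ?_, ?_⟩
  · intro j hj
    refine ⟨fun _ => ⟨j, hj⟩, fun a b _ => Subsingleton.elim (α := Unit) a b, ?_, by simp [hj], ?_⟩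
    · ext w
      simp [Fin.ext_iff, eq_comm]
      exact fun _ => ⟨RTree.root _⟩
    · intro a b
      have : a = b := Subsingleton.elim (α := Unit) a b
      subst this
      simp
  · intro u w huw
    have h1 : p[(u : ℕ)] ≠ w := by
      intro h'
      rcases h.getElem?_lt (i := w) (j := u) (by rw [← h']; simp) with h | h <;> omega
    simp only [parentGraph, SimpleGraph.fromRel_adj, List.get_eq_getElem, h1, or_false, u.2, w.2,
      dite_true, true_and, List.getElem?_eq_getElem, Option.some.injEq]
    exact ⟨fun h => h.2, fun h => ⟨by rintro rfl; omega, h⟩⟩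

end IsParentList

open RTree

/-! ### Greedy trees -/

lemma greedyParents_concat {C : List ℕ} (hC : C ≠ []) (b : ℕ) :
    greedyParents (C ++ [b]) = greedyParents C ++ List.replicate (b - 1) C.length := by
  have : C.length ≠ 0 := by simpa using hC
  simp [greedyParents, List.mapIdx_concat, this]

lemma greedyParents_singleton (b : ℕ) :
    greedyParents [b] = [0] ++ List.replicate b 0 := by
  simp [greedyParents]

lemma range'_succ_of_lt {a b : ℕ} (h : a < b) :
    List.range' a (b - a) = a :: List.range' (a + 1) (b - (a + 1)) := by
  rw [show b - a = (b - (a + 1)) + 1 by omega, List.range'_succ]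

/-- The queue consists of the vertices that have been numbered, but whose children have not been
created by the degrees in `B`. When the last degree `b` is taken away, the last `b - 1` of them are
contracted into vertex `C.length`. This vertex has the smallest number, so it enters the queue at
the front. -/
lemma Fib.nonempty_iso_mergeBack {W : Type} {G : SimpleGraph W} : ∀ {B : List ℕ} {δ : ℕ → RTree},
    B ≠ [] → (∀ C, C <+: B → C ≠ B → C.length < (greedyParents C).length) →
    (∀ j < B.length, δ j = leaf) → Fib G (greedyParents B) δ →
    Nonempty (G ≃g (mergeBack ((List.range' B.length ((greedyParents B).length - B.length)).map δ)
      B.reverse).graph) := by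
  intro B
  induction B using List.reverseRecOn with
  | nil => simp
  | append_singleton C b ih =>
    intro δ _ hlt hδ h
    by_cases hC : C = []
    · subst hC
      rw [List.nil_append, greedyParents_singleton] at h
      have h1 := h.merge_replicate (ts := []) (by simp) (hδ 0 (by simp))
      have h2 := h1.nonempty_iso
      rw [Function.update_self, List.append_nil] at h2
      have key : mergeBack ((List.range' ([] ++ [b]).length
          ((greedyParents ([] ++ [b])).length - ([] ++ [b]).length)).map δ) ([] ++ [b]).reverse =
          node ((List.range' 1 b).map δ) := by
        simp [greedyParents_singleton, mergeBack]
      rw [key]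
      exact h2
    · obtain ⟨e, ds, hds⟩ := List.exists_cons_of_ne_nil (l := C.reverse) (by simpa using hC)
      rw [greedyParents_concat hC] at h
      have hCl := hlt C (List.prefix_append C [b]) (by simp)
      have h1 := h.merge_replicate (ts := []) hCl (hδ C.length (by simp))
      have h2 := ih hC (fun C' hC' hne => hlt C' (hC'.trans (List.prefix_append C [b])) (by
          rintro rfl
          have := hC'.length_le
          simp at this)) (fun j hj => by
          rw [Function.update_of_ne (by omega)]
          exact hδ j (by simp; omega)) h1
      rw [hds, range'_succ_of_lt hCl, List.map_cons, Function.update_self, List.append_nil] at h2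
      rw [List.reverse_append, hds, List.reverse_singleton, List.singleton_append, mergeBack]
      have hmap : (List.range' (C.length + 1) ((greedyParents C).length - (C.length + 1))).map
          (Function.update δ C.length (node ((List.range' (greedyParents C).length (b - 1)).map δ)))
          = (List.range' (C.length + 1) ((greedyParents C).length - (C.length + 1))).map δ := by
        refine List.map_congr_left fun j hj => ?_
        rw [List.mem_range'_1] at hj
        rw [Function.update_of_ne (by omega)]
      rw [hmap] at h2
      have hq : (List.range' (C ++ [b]).length
          ((greedyParents (C ++ [b])).length - (C ++ [b]).length)).map δ =
          (List.range' (C.length + 1) ((greedyParents C).length - (C.length + 1))).map δ ++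
          (List.range' (greedyParents C).length (b - 1)).map δ := by
        rw [← List.map_append, greedyParents_concat hC]
        congr 1
        have := List.range'_append_1 (s := C.length + 1)
          (m := (greedyParents C).length - (C.length + 1)) (n := b - 1)
        rw [show C.length + 1 + ((greedyParents C).length - (C.length + 1)) =
          (greedyParents C).length by omega] at this
        rw [this]
        simp
        omega
      rw [hq]
      have hlen : (((List.range' (C.length + 1) ((greedyParents C).length - (C.length + 1))).map δ ++
          (List.range' (greedyParents C).length (b - 1)).map δ)).length - (b - 1) =
          ((List.range' (C.length + 1) ((greedyParents C).length - (C.length + 1))).map δ).length := by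
        simp
      rw [hlen, List.drop_left, List.take_left]
      exact h2

lemma length_greedyParents {C : List ℕ} (hC : C ≠ []) (h1 : ∀ x ∈ C, 1 ≤ x) :
    (greedyParents C).length + C.length = C.sum + 2 := by
  induction C using List.reverseRecOn with
  | nil => simp at hC
  | append_singleton C b ih =>
    by_cases hC : C = []
    · subst hC
      simp [greedyParents_singleton]
    · have := ih hC fun x hx => h1 x (by simp [hx])
      have := h1 b (by simp)
      rw [greedyParents_concat hC]
      simp
      omega

lemma isParentList_greedyParents {B : List ℕ} :
    (∀ C, C <+: B → C ≠ B → C.length < (greedyParents C).length) →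
    IsParentList (greedyParents B) := by
  induction B using List.reverseRecOn with
  | nil => exact fun _ => .single
  | append_singleton C b ih =>
    intro hlt
    by_cases hC : C = []
    · subst hC
      rw [List.nil_append, greedyParents_singleton]
      exact IsParentList.single.append_replicate (by simp) _
    · rw [greedyParents_concat hC]
      refine (ih fun C' hC' hne => hlt C' (hC'.trans (List.prefix_append C [b])) ?_).append_replicate
        (hlt C (List.prefix_append C [b]) (by simp)) _
      rintro rfl
      have := hC'.length_le
      simp at this

/-- The next vertex to be processed always exists. As long as all degrees are at least `2`, more
vertices are created than processed; after an entry below `2` only entries at most `1` follow, and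
the sum of `B` forces enough vertices to exist already. -/
lemma length_lt_length_greedyParents {B : List ℕ} (hB : B.Pairwise (· ≥ ·)) (h1 : ∀ x ∈ B, 1 ≤ x)
    (hs : B.sum + 2 = 2 * B.length) {C : List ℕ} (hC : C <+: B) (hne : C ≠ B) :
    C.length < (greedyParents C).length := by
  obtain ⟨R, rfl⟩ := hC
  by_cases hC : C = []
  · subst hC
    simp [greedyParents]
  have hR : R ≠ [] := by
    rintro rfl
    simp at hne
  have hlen := length_greedyParents hC fun x hx => h1 x (by simp [hx])
  have hR0 := List.length_pos_of_ne_nil hR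
  rw [List.pairwise_append] at hB
  by_cases h2 : ∀ x ∈ C, 2 ≤ x
  · have := two_mul_length_le_sum h2
    omega
  · push Not at h2
    obtain ⟨x, hx, hx2⟩ := h2
    have : R.sum ≤ R.length := by
      simpa using List.sum_le_card_nsmul R 1 fun y hy => by
        have := hB.2.2 x hx y hy
        omega
    simp at hs
    omega

/-- For `d = 1` nothing is taken from the queue, and `node []` is put in front of it. So the ones in
`B` only supply the initial leaves. -/
lemma mergeBack_append_ones : ∀ (m : ℕ) (q : List RTree) {ds : List ℕ}, ds ≠ [] →
    mergeBack q (List.replicate m 1 ++ ds) = mergeBack (List.replicate m leaf ++ q) ds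
  | 0, q, ds, _ => by simp
  | m + 1, q, ds, h => by
    obtain ⟨e, l, hl⟩ := List.exists_cons_of_ne_nil (l := List.replicate m 1 ++ ds) (by simp [h])
    rw [List.replicate_succ, List.cons_append, hl, mergeBack, ← hl, mergeBack_append_ones m _ h]
    simp [node, List.replicate_succ']

lemma filter_append_replicate_one {B : List ℕ} (hB : B.Pairwise (· ≥ ·)) (h1 : ∀ x ∈ B, 1 ≤ x) :
    ∃ m, B = B.filter (2 ≤ ·) ++ List.replicate m 1 := by
  induction B with
  | nil => exact ⟨0, rfl⟩
  | cons b B ih =>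
    obtain ⟨m, hm⟩ := ih hB.of_cons fun x hx => h1 x (by simp [hx])
    by_cases hb : 2 ≤ b
    · refine ⟨m, ?_⟩
      rw [List.filter_cons_of_pos (by simpa using hb), List.cons_append, ← hm]
    · have hb1 : b = 1 := by
        have := h1 b (by simp)
        omega
      refine ⟨B.length + 1, ?_⟩
      have hall : ∀ x ∈ b :: B, x = 1 := by
        intro x hx
        have := h1 x hx
        rcases List.mem_cons.1 hx with rfl | hx
        · exact hb1
        · have := List.rel_of_pairwise_cons hB hx
          omega
      rw [List.filter_eq_nil_iff.2 (by
        intro x hx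
        simp [hall x hx]), List.nil_append]
      exact List.eq_replicate_iff.2 ⟨by simp, hall⟩

/-- The greedy tree arises by repeatedly merging branches at the end of a queue. -/
theorem nonempty_iso_greedy {B : List ℕ} (hB : B.Pairwise (· ≥ ·)) (h1 : ∀ x ∈ B, 1 ≤ x)
    (hs : B.sum + 2 = 2 * B.length) (h2 : ∃ x ∈ B, 2 ≤ x) {N : ℕ}
    (hN : N + 2 * (B.filter (2 ≤ ·)).length = (B.filter (2 ≤ ·)).sum + 2) :
    Nonempty (parentGraph (greedyParents B) ≃g
      (mergeBack (List.replicate N leaf) (B.filter (2 ≤ ·)).reverse).graph) := by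
  have hne : B ≠ [] := by
    rintro rfl
    simp at h2
  have hlt := fun C => length_lt_length_greedyParents (C := C) hB h1 hs
  have hlen := length_greedyParents hne h1
  have h := Fib.nonempty_iso_mergeBack hne hlt (fun _ _ => rfl) (isParentList_greedyParents hlt).fib
  rw [show (greedyParents B).length - B.length = 0 by omega] at h
  obtain ⟨m, hm⟩ := filter_append_replicate_one hB h1
  have hf : (B.filter (2 ≤ ·)).reverse ≠ [] := by
    obtain ⟨x, hx, hx2⟩ := h2
    simpa using ⟨x, hx, hx2⟩
  have hNm : m = N := by
    rw [hm] at hs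
    simp only [List.sum_append, List.length_append, List.sum_replicate, List.length_replicate,
      smul_eq_mul, mul_one] at hs
    omega
  subst hNm
  have key : mergeBack [] B.reverse =
      mergeBack (List.replicate m leaf) (B.filter (2 ≤ ·)).reverse := by
    conv_lhs => rw [hm, List.reverse_append, List.reverse_replicate, mergeBack_append_ones _ _ hf,
      List.append_nil]
  rw [← key]
  exact h

open RTree

/-! ### Leaves of a list of parents -/

/-- The leaves among the children of `v`. -/
def leavesAt (p : List ℕ) (v : ℕ) : List ℕ :=
  (List.range p.length).filter fun y => p[y]? = some v ∧ y ∉ p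

/-- The leaves adjacent to labelled vertices, in the order of the labels. -/
def LabelledTree.leafOrder (S : LabelledTree) : List ℕ := S.labels.flatMap (leavesAt S.parents)

/-- Join a star with `c` vertices to the vertex `x`, and label its centre. -/
def LabelledTree.addStar (S : LabelledTree) (x c : ℕ) : LabelledTree :=
  ⟨S.parents ++ x :: List.replicate (c - 1) S.parents.length, S.labels ++ [S.parents.length]⟩

/-- The leaves of the stars with `c` vertices, for `c` in the list, if the first centre is `n`. -/
def starLeaves : ℕ → List ℕ → List ℕ
  | _, [] => []
  | n, c :: cs => List.range' (n + 1) (c - 1) ++ starLeaves (n + c) cs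

lemma le_of_mem_starLeaves : ∀ {cs : List ℕ} {n y : ℕ}, y ∈ starLeaves n cs → n < y
  | [], _, _, h => by simp [starLeaves] at h
  | c :: cs, n, y, h => by
    rw [starLeaves, List.mem_append, List.mem_range'_1] at h
    rcases h with h | h
    · omega
    · have := le_of_mem_starLeaves h
      omega

lemma lt_of_mem_starLeaves : ∀ {cs : List ℕ} {n y : ℕ}, (∀ c ∈ cs, 1 ≤ c) → y ∈ starLeaves n cs →
    y < n + cs.sum
  | [], _, _, _, h => by simp [starLeaves] at h
  | c :: cs, n, y, h1, h => by
    rw [starLeaves, List.mem_append, List.mem_range'_1] at h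
    rw [List.sum_cons]
    rcases h with h | h
    · have := h1 c (by simp)
      omega
    · have := lt_of_mem_starLeaves (fun c hc => h1 c (by simp [hc])) h
      omega

lemma nodup_starLeaves : ∀ {cs : List ℕ} (n : ℕ), (starLeaves n cs).Nodup
  | [], _ => List.nodup_nil
  | c :: cs, n => by
    rw [starLeaves, List.nodup_append]
    refine ⟨List.nodup_range', nodup_starLeaves _, fun a ha b hb => ?_⟩
    have := le_of_mem_starLeaves hb
    rw [List.mem_range'_1] at ha
    omega

lemma length_starLeaves : ∀ {cs : List ℕ} (n : ℕ),
    (starLeaves n cs).length = (cs.map (· - 1)).sum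
  | [], _ => rfl
  | c :: cs, n => by
    rw [starLeaves]
    simp [length_starLeaves (cs := cs)]

lemma length_addStar (S : LabelledTree) (x : ℕ) {c : ℕ} (hc : 1 ≤ c) :
    (S.addStar x c).parents.length = S.parents.length + c := by
  simp [LabelledTree.addStar]
  omega

lemma mem_addStar {S : LabelledTree} {x c y : ℕ} (hc : 2 ≤ c) :
    y ∈ (S.addStar x c).parents ↔ y ∈ S.parents ∨ y = x ∨ y = S.parents.length := by
  have : c - 1 ≠ 0 := by omega
  simp [LabelledTree.addStar, List.mem_replicate, this]

lemma range_add (n m : ℕ) : List.range (n + m) = List.range n ++ List.range' n m := by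
  rw [List.range_add]
  simp [List.range'_eq_map_range]

lemma getElem?_addStar {S : LabelledTree} {x c y : ℕ} (hy : S.parents.length < y)
    (hyc : y < S.parents.length + c) :
    (S.addStar x c).parents[y]? = some S.parents.length := by
  obtain ⟨k, rfl⟩ := Nat.exists_eq_add_of_lt hy
  rw [LabelledTree.addStar]
  dsimp only
  rw [List.getElem?_append_right (by omega),
    show S.parents.length + k + 1 - S.parents.length = k + 1 by omega, List.getElem?_cons_succ,
    List.getElem?_replicate]
  simp
  omega

lemma range_addStar (S : LabelledTree) (x : ℕ) {c : ℕ} (hc : 1 ≤ c) :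
    List.range (S.addStar x c).parents.length = List.range S.parents.length ++
      S.parents.length :: List.range' (S.parents.length + 1) (c - 1) := by
  rw [length_addStar S x hc, range_add, show c = c - 1 + 1 by omega, List.range'_succ,
    show c - 1 + 1 - 1 = c - 1 by omega]

/-- With `c ≥ 2` the new centre has a child, so it is no leaf; among the old vertices only `x` stops
being a leaf. -/
lemma leavesAt_addStar {S : LabelledTree} {x c v : ℕ} (hc : 2 ≤ c) (hv : v < S.parents.length) :
    leavesAt (S.addStar x c).parents v = (leavesAt S.parents v).filter (· ≠ x) := by
  rw [leavesAt, range_addStar S x (by omega), List.filter_append, List.filter_cons_of_neg,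
    (List.filter_eq_nil_iff (l := List.range' _ _)).2, List.append_nil, leavesAt, List.filter_filter]
  · refine List.filter_congr fun y hy => ?_
    rw [List.mem_range] at hy
    have h1 : (S.addStar x c).parents[y]? = S.parents[y]? := List.getElem?_append_left hy
    have h2 : y ≠ S.parents.length := hy.ne
    simp only [mem_addStar hc, h1, h2, decide_eq_decide, not_or, ← Bool.decide_and]
    tauto
  · intro y hy
    rw [List.mem_range'_1] at hy
    rw [getElem?_addStar (by omega) (by omega)]
    simp
    omega
  · simp [mem_addStar hc]

lemma leavesAt_addStar_self {S : LabelledTree} {x c : ℕ} (hc : 2 ≤ c) (hx : x < S.parents.length)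
    (hS : ∀ y ∈ S.parents, y < S.parents.length) :
    leavesAt (S.addStar x c).parents S.parents.length =
      List.range' (S.parents.length + 1) (c - 1) := by
  rw [leavesAt, range_addStar S x (by omega), List.filter_append, List.filter_cons_of_neg,
    List.filter_eq_nil_iff.2, List.nil_append, List.filter_eq_self]
  · intro y hy
    rw [List.mem_range'_1] at hy
    have h2 : (S.addStar x c).parents[y]? = some S.parents.length :=
      getElem?_addStar (by omega) (by omega)
    have h1 : y ∉ S.parents := fun h => by
      have := hS y h
      omega
    simp only [h2, mem_addStar hc, h1, true_and, false_or, decide_eq_true_eq]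
    omega
  · intro y hy
    rw [List.mem_range] at hy
    have h1 : (S.addStar x c).parents[y]? = S.parents[y]? := List.getElem?_append_left hy
    have h2 : S.parents[y]? ≠ some S.parents.length := fun h => by
      have := hS _ (List.mem_of_getElem? h)
      omega
    simp [h1, h2]
  · simp [mem_addStar hc]

lemma leavesAt_append_replicate {p : List ℕ} {v : ℕ} (h0 : 0 ∈ p)
    (hp : ∀ y ∈ p, y < p.length) (a : ℕ) :
    leavesAt (p ++ List.replicate a 0) v =
      leavesAt p v ++ if v = 0 then List.range' p.length a else [] := by
  have hmem : ∀ y, y ∈ p ++ List.replicate a 0 ↔ y ∈ p := by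
    intro y
    simp only [List.mem_append, List.mem_replicate, or_iff_left_iff_imp]
    rintro ⟨-, rfl⟩
    exact h0
  simp only [leavesAt, hmem]
  rw [List.length_append, List.length_replicate, range_add, List.filter_append]
  congr 1
  · refine List.filter_congr fun y hy => ?_
    rw [List.mem_range] at hy
    rw [List.getElem?_append_left hy]
  · have hget : ∀ y ∈ List.range' p.length a,
        (p ++ List.replicate a 0)[y]? = some 0 ∧ y ∉ p := by
      intro y hy
      rw [List.mem_range'_1] at hy
      refine ⟨?_, fun h => ?_⟩
      · rw [List.getElem?_append_right hy.1, List.getElem?_replicate, if_pos (by omega)]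
      · have := hp y h
        omega
    split_ifs with hv
    · rw [List.filter_eq_self]
      intro y hy
      simp [hget y hy, hv]
    · rw [List.filter_eq_nil_iff]
      intro y hy
      simp [(hget y hy).1, Ne.symm hv]

namespace LabelledTree

/-- The properties of the labelled trees that occur in the construction of the `𝓜`-trees. -/
structure Proper (S : LabelledTree) : Prop where
  isParentList : IsParentList S.parents
  labels_lt : ∀ v ∈ S.labels, v < S.parents.length

variable {S : LabelledTree} {x c : ℕ}

lemma Proper.addStar (h : S.Proper) (hx : x < S.parents.length) (hc : 1 ≤ c) :
    (S.addStar x c).Proper := by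
  refine ⟨?_, fun v hv => ?_⟩
  · have := (h.isParentList.snoc hx).append_replicate (x := S.parents.length) (by simp) (c - 1)
    simpa [LabelledTree.addStar] using this
  · rw [length_addStar S x hc]
    rw [LabelledTree.addStar, List.mem_append, List.mem_singleton] at hv
    rcases hv with hv | rfl
    · have := h.labels_lt v hv
      omega
    · omega

lemma hang_cons (cs : List ℕ) : S.hang x (c :: cs) = (S.addStar x c).hang x cs := rfl

lemma Proper.hang : ∀ {cs : List ℕ} {S : LabelledTree}, S.Proper → x < S.parents.length →
    (∀ c ∈ cs, 1 ≤ c) → (S.hang x cs).Proper ∧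
      (S.hang x cs).parents.length = S.parents.length + cs.sum ∧ S.parents <+: (S.hang x cs).parents
  | [], S, h, _, _ => ⟨h, rfl, List.prefix_rfl⟩
  | c :: cs, S, h, hx, hcs => by
    have hc := hcs c (by simp)
    have hl := length_addStar S x hc
    obtain ⟨h1, h2, h3⟩ := Proper.hang (cs := cs) (h.addStar hx hc) (by omega)
      fun c hc => hcs c (by simp [hc])
    rw [hang_cons]
    refine ⟨h1, ?_, List.IsPrefix.trans (List.prefix_append _ _) h3⟩
    rw [h2, hl, List.sum_cons, add_assoc]

lemma leavesAt_hang : ∀ {cs : List ℕ} {S : LabelledTree} {v : ℕ}, (∀ c ∈ cs, 2 ≤ c) →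
    v < S.parents.length → (∀ y ∈ leavesAt S.parents v, y ≠ x) →
    leavesAt (S.hang x cs).parents v = leavesAt S.parents v
  | [], _, _, _, _, _ => rfl
  | c :: cs, S, v, hcs, hv, hx => by
    have hc := hcs c (by simp)
    have hl := length_addStar S x (c := c) (by omega)
    have h1 : leavesAt (S.addStar x c).parents v = leavesAt S.parents v := by
      rw [leavesAt_addStar hc hv, List.filter_eq_self]
      simpa using hx
    rw [hang_cons, leavesAt_hang (fun c hc => hcs c (by simp [hc])) (by omega) (by rwa [h1]), h1]

lemma leafOrder_addStar (h : S.Proper) (hx : x < S.parents.length) (hc : 2 ≤ c) :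
    (S.addStar x c).leafOrder =
      S.leafOrder.filter (· ≠ x) ++ List.range' (S.parents.length + 1) (c - 1) := by
  rw [leafOrder, LabelledTree.addStar, List.flatMap_append, List.flatMap_singleton, leafOrder,
    List.filter_flatMap]
  congr 1
  · exact List.flatMap_congr fun v hv => leavesAt_addStar hc (h.labels_lt v hv)
  · exact leavesAt_addStar_self hc hx h.isParentList.lt_length

/-- The leaf order behaves like a queue: `x` is removed, and the leaves of the new stars are
appended, as their centres have the last labels. -/
lemma leafOrder_hang : ∀ {cs : List ℕ} {S : LabelledTree}, S.Proper → x < S.parents.length →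
    (∀ c ∈ cs, 2 ≤ c) → cs ≠ [] → (S.hang x cs).leafOrder =
      S.leafOrder.filter (· ≠ x) ++ starLeaves S.parents.length cs
  | [], S, h, _, _, hne => absurd rfl hne
  | [c], S, h, hx, hcs, _ => by
    have := leafOrder_addStar h hx (hcs c (by simp))
    rw [hang_cons, starLeaves, starLeaves, List.append_nil]
    exact this
  | c :: d :: cs, S, h, hx, hcs, _ => by
    have hc := hcs c (by simp)
    have hl := length_addStar S x (c := c) (by omega)
    rw [hang_cons, leafOrder_hang (h.addStar hx (by omega)) (by omega)
      (fun c hc => hcs c (List.mem_cons_of_mem _ hc)) (by simp), leafOrder_addStar h hx hc, hl,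
      List.filter_append, List.filter_filter, starLeaves, List.append_assoc]
    congr 1
    · simp
    · congr 1
      rw [List.filter_eq_self]
      intro y hy
      rw [List.mem_range'_1] at hy
      simp
      omega

/-- Choosing the least label adjacent to a leaf amounts to taking the first entry of the leaf order.
-/
lemma freeLeaf_eq {y : ℕ} {l : List ℕ} (h : S.leafOrder = y :: l) : S.freeLeaf = y := by
  have h1 : S.leafOrder.head? = S.labels.findSome? S.leafAt := by
    rw [leafOrder, List.head?_flatMap]
    congr 1
    funext v
    rw [leavesAt, List.head?_filter]
    rfl
  rw [freeLeaf, ← h1, h]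
  rfl

end LabelledTree

/-! ### The `𝓜`-tree and the queue of `mergeFront` -/

open RTree

lemma starRest_append : ∀ {g : List ℕ} {q : List RTree} (r : List RTree),
    (g.map (· - 1)).sum = q.length → starRest g (q ++ r) = r
  | [], q, r, h => by
    have : q = [] := by simpa using h.symm
    simp [starRest, this]
  | d :: g, q, r, h => by
    rw [List.map_cons, List.sum_cons] at h
    rw [starRest, List.drop_append_of_le_length (by omega), starRest_append]
    rw [List.length_drop]
    omega

lemma starsOf_append_right : ∀ {g : List ℕ} {q : List RTree} (r : List RTree),
    (g.map (· - 1)).sum = q.length → starsOf g (q ++ r) = starsOf g q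
  | [], q, r, h => rfl
  | d :: g, q, r, h => by
    rw [List.map_cons, List.sum_cons] at h
    rw [starsOf, starsOf, List.drop_append_of_le_length (by omega),
      List.take_append_of_le_length (by omega), starsOf_append_right]
    rw [List.length_drop]
    omega

lemma starsOf_append_left : ∀ (g g' : List ℕ) (q : List RTree),
    starsOf (g ++ g') q = starsOf g q ++ starsOf g' (starRest g q)
  | [], _, _ => rfl
  | d :: g, g', q => by
    rw [List.cons_append, starsOf, starsOf, starRest, starsOf_append_left, List.cons_append]

namespace LabelledTree

lemma exists_labels_hang {x : ℕ} : ∀ (cs : List ℕ) (S : LabelledTree),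
    ∃ ls, (S.hang x cs).labels = S.labels ++ ls ∧ ∀ v ∈ ls, S.parents.length ≤ v
  | [], S => ⟨[], by simp [hang], by simp⟩
  | c :: cs, S => by
    obtain ⟨ls, h1, h2⟩ := exists_labels_hang cs (S.addStar x c)
    refine ⟨S.parents.length :: ls, ?_, ?_⟩
    · rw [hang_cons, h1]
      simp [addStar]
    · have : S.parents.length ≤ (S.addStar x c).parents.length := by simp [addStar]
      simp only [List.mem_cons, forall_eq_or_imp, le_refl, true_and]
      exact fun v hv => this.trans (h2 v hv)

lemma lt_of_mem_leafOrder {S : LabelledTree} {y : ℕ} (h : y ∈ S.leafOrder) :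
    y < S.parents.length := by
  rw [leafOrder, List.mem_flatMap] at h
  obtain ⟨v, -, h⟩ := h
  rw [leavesAt, List.mem_filter, List.mem_range] at h
  exact h.1

lemma proper_single : Proper ⟨[0], [0]⟩ := ⟨.single, by simp⟩

lemma leavesAt_single : leavesAt [0] 0 = [] := by decide

/-- The root carries the first label, so its own leaves come before those of the stars. -/
lemma leafOrder_base {e : List ℕ} (he : ∀ c ∈ e, 2 ≤ c) (a : ℕ) :
    leafOrder ⟨(hang ⟨[0], [0]⟩ 0 e).parents ++ List.replicate a 0,
      (hang ⟨[0], [0]⟩ 0 e).labels⟩ =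
      List.range' (hang ⟨[0], [0]⟩ 0 e).parents.length a ++ starLeaves 1 e := by
  have he1 : ∀ c ∈ e, 1 ≤ c := fun c hc => one_le_two.trans (he c hc)
  obtain ⟨h1, h2, h3⟩ := proper_single.hang (x := 0) (by simp) he1
  have h0 : 0 ∈ (hang ⟨[0], [0]⟩ 0 e).parents := h3.subset (by simp)
  obtain ⟨ls, hls, hls1⟩ := exists_labels_hang (x := 0) e ⟨[0], [0]⟩
  have h4 : leavesAt (hang ⟨[0], [0]⟩ 0 e).parents 0 = [] := by
    rw [leavesAt_hang he (by simp) (by simp [leavesAt_single]), leavesAt_single]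
  have h5 : (hang ⟨[0], [0]⟩ 0 e).leafOrder = starLeaves 1 e := by
    by_cases hne : e = []
    · subst hne
      simp [hang, leafOrder, leavesAt_single, starLeaves]
    · rw [leafOrder_hang proper_single (by simp) he hne]
      simp [leafOrder, leavesAt_single]
  rw [leafOrder, hls] at h5 ⊢
  dsimp only at h5 ⊢
  rw [List.singleton_append, List.flatMap_cons] at h5 ⊢
  rw [h4, List.nil_append] at h5
  rw [leavesAt_append_replicate h0 h1.isParentList.lt_length, h4, if_pos rfl, List.nil_append,
    ← h5]
  congr 1
  refine List.flatMap_congr fun v hv => ?_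
  have : v ≠ 0 := by
    have := hls1 v hv
    simp at this
    omega
  rw [leavesAt_append_replicate h0 h1.isParentList.lt_length, if_neg this, List.append_nil]

end LabelledTree

open LabelledTree

lemma sum_map_sub_one {g : List ℕ} (h : ∀ x ∈ g, 1 ≤ x) :
    (g.map (· - 1)).sum + g.length = g.sum := by
  induction g with
  | nil => rfl
  | cons d g ih =>
    have := ih fun x hx => h x (by simp [hx])
    have := h d (by simp)
    simp
    omega

/-- The length of the leaf order is that of the queue in `mergeFront`. It is positive, so the
default value in `freeLeaf` is never used. -/
lemma mTreeAux_spec (l : List ℕ) (hne : l ≠ []) (h2 : ∀ x ∈ l, 2 ≤ x) :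
    (mTreeAux l).Proper ∧ (mTreeAux l).leafOrder.Nodup ∧
      (mTreeAux l).leafOrder.length + 2 * l.length = l.sum + 2 := by
  match l, hne with
  | c :: e, _ =>
    have he : ∀ x ∈ e, 2 ≤ x := fun x hx => h2 x (by simp [hx])
    have hc := h2 c (by simp)
    by_cases hl : e.length ≤ c
    · have he1 : ∀ c ∈ e, 1 ≤ c := fun c hc => one_le_two.trans (he c hc)
      obtain ⟨h1, h3, h4⟩ := proper_single.hang (x := 0) (by simp) he1
      rw [mTreeAux, if_pos hl]
      dsimp only
      refine ⟨⟨h1.isParentList.append_replicate h1.isParentList.length_pos _, fun v hv => ?_⟩, ?_⟩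
      · have := h1.labels_lt v hv
        simp
        omega
      · rw [leafOrder_base he, List.nodup_append]
        refine ⟨⟨List.nodup_range', nodup_starLeaves _, fun a ha b hb => ?_⟩, ?_⟩
        · have := lt_of_mem_starLeaves he1 hb
          rw [List.mem_range'_1, h3, List.length_singleton] at ha
          omega
        · have := sum_map_sub_one he1
          simp [length_starLeaves]
          omega
    · have hk : (e.drop (e.length - (c - 1))).length = c - 1 := by
        simp
        omega
      have htk : (e.take (e.length - (c - 1))).length = e.length - (c - 1) := by simp
      have hne' : e.take (e.length - (c - 1)) ≠ [] := by
        rw [← List.length_pos_iff, htk]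
        omega
      have hg : ∀ x ∈ e.drop (e.length - (c - 1)), 2 ≤ x := fun x hx => he x (List.mem_of_mem_drop hx)
      have htd := List.sum_append (l₁ := e.take (e.length - (c - 1)))
        (l₂ := e.drop (e.length - (c - 1)))
      rw [List.take_append_drop] at htd
      have htk2 : ∀ x ∈ e.take (e.length - (c - 1)), 2 ≤ x := fun x hx =>
        he x (List.mem_of_mem_take hx)
      obtain ⟨h1, h3, h4⟩ := mTreeAux_spec (e.take (e.length - (c - 1))) hne' htk2
      rw [mTreeAux, if_neg hl]
      dsimp only
      set g := e.drop (e.length - (c - 1))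
      set S := mTreeAux (e.take (e.length - (c - 1)))
      have hpos : 0 < S.leafOrder.length := by
        have := two_mul_length_le_sum htk2
        omega
      obtain ⟨x, tl, hx⟩ := List.exists_cons_of_length_pos hpos
      have hxl : x < S.parents.length := lt_of_mem_leafOrder (by rw [hx]; simp)
      have hg1 : ∀ x ∈ g, 1 ≤ x := fun x hx => one_le_two.trans (hg x hx)
      have hgne : g ≠ [] := by
        rw [← List.length_pos_iff]
        omega
      have hfil : (x :: tl).filter (· ≠ x) = tl := by
        rw [hx, List.nodup_cons] at h3
        rw [List.filter_cons_of_neg (by simp), List.filter_eq_self]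
        rintro y hy
        simp
        rintro rfl
        exact h3.1 hy
      rw [freeLeaf_eq hx]
      refine ⟨(h1.hang hxl hg1).1, ?_⟩
      rw [leafOrder_hang h1 hxl hg hgne, hx, hfil]
      refine ⟨?_, ?_⟩
      · rw [List.nodup_append]
        rw [hx] at h3
        refine ⟨h3.of_cons, nodup_starLeaves _, fun a ha b hb => ?_⟩
        have := le_of_mem_starLeaves hb
        have := lt_of_mem_leafOrder (S := S) (y := a) (by rw [hx]; simp [ha])
        omega
      · have := sum_map_sub_one hg1
        rw [hx] at h4
        simp only [List.length_append, length_starLeaves, List.length_cons, List.sum_cons] at h4 ⊢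
        omega
termination_by l.length
decreasing_by simp

section

variable {W : Type} {G : SimpleGraph W}

/-- The stars are contracted from the last to the first. The reversals occur because `mergeFront`
reads the leaves from the newest to the oldest and the degrees from the largest to the smallest. -/
lemma Fib.of_hang {x : ℕ} : ∀ {cs : List ℕ} {S : LabelledTree} {δ : ℕ → RTree} {ts : List RTree},
    x < S.parents.length → (∀ c ∈ cs, 1 ≤ c) →
    (∀ j, S.parents.length ≤ j → j < S.parents.length + cs.sum →
      j ∉ starLeaves S.parents.length cs → δ j = leaf) →
    Fib G (S.hang x cs).parents δ → δ x = node ts →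
    Fib G S.parents (Function.update δ x
      (node (starsOf cs.reverse ((starLeaves S.parents.length cs).map δ).reverse ++ ts)))
  | [], S, δ, ts, _, _, _, h, hts => by
    simpa [starsOf, ← hts, hang] using h
  | c :: cs, S, δ, ts, hx, h1, hδ, h, hts => by
    have hc := h1 c (by simp)
    have hl := length_addStar S x hc
    rw [starLeaves, List.map_append, List.reverse_append, List.reverse_cons, starsOf_append_left,
      starsOf_append_right _ (by rw [List.map_reverse, List.sum_reverse]; simp [length_starLeaves]),
      starRest_append _ (by rw [List.map_reverse, List.sum_reverse]; simp [length_starLeaves])]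
    have h2 := Fib.of_hang (cs := cs) (S := S.addStar x c) (by omega)
      (fun c hc => h1 c (by simp [hc])) (fun j hj hj2 hjs => hδ j (by omega) (by
        rw [List.sum_cons]
        omega) (by
        rw [starLeaves, List.mem_append, List.mem_range'_1, ← hl]
        rintro (h | h)
        · omega
        · exact hjs h)) h hts
    rw [hl] at h2
    set X := starsOf cs.reverse ((starLeaves (S.parents.length + c) cs).map δ).reverse
    obtain ⟨δ₁, hδ₁⟩ : ∃ δ₁, δ₁ = Function.update δ x (node (X ++ ts)) := ⟨_, rfl⟩
    rw [← hδ₁] at h2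
    have hne : ∀ y, y ≠ x → δ₁ y = δ y := fun y hy => by rw [hδ₁, Function.update_of_ne hy]
    have heq : δ₁ x = node (X ++ ts) := by rw [hδ₁, Function.update_self]
    have h3 : Fib G ((S.parents ++ [x]) ++ List.replicate (c - 1) S.parents.length) δ₁ := by
      simpa [addStar] using h2
    have h4 := h3.merge_replicate (ts := []) (by simp) (by
      rw [hne _ hx.ne']
      refine hδ _ le_rfl (by rw [List.sum_cons]; omega) fun h => ?_
      exact lt_irrefl _ (le_of_mem_starLeaves h))
    refine (h4.merge hx).congr fun j hj => ?_
    by_cases hjx : j = x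
    · subst hjx
      rw [Function.update_self, Function.update_self, Function.update_self,
        Function.update_of_ne hj.ne, heq, List.append_nil]
      have hmap : (List.range' (S.parents ++ [j]).length (c - 1)).map δ₁ =
          (List.range' (S.parents.length + 1) (c - 1)).map δ := by
        rw [List.length_append, List.length_singleton]
        refine List.map_congr_left fun y hy => hne y ?_
        rw [List.mem_range'_1] at hy
        omega
      rw [hmap]
      simp only [starsOf, List.append_assoc]
      rw [List.take_of_length_le (by simp)]
      refine (Iso.node_forall₂ (us := node ((List.range' (S.parents.length + 1) (c - 1)).map δ).reverse
        :: (X ++ ts)) (.cons (Iso.node_perm (List.reverse_perm _).symm) ?_)).trans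
          (Iso.node_perm ?_)
      · exact List.forall₂_same.2 fun _ _ => Iso.refl _
      · simpa using List.perm_middle.symm
    · rw [Function.update_of_ne hjx, Function.update_of_ne hj.ne, Function.update_of_ne hjx,
        hne j hjx]
      exact Iso.refl _

/-- The queue is the leaf order read backwards, so the stars that were hung last are formed first.
Their common parent `x` was the first leaf of the smaller tree, hence the contracted branch is at
the end of the queue. The labels `δ` are arbitrary on the leaves since the recursion changes the one
at `x`. -/
lemma Fib.nonempty_iso_mergeFront (l : List ℕ) (δ : ℕ → RTree) (hne : l ≠ []) (h2 : ∀ x ∈ l, 2 ≤ x)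
    (hδ : ∀ j < (mTreeAux l).parents.length, j ∉ (mTreeAux l).leafOrder → δ j = leaf)
    (h : Fib G (mTreeAux l).parents δ) :
    Nonempty (G ≃g (mergeFront ((mTreeAux l).leafOrder.map δ).reverse l).graph) := by
  match l, hne with
  | c :: e, _ =>
    have he : ∀ x ∈ e, 2 ≤ x := fun x hx => h2 x (by simp [hx])
    have hc := h2 c (by simp)
    by_cases hl : e.length ≤ c
    · have he1 : ∀ c ∈ e, 1 ≤ c := fun c hc => one_le_two.trans (he c hc)
      obtain ⟨h1, h3, h4⟩ := proper_single.hang (x := 0) (by simp) he1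
      rw [mTreeAux, if_pos hl] at h hδ ⊢
      dsimp only at h hδ
      rw [leafOrder_base he] at hδ
      rw [leafOrder_base he, mergeFront, if_pos hl]
      rw [List.length_append, List.length_replicate, h3, List.length_singleton] at hδ
      rw [h3, List.length_singleton]
      have hnot : ∀ j < 1 + e.sum, j ∉ starLeaves 1 e → δ j = leaf := by
        refine fun j hj hjs => hδ j (by omega) ?_
        rw [List.mem_append, List.mem_range'_1]
        rintro (h | h)
        · omega
        · exact hjs h
      have h5 := h.merge_replicate (ts := []) h1.isParentList.length_pos
        (hnot 0 (by omega) fun h => by simpa using le_of_mem_starLeaves h)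
      have h6 := Fib.of_hang (by simp) he1 (fun j hj hj2 hjs => by
        simp at hj
        rw [Function.update_of_ne (by omega)]
        exact hnot j hj2 hjs) h5 (by rw [Function.update_self, List.append_nil])
      have h7 := h6.nonempty_iso
      rw [Function.update_self, List.length_singleton] at h7
      have hmap : (starLeaves 1 e).map (Function.update δ 0 (node ((List.range'
          (hang ⟨[0], [0]⟩ 0 e).parents.length (c - e.length)).map δ ++ []))) =
          (starLeaves 1 e).map δ := by
        refine List.map_congr_left fun y hy => Function.update_of_ne ?_ _ _
        have := le_of_mem_starLeaves hy
        omega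
      rw [hmap, h3, List.length_singleton] at h7
      obtain ⟨φ⟩ := h7
      have hlen : (e.reverse.map (· - 1)).sum = ((starLeaves 1 e).map δ).reverse.length := by
        rw [List.map_reverse, List.sum_reverse]
        simp [length_starLeaves]
      rw [List.map_append, List.reverse_append, starsOf_append_right _ hlen,
        starRest_append _ hlen]
      obtain ⟨ψ, -⟩ := Iso.node_perm (ts := starsOf e.reverse ((starLeaves 1 e).map δ).reverse ++
          (List.range' (1 + e.sum) (c - e.length)).map δ)
        (us := starsOf e.reverse ((starLeaves 1 e).map δ).reverse ++
          ((List.range' (1 + e.sum) (c - e.length)).map δ).reverse)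
        ((List.reverse_perm _).symm.append_left _)
      exact ⟨φ.trans ψ⟩
    · have hk : (e.drop (e.length - (c - 1))).length = c - 1 := by
        simp
        omega
      have htk : (e.take (e.length - (c - 1))).length = e.length - (c - 1) := by simp
      have hne' : e.take (e.length - (c - 1)) ≠ [] := by
        rw [← List.length_pos_iff, htk]
        omega
      have hg : ∀ x ∈ e.drop (e.length - (c - 1)), 2 ≤ x := fun x hx => he x (List.mem_of_mem_drop hx)
      have htk2 : ∀ x ∈ e.take (e.length - (c - 1)), 2 ≤ x := fun x hx =>
        he x (List.mem_of_mem_take hx)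
      obtain ⟨h1, h3, h4⟩ := mTreeAux_spec (e.take (e.length - (c - 1))) hne' htk2
      have IH := Fib.nonempty_iso_mergeFront (e.take (e.length - (c - 1)))
      rw [mTreeAux, if_neg hl] at h hδ ⊢
      rw [mergeFront, if_neg hl]
      dsimp only at h hδ ⊢
      set g := e.drop (e.length - (c - 1))
      set S := mTreeAux (e.take (e.length - (c - 1)))
      have hpos : 0 < S.leafOrder.length := by
        have := two_mul_length_le_sum htk2
        omega
      obtain ⟨x, tl, hx⟩ := List.exists_cons_of_length_pos hpos
      have hxl : x < S.parents.length := lt_of_mem_leafOrder (by rw [hx]; simp)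
      have hg1 : ∀ x ∈ g, 1 ≤ x := fun x hx => one_le_two.trans (hg x hx)
      have hgne : g ≠ [] := by
        rw [← List.length_pos_iff]
        omega
      rw [hx, List.nodup_cons] at h3
      have hfil : (x :: tl).filter (· ≠ x) = tl := by
        rw [List.filter_cons_of_neg (by simp), List.filter_eq_self]
        rintro y hy
        simp
        rintro rfl
        exact h3.1 hy
      have htl : ∀ y ∈ tl, y < S.parents.length := fun y hy =>
        lt_of_mem_leafOrder (S := S) (y := y) (by rw [hx]; simp [hy])
      rw [freeLeaf_eq hx] at h hδ ⊢
      rw [leafOrder_hang h1 hxl hg hgne, hx, hfil] at hδ ⊢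
      rw [(h1.hang hxl hg1).2.1] at hδ
      have h5 := Fib.of_hang hxl hg1 (fun j hj hj2 hjs => hδ j hj2 (by
        rw [List.mem_append]
        rintro (h | h)
        · have := htl j h
          omega
        · exact hjs h)) h (ts := []) (hδ x (by omega) (by
        rw [List.mem_append]
        rintro (h | h)
        · exact h3.1 h
        · have := le_of_mem_starLeaves h
          omega))
      have h6 := IH _ hne' htk2 (fun j hj hjs => by
        rw [hx, List.mem_cons, not_or] at hjs
        rw [Function.update_of_ne hjs.1]
        refine hδ j (by omega) ?_
        rw [List.mem_append]
        rintro (h | h)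
        · exact hjs.2 h
        · have := le_of_mem_starLeaves h
          omega) h5
      have hlen : (g.reverse.map (· - 1)).sum =
          ((starLeaves S.parents.length g).map δ).reverse.length := by
        rw [List.map_reverse, List.sum_reverse]
        simp [length_starLeaves]
      rw [List.map_append, List.reverse_append, starsOf_append_right _ hlen,
        starRest_append _ hlen]
      rw [hx, List.map_cons, Function.update_self, List.append_nil, List.reverse_cons] at h6
      have hmap : tl.map (Function.update δ x (node (starsOf g.reverse
          ((starLeaves S.parents.length g).map δ).reverse))) = tl.map δ := by
        refine List.map_congr_left fun y hy => Function.update_of_ne ?_ _ _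
        rintro rfl
        exact h3.1 hy
      rw [hmap] at h6
      exact h6
termination_by l.length
decreasing_by simp

/-- The `𝓜`-tree arises by repeatedly merging branches at the beginning of a queue. -/
theorem nonempty_iso_mTree {l : List ℕ} (hne : l ≠ []) (h2 : ∀ x ∈ l, 2 ≤ x) {N : ℕ}
    (hN : N + 2 * l.length = l.sum + 2) :
    Nonempty (parentGraph (mTreeAux l).parents ≃g
      (mergeFront (List.replicate N leaf) l).graph) := by
  obtain ⟨h1, -, h3⟩ := mTreeAux_spec l hne h2
  have h := Fib.nonempty_iso_mergeFront l _ hne h2 (fun _ _ _ => rfl) h1.isParentList.fib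
  rw [List.map_const', List.reverse_replicate,
    show (mTreeAux l).leafOrder.length = N by omega] at h
  exact h

end

/-! ### Extremality of the greedy tree and the `𝓜`-tree in a class -/

open RTree

namespace RTree

lemma one_le_of_mem_innerDegs : ∀ {t : RTree} {d : ℕ}, d ∈ t.innerDegs → 1 ≤ d
  | leaf, d, h => by simp [innerDegs] at h
  | attach t c, d, h => by
    rw [innerDegs, Multiset.mem_add, Multiset.mem_cons] at h
    rcases h with h | rfl | h
    · exact one_le_of_mem_innerDegs h
    · omega
    · exact one_le_of_mem_innerDegs h

lemma one_le_of_mem_degs {t : RTree} (ht : t ≠ leaf) {d : ℕ} (h : d ∈ t.degs) : 1 ≤ d := by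
  rw [degs, Multiset.mem_cons] at h
  rcases h with rfl | h
  · rcases t with - | ⟨t, c⟩
    · exact absurd rfl ht
    · simp [children]
  · exact one_le_of_mem_innerDegs h

lemma sum_degs (t : RTree) : t.degs.sum + 2 = 2 * t.degs.card := by
  have := (whole_degs t).card_eq
  simp at this
  omega

lemma eq_of_size_le_two {t s : RTree} (h : t.size = s.size) (h2 : t.size ≤ 2) : t = s := by
  have key : ∀ t : RTree, t.size ≤ 2 → t = leaf ∧ t.size = 1 ∨ t = attach leaf leaf ∧ t.size = 2 := by
    rintro (- | ⟨t, c⟩) ht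
    · exact Or.inl ⟨rfl, rfl⟩
    · right
      have h1 := t.size_pos
      have h2 := c.size_pos
      rcases t with - | ⟨t, t'⟩
      · rcases c with - | ⟨c, c'⟩
        · exact ⟨rfl, rfl⟩
        · have h3 := c.size_pos
          have h4 := c'.size_pos
          simp only [size] at *
          omega
      · have h3 := t.size_pos
        have h4 := t'.size_pos
        simp only [size] at *
        omega
  rcases key t h2 with ⟨rfl, h3⟩ | ⟨rfl, h3⟩ <;> rcases key s (by omega) with ⟨rfl, h4⟩ | ⟨rfl, h4⟩
  · rfl
  · omega
  · omega
  · rfl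

end RTree

namespace FinTree

lemma exists_rtree (T : FinTree) : ∃ t : RTree, Nonempty (T.graph ≃g t.graph) := by
  obtain ⟨r⟩ := T.isTree.connected.nonempty
  obtain ⟨t, φ, -⟩ := RTree.exists_iso ⟨T, r⟩
  exact ⟨t, ⟨φ⟩⟩

lemma deg_eq_of_iso {T T' : FinTree} (φ : T.graph ≃g T'.graph) (v : T.V) :
    T'.deg (φ v) = T.deg v := (SimpleGraph.Iso.ncard_neighborSet φ v)

lemma degSeq_eq_of_iso {T T' : FinTree} (φ : T.graph ≃g T'.graph) : T.degSeq = T'.degSeq := by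
  have h : (Finset.univ.val.map T.deg) = Finset.univ.val.map T'.deg := by
    rw [← Finset.map_univ_equiv φ.toEquiv, Finset.map_val, Multiset.map_map]
    exact Multiset.map_congr rfl fun v _ => (deg_eq_of_iso φ v).symm
  rw [degSeq, degSeq, h]

lemma order_eq_of_iso {T T' : FinTree} (φ : T.graph ≃g T'.graph) : T.order = T'.order :=
  Fintype.card_congr φ.toEquiv

lemma length_degSeq (T : FinTree) : T.degSeq.length = T.order := by
  simp [degSeq, order]

lemma pairwise_degSeq (T : FinTree) : T.degSeq.Pairwise (· ≥ ·) := Multiset.pairwise_sort _ _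

end FinTree

lemma IsTreeDegSeq.pairwise {B : List ℕ} (h : IsTreeDegSeq B) : B.Pairwise (· ≥ ·) := by
  obtain ⟨T, rfl⟩ := h
  exact T.pairwise_degSeq

lemma IsTreeDegSeq.exists_rtree {B : List ℕ} (h : IsTreeDegSeq B) :
    ∃ t : RTree, (B : Multiset ℕ) = t.degs := by
  obtain ⟨T, rfl⟩ := h
  obtain ⟨t, ⟨φ⟩⟩ := T.exists_rtree
  refine ⟨t, ?_⟩
  rw [FinTree.degSeq_eq_of_iso (T' := t.toFinTree) φ, degSeq_toFinTree, Multiset.sort_eq]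

lemma IsTreeDegSeq.sum_add_two {B : List ℕ} (h : IsTreeDegSeq B) : B.sum + 2 = 2 * B.length := by
  obtain ⟨t, ht⟩ := h.exists_rtree
  have := t.sum_degs
  rwa [← ht] at this

lemma IsTreeDegSeq.one_le {B : List ℕ} (h : IsTreeDegSeq B) (h2 : ∃ x ∈ B, 2 ≤ x) :
    ∀ x ∈ B, 1 ≤ x := by
  obtain ⟨t, ht⟩ := h.exists_rtree
  intro x hx
  refine one_le_of_mem_degs (t := t) ?_ (by rwa [← ht])
  rintro rfl
  obtain ⟨y, hy, hy2⟩ := h2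
  rw [← Multiset.mem_coe, ht] at hy
  simp [degs, innerDegs, children] at hy
  omega

namespace RTree.Exchangeable

variable {ρ J : RTree → ℝ}

/-- After the passage to `B`, the count of items leaves only one possible number `N` of leaves. -/
lemma exists_filter_of_majorises (E : Exchangeable ρ J) {B D : List ℕ} (hB : B.Pairwise (· ≥ ·))
    (hB1 : ∀ x ∈ B, 1 ≤ x) (hB2 : ∃ x ∈ B, 2 ≤ x) (hD : D.Pairwise (· ≥ ·)) (hDB : Majorises B D)
    {ts : List RTree} (h : Whole 0 D ts) {N : ℕ}
    (hN : N + 2 * (B.filter (2 ≤ ·)).length = (B.filter (2 ≤ ·)).sum + 2) :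
    ∃ ts', Whole (List.replicate N leaf : List RTree) ((B.filter (2 ≤ ·)).reverse : List ℕ) ts' ∧
      J (node ts) ≤ J (node ts') := by
  obtain ⟨ts', h1, h2⟩ := E.le_of_majorisedWith hB hB1 _ rfl hD hDB.majorisedWith h
  obtain ⟨x, hx, hx2⟩ := hB2
  obtain ⟨n, ts'', h3, h4⟩ := h1.exists_filter E (d := x) (by simpa using hx) hx2
  have h5 := h3.card_eq
  rw [Multiset.filter_coe] at h3 h5
  simp only [Multiset.coe_card, List.length_replicate, Multiset.sum_coe] at h5
  have hn : n = N := by omega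
  subst hn
  refine ⟨ts'', ?_, h2.trans h4.le⟩
  rwa [Multiset.coe_reverse]

lemma reverse_filter_spec {B : List ℕ} (hB : B.Pairwise (· ≥ ·)) (hB2 : ∃ x ∈ B, 2 ≤ x) :
    (B.filter (2 ≤ ·)).reverse ≠ [] ∧ (B.filter (2 ≤ ·)).reverse.Pairwise (· ≤ ·) ∧
      ∀ x ∈ (B.filter (2 ≤ ·)).reverse, 2 ≤ x := by
  obtain ⟨x, hx, hx2⟩ := hB2
  refine ⟨by simpa using ⟨x, hx, hx2⟩, ?_, by simp⟩
  rw [List.pairwise_reverse]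
  exact hB.filter _

lemma pairwise_replicate_leaf (ρ : RTree → ℝ) (N : ℕ) :
    (List.replicate N leaf).Pairwise fun X Y => ρ X ≥ ρ Y := by
  rw [List.pairwise_replicate]
  exact Or.inr le_rfl

theorem le_greedy (E : Exchangeable ρ J) (hρ : Inc ρ) {B D : List ℕ} (hB : B.Pairwise (· ≥ ·))
    (hB1 : ∀ x ∈ B, 1 ≤ x) (hB2 : ∃ x ∈ B, 2 ≤ x) (hD : D.Pairwise (· ≥ ·)) (hDB : Majorises B D)
    {ts : List RTree} (h : Whole 0 D ts) {N : ℕ}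
    (hN : N + 2 * (B.filter (2 ≤ ·)).length = (B.filter (2 ≤ ·)).sum + 2) :
    J (node ts) ≤ J (mergeBack (List.replicate N leaf) (B.filter (2 ≤ ·)).reverse) := by
  obtain ⟨ts', h1, h2⟩ := E.exists_filter_of_majorises hB hB1 hB2 hD hDB h hN
  obtain ⟨h3, h4, h5⟩ := reverse_filter_spec hB hB2
  refine h2.trans (E.le_mergeBack hρ (β := ρ leaf) h3 h4 h5 (pairwise_replicate_leaf ρ N) ?_
    (fun M _ _ => hρ.leaf_le M) h1)
  intro a ha
  rw [List.eq_of_mem_replicate ha]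

theorem le_mTree (E : Exchangeable ρ J) (hρ : Dec ρ) {B D : List ℕ} (hB : B.Pairwise (· ≥ ·))
    (hB1 : ∀ x ∈ B, 1 ≤ x) (hB2 : ∃ x ∈ B, 2 ≤ x) (hD : D.Pairwise (· ≥ ·)) (hDB : Majorises B D)
    {ts : List RTree} (h : Whole 0 D ts) {N : ℕ}
    (hN : N + 2 * (B.filter (2 ≤ ·)).length = (B.filter (2 ≤ ·)).sum + 2) :
    J (node ts) ≤ J (mergeFront (List.replicate N leaf) (B.filter (2 ≤ ·)).reverse) := by
  obtain ⟨ts', h1, h2⟩ := E.exists_filter_of_majorises hB hB1 hB2 hD hDB h hN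
  obtain ⟨h3, h4, h5⟩ := reverse_filter_spec hB hB2
  -- Initially all items equal `leaf`, which has the largest value, so `β = κ = ρ leaf`. For `γ` any
  -- star with at least as many leaves as a vertex can have branches will do; `B.sum` is a crude
  -- choice.
  refine h2.trans (E.le_mergeFront hρ _ (β := ρ leaf) (κ := ρ leaf)
    (γ := ρ (node (List.replicate B.sum leaf))) rfl h3 h4 h5 (hρ.le_leaf _) le_rfl
    (pairwise_replicate_leaf ρ N) ?_ ?_ h1)
  · intro a ha
    rw [List.eq_of_mem_replicate ha]
    exact ⟨le_rfl, le_rfl⟩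
  · rintro M - ⟨x, hx, hxM⟩ hM
    refine ⟨hρ.anti ?_ fun k hk m hm => ?_, hρ.le_leaf M⟩
    · have : x ≤ B.sum := List.le_sum_of_mem (by simp at hx; exact hx.1)
      simp
      omega
    · rw [List.eq_of_mem_replicate hm]
      exact (hM k hk).2

end RTree.Exchangeable

lemma MaxCompatible.exchangeable {ρ : FinRootedTree → ℝ} {I : FinTree → ℝ}
    (hI : IsTreeInvariant I) (h : MaxCompatible ρ I) :
    Exchangeable (fun t => ρ t.toFinRooted) fun t => I t.toFinTree where
  iso := fun ⟨φ, _⟩ => hI _ _ ⟨φ⟩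
  comm _ _ := hI _ _ ⟨SimpleGraph.bridgeComm _ _ _ _⟩
  exchange F _ _ _ _ hp hs h1 h2 h3 h4 := exchange_of_maxCompatible hI h F hp hs h1 h2 h3 h4

/-- Compare all trees in a class with a certain tree. -/
lemma isGreatest_of_rtree {n : ℕ} {A : Set FinTree} {B : List ℕ} (hA : ∀ T ∈ A, T.order = n)
    (hB : IsTreeDegSeq B) (hAB : ∀ T ∈ A, Majorises B T.degSeq) {I : FinTree → ℝ}
    (hI : IsTreeInvariant I) {G : FinTree} (hG : G ∈ A)
    (h : (∃ x ∈ B, 2 ≤ x) → ∀ t : RTree, Majorises B (t.degs.sort (· ≥ ·)) →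
      I t.toFinTree ≤ I G) : IsGreatest (I '' A) (I G) := by
  refine ⟨⟨G, hG, rfl⟩, ?_⟩
  rintro _ ⟨T, hT, rfl⟩
  obtain ⟨t, ⟨φ⟩⟩ := T.exists_rtree
  rw [hI T t.toFinTree ⟨φ⟩]
  by_cases h2 : ∃ x ∈ B, 2 ≤ x
  · refine h h2 t ?_
    rw [← degSeq_toFinTree, ← FinTree.degSeq_eq_of_iso (T := T) (T' := t.toFinTree) φ]
    exact hAB T hT
  -- If all entries of `B` are below `2`, the degree sum leaves at most two vertices, and all trees
  -- in the class are isomorphic.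
  · push Not at h2
    obtain ⟨s, ⟨ψ⟩⟩ := G.exists_rtree
    rw [hI G s.toFinTree ⟨ψ⟩]
    have h3 : B.sum ≤ B.length := by
      simpa using List.sum_le_card_nsmul B 1 fun y hy => by
        have := h2 y hy
        omega
    have h4 := hB.sum_add_two
    have h5 : B.length = T.order := by rw [(hAB T hT).1, T.length_degSeq]
    have h6 : T.order = t.size := (FinTree.order_eq_of_iso (T' := t.toFinTree) φ).trans t.card_vert
    have h7 : G.order = s.size := (FinTree.order_eq_of_iso (T' := s.toFinTree) ψ).trans s.card_vert
    rw [eq_of_size_le_two (t := t) (s := s) (by rw [← h6, ← h7, hA T hT, hA G hG]) (by omega)]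

lemma exists_number_of_leaves (B : List ℕ) :
    ∃ N, N + 2 * (B.filter (2 ≤ ·)).length = (B.filter (2 ≤ ·)).sum + 2 := by
  have := two_mul_length_le_sum (l := B.filter (2 ≤ ·)) (by simp)
  exact ⟨(B.filter (2 ≤ ·)).sum + 2 - 2 * (B.filter (2 ≤ ·)).length, by omega⟩

section

variable {n : ℕ} {A : Set FinTree} {B : List ℕ} {ρ : FinRootedTree → ℝ} {I : FinTree → ℝ}
  {G : FinTree}

lemma mParents_of_two_le (h2 : ∃ x ∈ B, 2 ≤ x) :
    mParents B = (mTreeAux (B.filter (2 ≤ ·)).reverse).parents := by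
  rw [mParents, if_neg]
  push Not
  exact h2

theorem isGreatest_greedy (hA : ∀ T ∈ A, T.order = n) (hB : IsTreeDegSeq B)
    (hAB : ∀ T ∈ A, Majorises B T.degSeq) (hI : IsTreeInvariant I) (h : MaxCompatible ρ I)
    (hρ : IncreasingRule ρ) (hG : G ∈ A) (hBG : IsGreedyTree B G) :
    IsGreatest (I '' A) (I G) := by
  refine isGreatest_of_rtree hA hB hAB hI hG fun h2 t ht => ?_
  obtain ⟨N, hN⟩ := exists_number_of_leaves B
  have key := (h.exchangeable hI).le_greedy (inc_of_increasingRule hρ) hB.pairwise (hB.one_le h2) h2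
    (Multiset.pairwise_sort _ _) ht (ts := t.children) (by
      rw [Multiset.sort_eq]
      exact whole_degs t) hN
  rw [node_children] at key
  obtain ⟨φ⟩ := hBG
  obtain ⟨ψ⟩ := nonempty_iso_greedy hB.pairwise (hB.one_le h2) hB.sum_add_two h2 hN
  rwa [hI G (mergeBack _ _).toFinTree ⟨φ.trans ψ⟩]

theorem isGreatest_mTree (hA : ∀ T ∈ A, T.order = n) (hB : IsTreeDegSeq B)
    (hAB : ∀ T ∈ A, Majorises B T.degSeq) (hI : IsTreeInvariant I) (h : MaxCompatible ρ I)
    (hρ : DecreasingRule ρ) (hG : G ∈ A) (hBG : IsMTree B G) :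
    IsGreatest (I '' A) (I G) := by
  refine isGreatest_of_rtree hA hB hAB hI hG fun h2 t ht => ?_
  obtain ⟨N, hN⟩ := exists_number_of_leaves B
  have key := (h.exchangeable hI).le_mTree (dec_of_decreasingRule hρ) hB.pairwise (hB.one_le h2) h2
    (Multiset.pairwise_sort _ _) ht (ts := t.children) (by
      rw [Multiset.sort_eq]
      exact whole_degs t) hN
  rw [node_children] at key
  rw [IsMTree, mParents_of_two_le h2] at hBG
  obtain ⟨φ⟩ := hBG
  obtain ⟨h3, -, h4⟩ := Exchangeable.reverse_filter_spec hB.pairwise h2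
  obtain ⟨ψ⟩ := nonempty_iso_mTree h3 h4 (N := N) (by
    rw [List.length_reverse, List.sum_reverse]
    exact hN)
  rwa [hI G (mergeFront _ _).toFinTree ⟨φ.trans ψ⟩]

lemma IsTreeInvariant.neg (hI : IsTreeInvariant I) : IsTreeInvariant fun T => -I T :=
  fun T T' h => congrArg Neg.neg (hI T T' h)

lemma isGreatest_neg {S : Set FinTree} {a : ℝ} :
    IsGreatest ((fun T => -I T) '' S) (-a) ↔ IsLeast (I '' S) a := by
  simp [IsGreatest, IsLeast, upperBounds, lowerBounds]

lemma MinCompatible.neg (h : MinCompatible ρ I) : MaxCompatible ρ fun T => -I T := by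
  intro H v w hvw hv hw Ts hTs s h1 h2
  obtain ⟨T, hT, hmin⟩ := h H v w hvw hv hw Ts hTs s h1 h2
  exact ⟨T, hT, isGreatest_neg.2 hmin⟩

theorem isLeast_greedy (hA : ∀ T ∈ A, T.order = n) (hB : IsTreeDegSeq B)
    (hAB : ∀ T ∈ A, Majorises B T.degSeq) (hI : IsTreeInvariant I) (h : MinCompatible ρ I)
    (hρ : IncreasingRule ρ) (hG : G ∈ A) (hBG : IsGreedyTree B G) :
    IsLeast (I '' A) (I G) :=
  isGreatest_neg.1 (isGreatest_greedy hA hB hAB hI.neg h.neg hρ hG hBG)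

theorem isLeast_mTree (hA : ∀ T ∈ A, T.order = n) (hB : IsTreeDegSeq B)
    (hAB : ∀ T ∈ A, Majorises B T.degSeq) (hI : IsTreeInvariant I) (h : MinCompatible ρ I)
    (hρ : DecreasingRule ρ) (hG : G ∈ A) (hBG : IsMTree B G) :
    IsLeast (I '' A) (I G) :=
  isGreatest_neg.1 (isGreatest_mTree hA hB hAB hI.neg h.neg hρ hG hBG)

end

/-! ### Degree sequences of the two extremal trees -/

open RTree

namespace RTree

/-- The multiset of all degrees in a branch, where the root has an additional neighbour. -/
def branchDegs (t : RTree) : Multiset ℕ := (t.children.length + 1) ::ₘ t.innerDegs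

lemma innerDegs_node : ∀ ts : List RTree, (node ts).innerDegs = (ts.map branchDegs).sum
  | [] => rfl
  | c :: ts => by
    rw [node, innerDegs, innerDegs_node ts, List.map_cons, List.sum_cons, add_comm]
    rfl

lemma degs_node (ts : List RTree) : (node ts).degs = ts.length ::ₘ (ts.map branchDegs).sum := by
  rw [degs, innerDegs_node, children_node]

lemma branchDegs_node (ts : List RTree) :
    (node ts).branchDegs = (ts.length + 1) ::ₘ (ts.map branchDegs).sum := by
  rw [branchDegs, innerDegs_node, children_node]

lemma sum_branchDegs_replicate_leaf (N : ℕ) :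
    ((List.replicate N leaf).map branchDegs).sum = Multiset.replicate N 1 := by
  rw [List.map_replicate, List.sum_replicate]
  exact (Multiset.nsmul_singleton 1 N)

end RTree

lemma degs_mergeBack : ∀ {ds : List ℕ} {q : List RTree}, ds ≠ [] → (∀ x ∈ ds, 2 ≤ x) →
    q.length + 2 * ds.length = ds.sum + 2 →
    (mergeBack q ds).degs = (ds : Multiset ℕ) + (q.map branchDegs).sum
  | [], _, h, _, _ => absurd rfl h
  | [d], q, _, _, h => by
    simp only [List.length_singleton, List.sum_singleton, mul_one] at h
    rw [mergeBack, degs_node, show q.length = d by omega, Multiset.coe_singleton,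
      Multiset.singleton_add]
  | d :: e :: ds, q, _, h2, h => by
    have hd := h2 d (by simp)
    have hsum := two_mul_length_le_sum (l := e :: ds) fun x hx => h2 x (by simp_all)
    simp only [List.length_cons, List.sum_cons] at h hsum
    rw [mergeBack, degs_mergeBack (by simp) (fun x hx => h2 x (List.mem_cons_of_mem _ hx)) (by
      simp only [List.length_cons, List.length_take, List.sum_cons]
      omega), List.map_cons, List.sum_cons, branchDegs_node, List.length_drop,
      show q.length - (q.length - (d - 1)) + 1 = d by omega]
    conv_rhs => rw [← List.take_append_drop (q.length - (d - 1)) q, List.map_append, List.sum_append]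
    rw [← Multiset.cons_coe d, Multiset.cons_add, Multiset.cons_add, Multiset.add_cons,
      add_comm (List.sum _) (List.sum _)]

lemma length_starRest : ∀ (g : List ℕ) (q : List RTree),
    (starRest g q).length = q.length - (g.map (· - 1)).sum
  | [], q => by simp [starRest]
  | d :: g, q => by
    rw [starRest, length_starRest g, List.length_drop, List.map_cons, List.sum_cons]
    omega

lemma sum_branchDegs_starsOf : ∀ {g : List ℕ} {q : List RTree}, (∀ x ∈ g, 1 ≤ x) →
    (g.map (· - 1)).sum ≤ q.length →
    ((starsOf g q).map branchDegs).sum + ((starRest g q).map branchDegs).sum =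
      (g : Multiset ℕ) + (q.map branchDegs).sum
  | [], q, _, _ => by simp [starsOf, starRest]
  | d :: g, q, h1, h => by
    have hd := h1 d (by simp)
    rw [List.map_cons, List.sum_cons] at h
    rw [starsOf, starRest, List.map_cons, List.sum_cons, add_assoc,
      sum_branchDegs_starsOf (fun x hx => h1 x (by simp [hx])) (by rw [List.length_drop]; omega),
      branchDegs_node, List.length_take, show min (d - 1) q.length + 1 = d by omega]
    conv_rhs => rw [← List.take_append_drop (d - 1) q, List.map_append, List.sum_append]
    rw [← Multiset.cons_coe d, Multiset.cons_add, Multiset.cons_add, add_left_comm]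

lemma degs_mergeFront (ds : List ℕ) (q : List RTree) (hne : ds ≠ []) (h2 : ∀ x ∈ ds, 2 ≤ x)
    (h : q.length + 2 * ds.length = ds.sum + 2) :
    (mergeFront q ds).degs = (ds : Multiset ℕ) + (q.map branchDegs).sum := by
  match ds, hne with
  | c :: e, _ =>
    have he : ∀ x ∈ e, 2 ≤ x := fun x hx => h2 x (by simp [hx])
    have hc := h2 c (by simp)
    simp only [List.length_cons, List.sum_cons] at h
    have hrev : ∀ g : List ℕ, (g.reverse.map (· - 1)).sum = (g.map (· - 1)).sum := fun g => by
      rw [List.map_reverse, List.sum_reverse]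
    by_cases hl : e.length ≤ c
    · have he1 : ∀ x ∈ e.reverse, 1 ≤ x := fun x hx => one_le_two.trans (he x (by simpa using hx))
      have hs := sum_map_sub_one (g := e) fun x hx => he1 x (by simpa using hx)
      rw [mergeFront, if_pos hl, degs_node, List.length_append, length_starsOf, length_starRest,
        List.length_reverse, hrev, List.map_append, List.sum_append,
        sum_branchDegs_starsOf he1 (by rw [hrev]; omega), ← Multiset.cons_coe, Multiset.cons_add,
        Multiset.coe_reverse]
      congr 1
      omega
    · have hk : (e.drop (e.length - (c - 1))).length = c - 1 := by
        simp
        omega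
      have htk : (e.take (e.length - (c - 1))).length = e.length - (c - 1) := by simp
      have hne' : e.take (e.length - (c - 1)) ≠ [] := by
        rw [← List.length_pos_iff, htk]
        omega
      have htd := List.sum_append (l₁ := e.take (e.length - (c - 1)))
        (l₂ := e.drop (e.length - (c - 1)))
      have htm := Multiset.coe_add (e.take (e.length - (c - 1))) (e.drop (e.length - (c - 1)))
      rw [List.take_append_drop] at htd htm
      have htk2 : ∀ x ∈ e.take (e.length - (c - 1)), 2 ≤ x := fun x hx =>
        he x (List.mem_of_mem_take hx)
      have hg1 : ∀ x ∈ (e.drop (e.length - (c - 1))).reverse, 1 ≤ x := fun x hx =>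
        one_le_two.trans (he x (List.mem_of_mem_drop (List.mem_reverse.1 hx)))
      have hs := sum_map_sub_one (g := e.drop (e.length - (c - 1)))
        fun x hx => hg1 x (by simpa using hx)
      have h3 := two_mul_length_le_sum htk2
      rw [mergeFront, if_neg hl, degs_mergeFront _ _ hne' htk2 (by
        rw [List.length_append, length_starRest, hrev, List.length_singleton]
        omega), List.map_append, List.sum_append, List.map_singleton, List.sum_singleton,
        branchDegs_node, length_starsOf, List.length_reverse, hk, Multiset.add_cons,
        show c - 1 + 1 = c by omega, add_comm (List.sum _) (List.sum _),
        sum_branchDegs_starsOf hg1 (by rw [hrev]; omega), Multiset.coe_reverse, Multiset.add_cons,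
        ← add_assoc, htm, ← Multiset.cons_coe, Multiset.cons_add]
termination_by ds.length
decreasing_by simp

lemma coe_eq_filter_add {B : List ℕ} (hB : B.Pairwise (· ≥ ·)) (h1 : ∀ x ∈ B, 1 ≤ x)
    (hs : B.sum + 2 = 2 * B.length) {N : ℕ}
    (hN : N + 2 * (B.filter (2 ≤ ·)).length = (B.filter (2 ≤ ·)).sum + 2) :
    ((B.filter (2 ≤ ·)).reverse : Multiset ℕ) + Multiset.replicate N 1 = (B : Multiset ℕ) := by
  obtain ⟨m, hm⟩ := filter_append_replicate_one hB h1
  have hNm : m = N := by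
    rw [hm] at hs
    simp only [List.sum_append, List.length_append, List.sum_replicate, List.length_replicate,
      smul_eq_mul, mul_one] at hs
    omega
  subst hNm
  conv_rhs => rw [hm]
  rw [Multiset.coe_reverse, ← Multiset.coe_replicate, Multiset.coe_add]

lemma degSeq_eq_of_degs_eq {t : RTree} {B : List ℕ} (hB : B.Pairwise (· ≥ ·))
    (h : t.degs = (B : Multiset ℕ)) : t.toFinTree.degSeq = B := by
  rw [degSeq_toFinTree, h, Multiset.coe_sort]
  exact List.mergeSort_of_pairwise (by simpa using hB)

lemma eq_of_forall_eq_one {B : List ℕ} (h1 : ∀ x ∈ B, 1 ≤ x) (h2 : ¬∃ x ∈ B, 2 ≤ x)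
    (hs : B.sum + 2 = 2 * B.length) : B = [1, 1] := by
  push Not at h2
  have h3 : B = List.replicate B.length 1 := List.eq_replicate_iff.2 ⟨rfl, fun x hx => by
    have := h1 x hx
    have := h2 x hx
    omega⟩
  rw [h3] at hs
  simp at hs
  rw [h3, show B.length = 2 by omega]
  rfl

lemma nonempty_iso_parentGraph_two : Nonempty (parentGraph [0, 0] ≃g (attach leaf leaf).graph) := by
  have h := IsParentList.fib (IsParentList.single.snoc (x := 0) (by simp))
  have h' := h.merge (by simp)
  exact h'.nonempty_iso

theorem exists_isGreedyTree {B : List ℕ} (hB : B.Pairwise (· ≥ ·)) (h1 : ∀ x ∈ B, 1 ≤ x)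
    (hs : B.sum + 2 = 2 * B.length) : ∃ G : FinTree, IsGreedyTree B G ∧ G.degSeq = B := by
  by_cases h2 : ∃ x ∈ B, 2 ≤ x
  · obtain ⟨N, hN⟩ := exists_number_of_leaves B
    obtain ⟨φ⟩ := nonempty_iso_greedy hB h1 hs h2 hN
    obtain ⟨h3, -, h4⟩ := Exchangeable.reverse_filter_spec hB h2
    refine ⟨(mergeBack (List.replicate N leaf) (B.filter (2 ≤ ·)).reverse).toFinTree, ⟨?_⟩,
      degSeq_eq_of_degs_eq hB ?_⟩
    · exact φ.symm
    rw [degs_mergeBack h3 h4 (by simpa using hN), sum_branchDegs_replicate_leaf,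
      coe_eq_filter_add hB h1 hs hN]
  · obtain rfl := eq_of_forall_eq_one h1 h2 hs
    obtain ⟨φ⟩ := nonempty_iso_parentGraph_two
    exact ⟨(attach leaf leaf).toFinTree, ⟨φ.symm⟩, degSeq_eq_of_degs_eq hB rfl⟩

theorem exists_isMTree {B : List ℕ} (hB : B.Pairwise (· ≥ ·)) (h1 : ∀ x ∈ B, 1 ≤ x)
    (hs : B.sum + 2 = 2 * B.length) : ∃ M : FinTree, IsMTree B M ∧ M.degSeq = B := by
  by_cases h2 : ∃ x ∈ B, 2 ≤ x
  · obtain ⟨N, hN⟩ := exists_number_of_leaves B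
    obtain ⟨h3, -, h4⟩ := Exchangeable.reverse_filter_spec hB h2
    have hN' : N + 2 * (B.filter (2 ≤ ·)).reverse.length = (B.filter (2 ≤ ·)).reverse.sum + 2 := by
      rw [List.length_reverse, List.sum_reverse]
      exact hN
    obtain ⟨φ⟩ := nonempty_iso_mTree h3 h4 hN'
    refine ⟨(mergeFront (List.replicate N leaf) (B.filter (2 ≤ ·)).reverse).toFinTree, ?_,
      degSeq_eq_of_degs_eq hB ?_⟩
    · rw [IsMTree, mParents_of_two_le h2]
      exact ⟨φ.symm⟩
    · rw [degs_mergeFront _ _ h3 h4 (by simpa using hN'), sum_branchDegs_replicate_leaf,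
        coe_eq_filter_add hB h1 hs hN]
  · obtain rfl := eq_of_forall_eq_one h1 h2 hs
    obtain ⟨φ⟩ := nonempty_iso_parentGraph_two
    refine ⟨(attach leaf leaf).toFinTree, ?_, degSeq_eq_of_degs_eq hB rfl⟩
    rw [IsMTree, show mParents [1, 1] = [0, 0] from rfl]
    exact ⟨φ.symm⟩

/-! ### Compatibility from inequalities for ordered trees -/

open RTree

namespace FinRootedTree

/-- An isomorphic ordered tree. -/
noncomputable def toRTree (X : FinRootedTree) : RTree := (RTree.exists_iso X).choose

lemma isoTo_toRTree (X : FinRootedTree) : X.IsoTo X.toRTree := (RTree.exists_iso X).choose_spec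

lemma forall₂_isoTo_map_toRTree (Ts : List FinRootedTree) :
    List.Forall₂ IsoTo Ts (Ts.map toRTree) :=
  List.forall₂_map_right_iff.2 (List.forall₂_same.2 fun X _ => X.isoTo_toRTree)

lemma size_toRTree (X : FinRootedTree) : X.toRTree.size = X.order := by
  obtain ⟨φ, -⟩ := X.isoTo_toRTree
  exact X.toRTree.card_vert.symm.trans (Fintype.card_congr φ.toEquiv).symm

lemma toRTree_eq_leaf {X : FinRootedTree} (h : X.order = 1) : X.toRTree = leaf := by
  have h1 := X.size_toRTree
  exact eq_of_size_le_two (by rw [h1, h]; rfl) (by omega)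

lemma IsoTo.iso_toRTree {X : FinRootedTree} {t : RTree} (h : X.IsoTo t) : X.toRTree.Iso t := by
  obtain ⟨φ, hφ⟩ := X.isoTo_toRTree
  obtain ⟨ψ, hψ⟩ := h
  refine ⟨φ.symm.trans ψ, ?_⟩
  rw [← hφ, ← hψ]
  simp

end FinRootedTree

open FinRootedTree

lemma hasRecurrence_of_node {σ : RTree → ℝ} {f : Multiset ℝ → ℝ}
    (hσ : ∀ {t s : RTree}, t.Iso s → σ t = σ s)
    (h : ∀ ts : List RTree, σ (node ts) = f (ts.map σ : List ℝ)) :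
    HasRecurrence (fun X => σ X.toRTree) f := by
  intro X Ts hX
  rw [isBranching_iff_iso (forall₂_isoTo_map_toRTree Ts)] at hX
  dsimp only
  rw [hσ hX.iso_toRTree, h, List.map_map]
  rfl

/-- Every distribution is bounded below by one of the two extremal ones, so the smaller of these is
the minimum. As `v` and `w` have degree `1` in `H`, there are no branches at the ends of the path
apart from those distributed. -/
lemma minCompatible_of_exchange {σ : RTree → ℝ} {I : FinTree → ℝ} (hI : IsTreeInvariant I)
    (h : ∀ (F : List (List RTree)) {L R Ts : List RTree} {s : ℕ}, (L ++ R).Perm Ts →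
      Ts.Pairwise (fun X Y => σ X ≥ σ Y) → L.length ≤ s → R.length ≤ s →
      I (plug (Ts.take s :: F) (node (Ts.drop s))).toFinTree ≤
        I (plug (L :: F) (node R)).toFinTree ∨
      I (plug (Ts.drop s :: F) (node (Ts.take s))).toFinTree ≤
        I (plug (L :: F) (node R)).toFinTree) :
    MinCompatible (fun X => σ X.toRTree) I := by
  intro H v w hvw hv hw Ts hTs s hs1 hs2
  obtain ⟨L₀, F, R₀, φ, hφv, hφw⟩ := exists_iso_plug_cons H v w hvw
  have hL₀ : L₀ = [] := by
    have h1 := SimpleGraph.Iso.ncard_neighborSet φ v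
    rw [hφv, ncard_neighborSet_root] at h1
    have h2 := h1.trans hv
    rw [plug, children, children_node] at h2
    simpa using h2
  have hR₀ : R₀ = [] := by
    have h1 := SimpleGraph.Iso.ncard_neighborSet φ w
    rw [hφw, ncard_neighborSet_hole] at h1
    have h2 := h1.trans hw
    simpa using h2
  subst hL₀ hR₀
  have hdec : ∀ (T : FinTree) (L R : List FinRootedTree), T.IsDecomp L H v w R ↔
      Nonempty (T.graph ≃g (plug (L.map toRTree :: F) (node (R.map toRTree))).graph) := by
    intro T L R
    obtain ⟨ψ, -⟩ := graft_iso_plug φ hφv hφw (forall₂_isoTo_map_toRTree L)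
      (forall₂_isoTo_map_toRTree R)
    rw [List.append_nil, List.append_nil] at ψ
    exact ⟨fun ⟨χ⟩ => ⟨χ.trans ψ⟩, fun ⟨χ⟩ => ⟨χ.trans ψ.symm⟩⟩
  have key : ∀ T ∈ distributions H v w Ts s,
      I (plug ((Ts.take s).map toRTree :: F) (node ((Ts.drop s).map toRTree))).toFinTree ≤ I T ∨
      I (plug ((Ts.drop s).map toRTree :: F) (node ((Ts.take s).map toRTree))).toFinTree ≤ I T := by
    rintro T ⟨L, R, hp, h1, h2, hT⟩
    have hlen := hp.length_eq
    rw [List.length_append] at hlen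
    obtain ⟨χ⟩ := (hdec T L R).1 hT
    rw [hI T (plug (L.map toRTree :: F) (node (R.map toRTree))).toFinTree ⟨χ⟩,
      List.map_take, List.map_drop]
    refine h F ?_ (List.pairwise_map.2 hTs) (by simpa using h2) (by simp; omega)
    rw [← List.map_append]
    exact hp.map _
  have hmem : ∀ L R : List FinRootedTree, (L ++ R).Perm Ts → L.length ≤ s → R.length ≤ s →
      (plug (L.map toRTree :: F) (node (R.map toRTree))).toFinTree ∈ distributions H v w Ts s := by
    intro L R hp h1 h2
    have hlen := hp.length_eq
    rw [List.length_append] at hlen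
    exact ⟨L, R, hp, by omega, h1, (hdec _ L R).2 ⟨RelIso.refl _⟩⟩
  have hm1 := hmem (Ts.take s) (Ts.drop s) (by rw [List.take_append_drop]) (by simp)
    (by simp; omega)
  have hm2 := hmem (Ts.drop s) (Ts.take s)
    (List.perm_append_comm.trans (by rw [List.take_append_drop])) (by simp; omega) (by simp)
  rcases le_total (I (plug ((Ts.take s).map toRTree :: F)
      (node ((Ts.drop s).map toRTree))).toFinTree)
    (I (plug ((Ts.drop s).map toRTree :: F) (node ((Ts.take s).map toRTree))).toFinTree)
    with hle | hle
  · refine ⟨_, Or.inl ((hdec _ _ _).2 ⟨RelIso.refl _⟩), ⟨_, hm1, rfl⟩, ?_⟩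
    rintro _ ⟨T, hT, rfl⟩
    exact (key T hT).elim id hle.trans
  · refine ⟨_, Or.inr ((hdec _ _ _).2 ⟨RelIso.refl _⟩), ⟨_, hm2, rfl⟩, ?_⟩
    rintro _ ⟨T, hT, rfl⟩
    exact (key T hT).elim hle.trans id

open RTree

/-! ### Solvability -/

section Response

variable {V W : Type} [Fintype V] [Fintype W]

open Classical in
/-- The action of the matrix `A + diag a`, where `A` is the adjacency matrix. -/
noncomputable def diagAct (G : SimpleGraph V) (a x : V → ZMod 2) (u : V) : ZMod 2 :=
  ∑ w, (if G.Adj u w then x w else 0) + a u * x u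

open Classical in
/-- The number of vectors `x` with value `p` at `v` for which `(A + diag a) x` has the entry `q` at
`v` and vanishes elsewhere. -/
noncomputable def response (G : SimpleGraph V) (v : V) (a : V → ZMod 2) (p q : ZMod 2) : ℕ :=
  Nat.card {x : V → ZMod 2 // x v = p ∧ ∀ u, diagAct G a x u = if u = v then q else 0}

lemma response_eq_sum [DecidableEq V] (G : SimpleGraph V) (v : V) (a : V → ZMod 2) (p q : ZMod 2) :
    response G v a p q =
      ∑ x : V → ZMod 2, if x v = p ∧ ∀ u, diagAct G a x u = if u = v then q else 0 then 1 else 0 := by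
  classical
  rw [response, Nat.card_eq_fintype_card, Fintype.card_subtype, Finset.card_filter]
  refine Finset.sum_congr (by congr!) fun x _ => by congr!

lemma diagAct_bridge_inl (G : SimpleGraph V) (v : V) (X : SimpleGraph W) (w : W)
    (a x : V → ZMod 2) (b y : W → ZMod 2) (u : V) [Decidable (u = v)] :
    diagAct (SimpleGraph.bridge G v X w) (Sum.elim a b) (Sum.elim x y) (.inl u) =
      diagAct G a x u + if u = v then y w else 0 := by
  classical
  rw [diagAct, diagAct, Fintype.sum_sum_type]
  simp only [SimpleGraph.bridge_inl_inl, SimpleGraph.bridge_inl_inr, Sum.elim_inl, Sum.elim_inr]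
  have : ∑ w', (if u = v ∧ w' = w then y w' else 0) = if u = v then y w else 0 := by
    by_cases h : u = v <;> simp [h]
  rw [this]
  ring

lemma diagAct_bridge_inr (G : SimpleGraph V) (v : V) (X : SimpleGraph W) (w : W)
    (a x : V → ZMod 2) (b y : W → ZMod 2) (u : W) [Decidable (u = w)] :
    diagAct (SimpleGraph.bridge G v X w) (Sum.elim a b) (Sum.elim x y) (.inr u) =
      diagAct X b y u + if u = w then x v else 0 := by
  classical
  rw [diagAct, diagAct, Fintype.sum_sum_type]
  simp only [SimpleGraph.bridge_inr_inr, SimpleGraph.bridge_inr_inl, Sum.elim_inl, Sum.elim_inr]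
  have : ∑ v', (if v' = v ∧ u = w then x v' else 0) = if u = w then x v else 0 := by
    by_cases h : u = w <;> simp [h]
  rw [this]
  ring

/-- The two systems interact only through the values at `v` and `w`. Once the value `p'` at `w` is
fixed, it is moved to the right hand side at `v`, and the value `p` at `v` to the right hand side at
`w`. -/
lemma response_bridge (G : SimpleGraph V) (v : V) (X : SimpleGraph W) (w : W)
    (a : V → ZMod 2) (b : W → ZMod 2) (p q : ZMod 2) :
    response (SimpleGraph.bridge G v X w) (.inl v) (Sum.elim a b) p q =
      ∑ p', response G v a p (q - p') * response X w b p' (-p) := by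
  classical
  have h : ∀ (x : V → ZMod 2) (y : W → ZMod 2),
      (Sum.elim x y (.inl v) = p ∧ ∀ u, diagAct (SimpleGraph.bridge G v X w) (Sum.elim a b)
        (Sum.elim x y) u = if u = .inl v then q else 0) ↔
      (x v = p ∧ ∀ u, diagAct G a x u = if u = v then q - y w else 0) ∧
        ∀ u, diagAct X b y u = if u = w then -p else 0 := by
    intro x y
    rw [Sum.elim_inl, Sum.forall, and_assoc]
    refine and_congr_right fun hp => and_congr (forall_congr' fun u => ?_) (forall_congr' fun u => ?_)
    · rw [diagAct_bridge_inl]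
      by_cases hu : u = v <;> simp [hu, eq_sub_iff_add_eq]
    · rw [diagAct_bridge_inr, hp]
      by_cases hu : u = w
      · simp only [hu, if_true, reduceCtorEq, if_false]
        exact eq_neg_iff_add_eq_zero.symm
      · simp [hu]
  rw [response_eq_sum]
  refine (Fintype.sum_equiv (Equiv.sumArrowEquivProdArrow V W (ZMod 2)) _ (fun z =>
    if (z.1 v = p ∧ ∀ u, diagAct G a z.1 u = if u = v then q - z.2 w else 0) ∧
        ∀ u, diagAct X b z.2 u = if u = w then -p else 0 then 1 else 0) fun z => ?_).trans ?_
  · obtain ⟨⟨x, y⟩, rfl⟩ := (Equiv.sumArrowEquivProdArrow V W (ZMod 2)).symm.surjective z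
    exact if_congr (h x y) rfl rfl
  · rw [Fintype.sum_prod_type]
    simp only [response_eq_sum, Finset.sum_mul_sum]
    rw [Finset.sum_comm (s := (Finset.univ : Finset (ZMod 2)))]
    refine Finset.sum_congr rfl fun x _ => ?_
    rw [Finset.sum_comm]
    refine Finset.sum_congr rfl fun y _ => ?_
    rw [Finset.sum_eq_single (y w) (fun p' _ hp' => by simp [hp'.symm]) (by simp),
      ite_zero_mul_ite_zero, one_mul]
    simp only [true_and]

/-- The number of right hand sides for which the system with the matrix `A + diag a` is solvable. -/
noncomputable def numSolvable (G : SimpleGraph V) (a : V → ZMod 2) : ℕ :=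
  Nat.card {b : V → ZMod 2 // ∃ x, diagAct G a x = b}

open Classical in
lemma mulVec_eq_diagAct (G : SimpleGraph V) (a x : V → ZMod 2) :
    (G.adjMatrix (ZMod 2) + Matrix.diagonal a).mulVec x = diagAct G a x := by
  funext u
  rw [Matrix.add_mulVec, Pi.add_apply, Matrix.mulVec_diagonal, diagAct]
  congr 1
  simp [Matrix.mulVec, dotProduct, SimpleGraph.adjMatrix_apply]

/-- The solvable right hand sides form the image of a linear map, and the two responses with defect
`0` count its kernel by the value at `v`. -/
lemma numSolvable_mul (G : SimpleGraph V) (v : V) (a : V → ZMod 2) :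
    numSolvable G a * (response G v a 0 0 + response G v a 1 0) = 2 ^ Fintype.card V := by
  classical
  let f : (V → ZMod 2) →+ (V → ZMod 2) :=
    (Matrix.mulVecLin (G.adjMatrix (ZMod 2) + Matrix.diagonal a)).toAddMonoidHom
  have hf : ∀ x, f x = diagAct G a x := fun x => by
    rw [← mulVec_eq_diagAct]
    change Matrix.mulVec _ _ = _
    congr!
  have h1 : numSolvable G a = Nat.card f.range := by
    refine Nat.card_congr (Equiv.subtypeEquivRight fun b => ?_)
    simp only [AddMonoidHom.mem_range, hf]
  have h2 : response G v a 0 0 + response G v a 1 0 = Nat.card f.ker := by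
    rw [response_eq_sum, response_eq_sum, ← Finset.sum_add_distrib, Nat.card_eq_fintype_card,
      Fintype.card_subtype, Finset.card_filter]
    refine Finset.sum_congr (by congr!) fun x _ => ?_
    have h3 : x ∈ f.ker ↔ ∀ u, diagAct G a x u = 0 := by
      rw [AddMonoidHom.mem_ker, hf]
      exact funext_iff
    simp only [ite_self, h3]
    have h4 : x v = 0 ∨ x v = 1 := by
      generalize x v = z
      revert z
      decide
    rcases h4 with h4 | h4 <;> simp [h4]
  have h5 := f.ker.card_eq_card_quotient_mul_card_addSubgroup
  rw [Nat.card_congr (QuotientAddGroup.quotientKerEquivRange f).toEquiv] at h5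
  rw [h1, h2, ← h5]
  simp

end Response

lemma solvability_eq_card (T : FinTree) : solvability T =
    Nat.card {p : (T.V → ZMod 2) × (T.V → ZMod 2) // ∃ x, diagAct T.graph p.1 x = p.2} := by
  simp only [solvability, mulVec_eq_diagAct]

lemma solvability_eq_sum (T : FinTree) [DecidableEq T.V] :
    solvability T = ∑ a : T.V → ZMod 2, numSolvable T.graph a := by
  rw [solvability_eq_card, Nat.card_congr (Equiv.subtypeProdEquivSigmaSubtype
    (fun a b => ∃ x : T.V → ZMod 2, diagAct T.graph a x = b)), Nat.card_sigma]
  rfl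

lemma isTreeInvariant_solvability : IsTreeInvariant fun T => (solvability T : ℝ) := by
  classical
  rintro T T' ⟨φ⟩
  dsimp only
  rw [solvability_eq_card, solvability_eq_card]
  refine congrArg Nat.cast (Nat.card_congr ?_)
  let e := φ.toEquiv.symm.arrowCongr (Equiv.refl (ZMod 2))
  refine ((e.prodCongr e).subtypeEquiv fun p => ?_).symm
  obtain ⟨a, b⟩ := p
  refine Equiv.exists_congr e fun x => ?_
  have key : ∀ u, diagAct T.graph (e a) (e x) u = diagAct T'.graph a x (φ u) := by
    intro u
    rw [diagAct, diagAct]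
    congr 1
    refine Fintype.sum_equiv φ.toEquiv _ _ fun w => ?_
    exact if_congr (φ.map_adj_iff).symm rfl rfl
  have h : diagAct T.graph (e a) (e x) = e (diagAct T'.graph a x) := funext key
  change diagAct T'.graph a x = b ↔ diagAct T.graph (e a) (e x) = e b
  rw [h, e.apply_eq_iff_eq]

namespace RTree

/-- For `N p q` exactly one of the three pairs `(p, q) ≠ (0, 0)` occurs. -/
def IsLine (N : ZMod 2 → ZMod 2 → ℕ) : Prop :=
  ∃ k : ℕ, k ≠ 0 ∧ N 0 0 = k ∧ ((N 1 0 = k ∧ N 1 1 = 0 ∧ N 0 1 = 0) ∨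
    (N 1 0 = 0 ∧ N 1 1 = k ∧ N 0 1 = 0) ∨ (N 1 0 = 0 ∧ N 1 1 = 0 ∧ N 0 1 = k))

lemma response_leaf (a : leaf.Vert → ZMod 2) (p q : ZMod 2) :
    response leaf.graph leaf.root a p q = if a leaf.root * p = q then 1 else 0 := by
  have hu : ∀ u : leaf.Vert, u = leaf.root := fun u => Subsingleton.elim (α := Unit) u _
  have hx : ∀ x : leaf.Vert → ZMod 2, (x leaf.root = p ∧ ∀ u, diagAct leaf.graph a x u =
      if u = leaf.root then q else 0) ↔ x = (fun _ => p) ∧ a leaf.root * p = q := by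
    intro x
    have h1 : ∀ u, diagAct leaf.graph a x u = a u * x u := by
      intro u
      rw [diagAct, Finset.sum_eq_zero, zero_add]
      intro w _
      rw [hu u, hu w, if_neg (SimpleGraph.irrefl _)]
    constructor
    · rintro ⟨h2, h3⟩
      refine ⟨funext fun u => by rw [hu u, h2], ?_⟩
      have := h3 leaf.root
      rwa [h1, h2, if_pos rfl] at this
    · rintro ⟨rfl, h2⟩
      refine ⟨rfl, fun u => ?_⟩
      rw [h1, hu u, if_pos rfl, h2]
  classical
  rw [response_eq_sum, Finset.sum_congr rfl fun x _ => if_congr (hx x) rfl rfl]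
  simp only [ite_and]
  simp

lemma response_attach (t c : RTree) (a : t.Vert → ZMod 2) (b : c.Vert → ZMod 2) (p q : ZMod 2) :
    response (attach t c).graph (attach t c).root (Sum.elim a b) p q =
      response t.graph t.root a p q * response c.graph c.root b 0 p +
        response t.graph t.root a p (q + 1) * response c.graph c.root b 1 p := by
  refine (response_bridge t.graph t.root c.graph c.root a b p q).trans ?_
  have h : ∀ p q : ZMod 2, q - 0 = q ∧ q - 1 = q + 1 ∧ -p = p := by decide
  refine (Fin.sum_univ_two _).trans ?_
  change response t.graph t.root a p (q - 0) * response c.graph c.root b 0 (-p) +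
    response t.graph t.root a p (q - 1) * response c.graph c.root b 1 (-p) = _
  rw [(h p q).1, (h p q).2.1, (h p q).2.2]

/-- The pairs of value and defect at the root form a line in `𝔽₂²`, and all its points have equally
many preimages. A branch acts on this line according to its own line, which leaves nine cases. -/
lemma isLine_response : ∀ (t : RTree) (a : t.Vert → ZMod 2),
    IsLine fun p q => response t.graph t.root a p q
  | leaf, a => by
    refine ⟨1, one_ne_zero, ?_⟩
    simp only [response_leaf]
    generalize a leaf.root = z
    revert z
    decide
  | attach t c, a => by
    obtain ⟨⟨a, b⟩, rfl⟩ := (Equiv.sumArrowEquivProdArrow t.Vert c.Vert (ZMod 2)).symm.surjective a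
    have h1 : (1 : ZMod 2) + 1 = 0 := by decide
    obtain ⟨k, hk, h2, h3⟩ := isLine_response t a
    obtain ⟨l, hl, h4, h5⟩ := isLine_response c b
    have h6 := response_attach t c a b
    dsimp only at h2 h3 h4 h5
    change IsLine fun p q => response (attach t c).graph (attach t c).root (Sum.elim a b) p q
    simp only [IsLine, h6, h1, zero_add]
    rcases h3 with ⟨h7, h8, h9⟩ | ⟨h7, h8, h9⟩ | ⟨h7, h8, h9⟩ <;>
    rcases h5 with ⟨h10, h11, h12⟩ | ⟨h10, h11, h12⟩ | ⟨h10, h11, h12⟩ <;>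
    simp [h2, h4, h7, h8, h9, h10, h11, h12, hk, hl]

/-- The sum of the weights `2 ^ n / N 0 0` of all `a` for which `N p q ≠ 0`. -/
noncomputable def lineWeight (t : RTree) (p q : ZMod 2) : ℝ :=
  ∑ a : t.Vert → ZMod 2, 2 ^ t.size * (response t.graph t.root a p q : ℝ) /
    (response t.graph t.root a 0 0 : ℝ) ^ 2

/-- The sum of the weights for each of the pairs `(1, 0)` and `(1, 1)`, and the solvability. -/
noncomputable def solPair : RTree → ℝ × ℝ
  | leaf => (2, 3)
  | attach t c => (t.solPair.1 * (c.solPair.2 - c.solPair.1 / 2),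
      t.solPair.2 * c.solPair.2 + 5 / 4 * t.solPair.1 * c.solPair.1)

/-- If the line of `a` contains `(p, q)`, its weight is `2 ^ n` divided by the size of the fibres,
and otherwise `0`. The factor `1 / 2` arises when the lines are spanned by `(0, 1)` in `t` and by
`(1, 0)` in `c`: the fibre sizes are then multiplied and doubled. -/
lemma lineWeight_attach (t c : RTree) :
    (attach t c).lineWeight 1 0 = t.lineWeight 1 0 * c.lineWeight 0 1 +
      t.lineWeight 1 1 * c.lineWeight 1 1 ∧
    (attach t c).lineWeight 1 1 = t.lineWeight 1 1 * c.lineWeight 0 1 +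
      t.lineWeight 1 0 * c.lineWeight 1 1 ∧
    (attach t c).lineWeight 0 1 = (t.lineWeight 1 0 + t.lineWeight 1 1) * c.lineWeight 1 0 +
      t.lineWeight 0 1 * (c.lineWeight 1 0 / 2 + c.lineWeight 1 1 + c.lineWeight 0 1) := by
  have h1 : (1 : ZMod 2) + 1 = 0 := by decide
  have hsum : ∀ p q, (attach t c).lineWeight p q = ∑ a : t.Vert → ZMod 2, ∑ b : c.Vert → ZMod 2,
      2 ^ (t.size + c.size) *
        (response (attach t c).graph (attach t c).root (Sum.elim a b) p q : ℝ) /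
        (response (attach t c).graph (attach t c).root (Sum.elim a b) 0 0 : ℝ) ^ 2 := by
    intro p q
    rw [← Fintype.sum_prod_type']
    refine Fintype.sum_equiv (Equiv.sumArrowEquivProdArrow t.Vert c.Vert (ZMod 2)) _ _ fun z => ?_
    obtain ⟨⟨a, b⟩, rfl⟩ := (Equiv.sumArrowEquivProdArrow t.Vert c.Vert (ZMod 2)).symm.surjective z
    rfl
  simp only [hsum, response_attach, h1, zero_add]
  simp only [lineWeight, Finset.sum_mul_sum, ← Finset.sum_add_distrib, Finset.sum_div]
  refine ⟨?_, ?_, ?_⟩ <;> refine Finset.sum_congr rfl fun a _ => Finset.sum_congr rfl fun b _ => ?_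
  all_goals
    obtain ⟨k, hk, h2, h3⟩ := isLine_response t a
    obtain ⟨l, hl, h4, h5⟩ := isLine_response c b
    dsimp only at h2 h3 h4 h5
    rcases h3 with ⟨h7, h8, h9⟩ | ⟨h7, h8, h9⟩ | ⟨h7, h8, h9⟩ <;>
    rcases h5 with ⟨h10, h11, h12⟩ | ⟨h10, h11, h12⟩ | ⟨h10, h11, h12⟩ <;>
    simp [h2, h4, h7, h8, h9, h10, h11, h12] <;> field_simp <;> ring

/-- The equality of the first two weights reflects the symmetry of adding `1` to the diagonal entry
at the root, which interchanges `(1, 0)` and `(1, 1)`; here it is read off from the recursion. -/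
lemma lineWeight_eq : ∀ t : RTree, t.lineWeight 1 0 = t.solPair.1 ∧ t.lineWeight 1 1 = t.solPair.1 ∧
    t.lineWeight 0 1 = t.solPair.2 - 3 / 2 * t.solPair.1
  | leaf => by
    have hsum : ∀ f : (leaf.Vert → ZMod 2) → ℝ, ∑ a, f a = f (fun _ => 0) + f (fun _ => 1) := by
      intro f
      refine (Fintype.sum_equiv (Equiv.funUnique Unit (ZMod 2)) f (fun z => f fun _ => z)
        fun a => ?_).trans (Fin.sum_univ_two _)
      rfl
    simp [lineWeight, hsum, response_leaf, solPair, size]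
  | attach t c => by
    obtain ⟨h1, h2, h3⟩ := lineWeight_eq t
    obtain ⟨h4, h5, h6⟩ := lineWeight_eq c
    obtain ⟨h7, h8, h9⟩ := lineWeight_attach t c
    rw [h7, h8, h9, h1, h2, h3, h4, h5, h6, solPair]
    refine ⟨?_, ?_, ?_⟩ <;> ring

/-- The kernel consists of two fibres if the line contains `(1, 0)` and of one otherwise, hence the
factor `1 / 2` for the first weight. -/
theorem solvability_toFinTree (t : RTree) : (solvability t.toFinTree : ℝ) = t.solPair.2 := by
  obtain ⟨h1, h2, h3⟩ := lineWeight_eq t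
  have h4 : t.solPair.2 = t.lineWeight 1 0 / 2 + t.lineWeight 1 1 + t.lineWeight 0 1 := by
    rw [h1, h2, h3]
    ring
  have h0 : solvability t.toFinTree = ∑ a : t.Vert → ZMod 2, numSolvable t.graph a :=
    @solvability_eq_sum t.toFinTree (inferInstanceAs (DecidableEq t.Vert))
  rw [h0, h4, Nat.cast_sum]
  simp only [lineWeight, ← Finset.sum_add_distrib, Finset.sum_div]
  refine Finset.sum_congr rfl fun a _ => ?_
  have h5 := numSolvable_mul t.graph t.root a
  rw [card_vert] at h5
  have h6 : (numSolvable t.graph a : ℝ) *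
      (response t.graph t.root a 0 0 + response t.graph t.root a 1 0) = 2 ^ t.size := by
    exact_mod_cast h5
  rw [← h6]
  obtain ⟨k, hk, h2, h3⟩ := isLine_response t a
  dsimp only at h2 h3
  rcases h3 with ⟨h7, h8, h9⟩ | ⟨h7, h8, h9⟩ | ⟨h7, h8, h9⟩ <;>
  simp [h2, h7, h8, h9] <;> field_simp
  ring

end RTree

/-! ### The exchange inequality for the solvability -/

open RTree

lemma sum_le_sum_take : ∀ {xs L : List ℝ} {s : ℕ}, xs.Pairwise (· ≥ ·) → (∀ x ∈ xs, 0 ≤ x) →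
    L.Subperm xs → L.length ≤ s → L.sum ≤ (xs.take s).sum
  | [], L, s, _, _, h, _ => by
    have := h.length_le
    have hL : L = [] := List.eq_nil_of_length_eq_zero (by simpa using this)
    simp [hL]
  | x :: xs, L, 0, _, _, _, hl => by
    have hL : L = [] := List.eq_nil_of_length_eq_zero (by simpa using hl)
    simp [hL]
  | x :: xs, L, s + 1, hs, h0, h, hl => by
    rw [List.take_succ_cons, List.sum_cons]
    have key : ∀ {a : ℝ}, a ∈ L → (L.erase a).Subperm xs → L.sum ≤ a + (xs.take s).sum := by
      intro a ha hsub
      rw [(List.perm_cons_erase ha).sum_eq, List.sum_cons]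
      have := sum_le_sum_take hs.of_cons (fun y hy => h0 y (List.mem_cons_of_mem _ hy)) hsub
        (s := s) (by rw [List.length_erase_of_mem ha]; omega)
      linarith
    by_cases hx : x ∈ L
    · refine key hx ?_
      have := h.erase x
      rwa [List.erase_cons_head] at this
    · rcases L with - | ⟨a, L⟩
      · have : 0 ≤ (xs.take s).sum := List.sum_nonneg fun y hy =>
          h0 y (List.mem_cons_of_mem _ (List.mem_of_mem_take hy))
        have := h0 x (by simp)
        simp only [List.sum_nil]
        linarith
      · have hsub : (a :: L).Subperm xs := by
          obtain ⟨l, hl1, hl2⟩ := h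
          rcases List.sublist_cons_iff.1 hl2 with h2 | ⟨r, rfl, -⟩
          · exact ⟨l, hl1, h2⟩
          · exact absurd (hl1.subset (by simp)) hx
        have ha := List.rel_of_pairwise_cons hs (hsub.subset (List.mem_cons_self))
        have := key (a := a) (by simp) ((List.erase_subperm a _).trans hsub)
        linarith

/-- The sums of the two parts in a distribution of branches. -/
lemma sums_of_distribution {σ : RTree → ℝ} (h0 : ∀ t, 0 ≤ σ t) {L R Ts : List RTree} {s : ℕ}
    (hp : (L ++ R).Perm Ts) (hs : Ts.Pairwise fun X Y => σ X ≥ σ Y) (hL : L.length ≤ s)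
    (hR : R.length ≤ s) :
    (L.map σ).sum + (R.map σ).sum = ((Ts.take s).map σ).sum + ((Ts.drop s).map σ).sum ∧
      (L.map σ).sum ≤ ((Ts.take s).map σ).sum ∧ (R.map σ).sum ≤ ((Ts.take s).map σ).sum := by
  have h1 : (Ts.map σ).Pairwise (· ≥ ·) := List.pairwise_map.2 hs
  have h2 : ∀ x ∈ Ts.map σ, 0 ≤ x := by
    intro x hx
    obtain ⟨t, -, rfl⟩ := List.mem_map.1 hx
    exact h0 t
  have hp' := hp.map σ
  rw [List.map_append] at hp'
  refine ⟨?_, ?_, ?_⟩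
  · rw [← List.sum_append, ← List.sum_append, ← List.map_append, ← List.map_append,
      List.take_append_drop, (hp.map σ).sum_eq]
  · rw [List.map_take]
    exact sum_le_sum_take h1 h2 ((List.sublist_append_left _ _).subperm.trans hp'.subperm)
      (by simpa using hL)
  · rw [List.map_take]
    exact sum_le_sum_take h1 h2 ((List.sublist_append_right _ _).subperm.trans hp'.subperm)
      (by simpa using hR)

namespace RTree

/-- The second component is the solvability. The first one is recovered from the solvability of the
tree with an additional leaf at the root. -/
lemma Iso.solPair_eq {t s : RTree} (h : t.Iso s) : t.solPair = s.solPair := by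
  have key : ∀ {t s : RTree}, t.Iso s → t.solPair.2 = s.solPair.2 := by
    rintro t s ⟨φ, -⟩
    rw [← solvability_toFinTree, ← solvability_toFinTree]
    exact isTreeInvariant_solvability t.toFinTree s.toFinTree ⟨φ⟩
  have h1 := key h
  have h2 := key (h.attach (Iso.refl leaf))
  simp only [solPair] at h2
  refine Prod.ext ?_ h1
  linarith

lemma solPair_bounds (t : RTree) :
    0 < t.solPair.1 ∧ 0 < t.solPair.2 ∧ t.solPair.1 ≤ 2 / 3 * t.solPair.2 := by
  induction t with
  | leaf => norm_num [solPair]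
  | attach t c ih ih' =>
    obtain ⟨h1, h2, h3⟩ := ih
    obtain ⟨h4, h5, h6⟩ := ih'
    simp only [solPair]
    have h7 := mul_pos h1 h4
    have h8 := mul_pos h2 h5
    have h9 := mul_le_mul_of_nonneg_right h3 h5.le
    refine ⟨mul_pos h1 (by linarith), by linarith, by linarith⟩

/-- A type II invariant for which the solvability is compatible. -/
noncomputable def solRho (t : RTree) : ℝ := -Real.log (1 - t.solPair.1 / (2 * t.solPair.2))

lemma solRatio_bounds (t : RTree) :
    0 < t.solPair.1 / (2 * t.solPair.2) ∧ t.solPair.1 / (2 * t.solPair.2) ≤ 1 / 3 := by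
  obtain ⟨h1, h2, h3⟩ := t.solPair_bounds
  refine ⟨by positivity, ?_⟩
  rw [div_le_iff₀ (by positivity)]
  linarith

lemma solRho_pos (t : RTree) : 0 < t.solRho := by
  obtain ⟨h1, h2⟩ := t.solRatio_bounds
  rw [solRho, neg_pos]
  exact Real.log_neg (by linarith) (by linarith)

lemma exp_neg_solRho (t : RTree) :
    Real.exp (-t.solRho) = 1 - t.solPair.1 / (2 * t.solPair.2) := by
  obtain ⟨h1, h2⟩ := t.solRatio_bounds
  rw [solRho, neg_neg, Real.exp_log (by linarith)]

/-- Write `(X, S)` for the pair. Attaching `c` multiplies `S + 5 / 2 * X` by the solvability of `c`,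
and `X` by this times `exp (-solRho c)`. A single vertex has `S + 5 / 2 * X = 8` and `X = 2`. -/
lemma solPair_node : ∀ ts : List RTree, (node ts).solPair =
    (2 * (ts.map fun t => t.solPair.2).prod * Real.exp (-(ts.map solRho).sum),
      (ts.map fun t => t.solPair.2).prod * (8 - 5 * Real.exp (-(ts.map solRho).sum)))
  | [] => by norm_num [node, solPair]
  | c :: ts => by
    obtain ⟨h1, h2, h3⟩ := c.solPair_bounds
    rw [node, solPair, solPair_node ts]
    simp only [List.map_cons, List.sum_cons, List.prod_cons, neg_add, Real.exp_add,
      exp_neg_solRho c]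
    refine Prod.ext ?_ ?_ <;> field_simp
    ring

lemma prod_solPair_pos (ts : List RTree) : 0 < (ts.map fun t => t.solPair.2).prod := by
  refine List.prod_pos fun x hx => ?_
  obtain ⟨t, -, rfl⟩ := List.mem_map.1 hx
  exact t.solPair_bounds.2.1

lemma solRho_node (ts : List RTree) : (node ts).solRho =
    -Real.log (1 - Real.exp (-(ts.map solRho).sum) / (8 - 5 * Real.exp (-(ts.map solRho).sum))) := by
  have h := prod_solPair_pos ts
  rw [solRho, solPair_node]
  congr 3
  rw [mul_assoc 2, mul_div_mul_left _ _ two_ne_zero, mul_div_mul_left _ _ h.ne']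

/-- The action of a path with branches on the pairs `solPair`. -/
noncomputable def plugAct : List (List RTree) → ℝ × ℝ → ℝ × ℝ
  | [], v => v
  | F :: Fs, v => ((node F).solPair.1 * ((plugAct Fs v).2 - (plugAct Fs v).1 / 2),
      (node F).solPair.2 * (plugAct Fs v).2 + 5 / 4 * (node F).solPair.1 * (plugAct Fs v).1)

lemma solPair_plug (x : RTree) : ∀ F, (plug F x).solPair = plugAct F x.solPair
  | [] => rfl
  | F :: Fs => by rw [plug, solPair, plugAct, solPair_plug x Fs]

lemma plugAct_combination (a b : ℝ) (v w : ℝ × ℝ) : ∀ F, plugAct F (a • v - b • w) =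
    a • plugAct F v - b • plugAct F w
  | [] => rfl
  | F :: Fs => by
    rw [plugAct, plugAct_combination a b v w Fs, plugAct, plugAct]
    refine Prod.ext ?_ ?_ <;> simp <;> ring

/-- A cone preserved by all branches along a path; it contains `(0, 1)` and has `(-2, 5)` on its
boundary. The bound `X ≤ 2 / 3 * S` for the frames is what makes it invariant. -/
lemma plugAct_cone {v : ℝ × ℝ} (h0 : 0 ≤ v.2) (h1 : -(2 / 5) * v.2 ≤ v.1) (h2 : v.1 ≤ 2 * v.2) :
    ∀ F, 0 ≤ (plugAct F v).2 ∧ -(2 / 5) * (plugAct F v).2 ≤ (plugAct F v).1 ∧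
      (plugAct F v).1 ≤ 2 * (plugAct F v).2
  | [] => ⟨h0, h1, h2⟩
  | F :: Fs => by
    obtain ⟨h3, h4, h5⟩ := plugAct_cone h0 h1 h2 Fs
    obtain ⟨h6, h7, h8⟩ := (node F).solPair_bounds
    simp only [plugAct]
    set X := (node F).solPair.1
    set S := (node F).solPair.2
    set x := (plugAct Fs v).1
    set y := (plugAct Fs v).2
    have h9 : 0 ≤ X * (2 * y - x) := mul_nonneg h6.le (by linarith)
    have h10 : 0 ≤ X * (x + 2 / 5 * y) := mul_nonneg h6.le (by linarith)
    have h11 : 0 ≤ (2 / 3 * S - X) * y := mul_nonneg (by linarith) h3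
    have h12 : 0 ≤ S * y := mul_nonneg h7.le h3
    refine ⟨by nlinarith, by nlinarith, by nlinarith⟩

lemma solvability_plug (F : List (List RTree)) : ∃ c₀ c₁ c₂ c₃ : ℝ, c₁ ≤ 0 ∧ c₂ ≤ 0 ∧
    ∀ L R : List RTree, (plug (L :: F) (node R)).solPair.2 =
      ((L ++ R).map fun t => t.solPair.2).prod * (c₀ + c₁ * Real.exp (-(L.map solRho).sum) +
        c₂ * Real.exp (-(R.map solRho).sum) +
        c₃ * (Real.exp (-(L.map solRho).sum) * Real.exp (-(R.map solRho).sum))) := by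
  obtain ⟨-, -, h1⟩ := plugAct_cone (v := (0, 1)) (by norm_num) (by norm_num) (by norm_num) F
  obtain ⟨h2, -⟩ := plugAct_cone (v := (-2, 5)) (by norm_num) (by norm_num) (by norm_num) F
  set p := plugAct F (0, 1) with hp
  set r := plugAct F (-2, 5) with hr
  refine ⟨64 * p.2, 20 * p.1 - 40 * p.2, -8 * r.2, 5 * r.2 - 5 / 2 * r.1, by linarith, by linarith,
    fun L R => ?_⟩
  rw [plug, solPair, solPair_plug, solPair_node L, solPair_node R]
  set σ := (R.map fun t => t.solPair.2).prod with hσ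
  set y := Real.exp (-(R.map solRho).sum) with hy
  -- The pair of `node R` is affine in `y`, with the vectors `(0, 1)` and `(-2, 5)`. Their images
  -- under the linear map `plugAct F` determine the coefficients, and the cone yields the signs of
  -- `c₁` and `c₂`.
  have h3 : ((2 * σ * y, σ * (8 - 5 * y)) : ℝ × ℝ) =
      (8 * σ) • ((0, 1) : ℝ × ℝ) - (σ * y) • ((-2, 5) : ℝ × ℝ) := by
    refine Prod.ext ?_ ?_ <;> simp <;> ring
  rw [h3, plugAct_combination, ← hp, ← hr, List.map_append, List.prod_append, ← hσ]
  simp only [Prod.snd_sub, Prod.smul_snd, Prod.fst_sub, Prod.smul_fst, smul_eq_mul]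
  ring

/-- With a fixed product, `a + b` is largest when one of the factors is the least possible value
`m`. As both coefficients are nonpositive, the large factor `M` should go with the smaller
coefficient. -/
lemma le_of_concave {c₁ c₂ m M a b : ℝ} (h1 : c₁ ≤ 0) (h2 : c₂ ≤ 0) (hm : 0 < m) (ha : m ≤ a)
    (hb : m ≤ b) (hab : a * b = m * M) :
    c₁ * m + c₂ * M ≤ c₁ * a + c₂ * b ∨ c₁ * M + c₂ * m ≤ c₁ * a + c₂ * b := by
  have h3 : a + b ≤ m + M := by
    have : 0 ≤ (a - m) * (b - m) := mul_nonneg (by linarith) (by linarith)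
    have : m * (a + b) ≤ m * (m + M) := by nlinarith
    exact le_of_mul_le_mul_left this hm
  rcases le_total c₂ c₁ with h | h
  · left
    nlinarith [mul_nonneg (sub_nonneg.2 h) (sub_nonneg.2 ha)]
  · right
    nlinarith [mul_nonneg (sub_nonneg.2 h) (sub_nonneg.2 hb)]

end RTree

theorem minCompatible_solvability :
    MinCompatible (fun X => solRho X.toRTree) fun T => (solvability T : ℝ) := by
  refine minCompatible_of_exchange isTreeInvariant_solvability fun F L R Ts s hp hs hL hR => ?_
  obtain ⟨c₀, c₁, c₂, c₃, h1, h2, h3⟩ := solvability_plug F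
  obtain ⟨h4, h5, h6⟩ := sums_of_distribution (fun t => (solRho_pos t).le) hp hs hL hR
  rw [solvability_toFinTree, solvability_toFinTree, solvability_toFinTree, h3, h3, h3,
    (hp.map _).prod_eq, List.take_append_drop,
    ((List.perm_append_comm (l₁ := Ts.drop s) (l₂ := Ts.take s)).map _).prod_eq,
    List.take_append_drop]
  have hab : Real.exp (-(L.map solRho).sum) * Real.exp (-(R.map solRho).sum) =
      Real.exp (-((Ts.take s).map solRho).sum) * Real.exp (-((Ts.drop s).map solRho).sum) := by
    rw [← Real.exp_add, ← Real.exp_add, ← neg_add, ← neg_add, h4]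
  have hpos := prod_solPair_pos Ts
  have key := le_of_concave h1 h2 (Real.exp_pos (-((Ts.take s).map solRho).sum))
    (Real.exp_le_exp.2 (neg_le_neg h5)) (Real.exp_le_exp.2 (neg_le_neg h6)) hab
  rw [mul_le_mul_iff_right₀ hpos, mul_le_mul_iff_right₀ hpos, hab,
    mul_comm (Real.exp (-((Ts.drop s).map solRho).sum))]
  exact key.imp (fun h => by linarith) fun h => by linarith

lemma strictAntiOn_neg_log : StrictAntiOn
    (fun x => -Real.log (1 - Real.exp (-x) / (8 - 5 * Real.exp (-x)))) (Set.Ici 0) := by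
  intro x hx y hy hxy
  have h1 : Real.exp (-x) ≤ 1 := Real.exp_le_one_iff.2 (by simpa using hx)
  have h2 := Real.exp_lt_exp.2 (neg_lt_neg hxy)
  have h3 := Real.exp_pos (-x)
  have h4 := Real.exp_pos (-y)
  dsimp only
  refine neg_lt_neg (Real.log_lt_log ?_ (sub_lt_sub_left ?_ 1))
  · rw [sub_pos, div_lt_one (by linarith)]
    linarith
  · rw [div_lt_div_iff₀ (by linarith) (by linarith)]
    nlinarith

theorem decreasingRule_solRho : DecreasingRule fun X => solRho X.toRTree := by
  have h0 : ∀ S : Multiset FinRootedTree,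
      0 ≤ (S.map fun X => solRho X.toRTree).sum := fun S =>
    Multiset.sum_nonneg fun x hx => by
      obtain ⟨X, -, rfl⟩ := Multiset.mem_map.1 hx
      exact (solRho_pos _).le
  refine ⟨fun S => -Real.log (1 - Real.exp (-S.sum) / (8 - 5 * Real.exp (-S.sum))),
    hasRecurrence_of_node (fun h => by rw [solRho, solRho, h.solPair_eq]) (fun ts => by
      rw [solRho_node, Multiset.sum_coe]), ?_, ?_, ?_⟩
  · intro S X Y hXY
    have h1 := h0 (X ::ₘ S)
    have h2 := h0 (Y ::ₘ S)
    rw [Multiset.map_cons] at h1 h2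
    exact strictAntiOn_neg_log h1 h2 (by simpa using hXY)
  · intro S X
    have h1 := h0 (X ::ₘ S)
    rw [Multiset.map_cons] at h1
    exact strictAntiOn_neg_log (h0 S) h1 (by simpa using solRho_pos X.toRTree)
  · intro X Y hX hY
    dsimp only
    have h1 := Y.size_toRTree
    rw [FinRootedTree.toRTree_eq_leaf hX]
    rcases h : Y.toRTree with - | ⟨t, c⟩
    · rw [h] at h1
      simp [size] at h1
      omega
    · rw [← node_children t, show attach (node t.children) c = node (c :: t.children) from rfl,
        show leaf = node [] from rfl, solRho_node, solRho_node]
      have h2 : 0 < ((c :: t.children).map solRho).sum := by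
        rw [List.map_cons, List.sum_cons]
        have := List.sum_nonneg (l := t.children.map solRho) fun x hx => by
          obtain ⟨X, -, rfl⟩ := List.mem_map.1 hx
          exact (solRho_pos _).le
        linarith [solRho_pos c]
      exact strictAntiOn_neg_log (by simp) h2.le (by simpa using h2)

open RTree

/-! ### The Steiner distance -/

/-- The set `S` has elements inside and outside `U`. -/
def Separates {V : Type} (U S : Finset V) : Prop := (∃ x ∈ S, x ∈ U) ∧ ∃ x ∈ S, x ∉ U

section

variable {V W : Type} {A U : Finset V} {B U' : Finset W}

lemma separates_inl : Separates (U.map .inl) (A.disjSum B) ↔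
    (∃ x ∈ A, x ∈ U) ∧ ((∃ x ∈ A, x ∉ U) ∨ B.Nonempty) := by
  simp only [Separates, Finset.mem_disjSum, Finset.mem_map, Function.Embedding.inl_apply,
    Finset.Nonempty]
  constructor
  · rintro ⟨⟨x, ⟨a, ha, rfl⟩ | ⟨b, hb, rfl⟩, y, hy, hxy⟩, ⟨z, ⟨a', ha', rfl⟩ | ⟨b', hb', rfl⟩, hz⟩⟩
    · refine ⟨⟨a, ha, ?_⟩, Or.inl ⟨a', ha', fun h => hz ⟨a', h, rfl⟩⟩⟩
      rwa [← Sum.inl_injective hxy]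
    · refine ⟨⟨a, ha, ?_⟩, Or.inr ⟨b', hb'⟩⟩
      rwa [← Sum.inl_injective hxy]
    · exact absurd hxy (by simp)
    · exact absurd hxy (by simp)
  · rintro ⟨⟨a, ha, hU⟩, ⟨x, hx, hxU⟩ | ⟨b, hb⟩⟩
    · refine ⟨⟨_, Or.inl ⟨a, ha, rfl⟩, a, hU, rfl⟩, ⟨_, Or.inl ⟨x, hx, rfl⟩, ?_⟩⟩
      rintro ⟨y, hy, hxy⟩
      rw [Sum.inl_injective hxy] at hy
      exact hxU hy
    · exact ⟨⟨_, Or.inl ⟨a, ha, rfl⟩, a, hU, rfl⟩, ⟨_, Or.inr ⟨b, hb, rfl⟩, by simp⟩⟩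

lemma separates_map (e : V ≃ W) : Separates (U.map e.toEmbedding) (A.map e.toEmbedding) ↔
    Separates U A := by
  simp only [Separates, Finset.mem_map, Equiv.toEmbedding_apply, exists_exists_and_eq_and,
    e.injective.eq_iff, exists_eq_right]

lemma separates_inr : Separates (U'.map .inr) (A.disjSum B) ↔
    (∃ x ∈ B, x ∈ U') ∧ ((∃ x ∈ B, x ∉ U') ∨ A.Nonempty) := by
  have h1 : ∀ U' : Finset W, (U'.map Function.Embedding.inr : Finset (V ⊕ W)) =
      (U'.map Function.Embedding.inl).map (Equiv.sumComm W V).toEmbedding := by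
    intro U'
    rw [Finset.map_map]
    rfl
  have h2 : A.disjSum B = (B.disjSum A).map (Equiv.sumComm W V).toEmbedding := by
    ext (x | x) <;> simp
  rw [h1, h2, separates_map, separates_inl]

open Classical in
/-- The number of members of `l` that separate `S`. -/
noncomputable def numSep (l : List (Finset V × Sym2 V)) (S : Finset V) : ℕ :=
  l.countP fun U => Separates U.1 S

/-- The vertex sets of the branches after joining two rooted trees. -/
def bridgeCuts (l : List (Finset V × Sym2 V)) (v : V) [Fintype W] (l' : List (Finset W × Sym2 W))
    (w : W) : List (Finset (V ⊕ W) × Sym2 (V ⊕ W)) :=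
  l.map (fun U => (U.1.map .inl, U.2.map Sum.inl)) ++
    (l'.map (fun U => (U.1.map .inr, U.2.map Sum.inr)) ++
      [((Finset.univ : Finset W).map .inr, s(Sum.inl v, Sum.inr w))])

/-- `l` lists the vertex sets of the branches of a tree with root `r`, and the edges that join
them to the rest of the tree. -/
structure IsCutSystem (G : SimpleGraph V) (r : V) (l : List (Finset V × Sym2 V)) : Prop where
  root_notMem : ∀ U ∈ l, r ∉ U.1
  eq_edge : ∀ U ∈ l, ∀ a b, G.Adj a b → a ∈ U.1 → b ∉ U.1 → s(a, b) = U.2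
  nodup : (l.map Prod.snd).Nodup
  exists_connected : ∀ S : Finset V, S.Nonempty →
    ∃ U : Finset V, S ⊆ U ∧ (G.induce (U : Set V)).Connected ∧ U.card = numSep l S + 1

variable [Fintype W] {G : SimpleGraph V} {X : SimpleGraph W} {v : V} {w : W}
  {l : List (Finset V × Sym2 V)} {l' : List (Finset W × Sym2 W)}

lemma mem_bridgeCuts {U : Finset (V ⊕ W) × Sym2 (V ⊕ W)} : U ∈ bridgeCuts l v l' w ↔
    (∃ U' ∈ l, (U'.1.map .inl, U'.2.map Sum.inl) = U) ∨
    (∃ U' ∈ l', (U'.1.map .inr, U'.2.map Sum.inr) = U) ∨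
    U = ((Finset.univ : Finset W).map .inr, s(Sum.inl v, Sum.inr w)) := by
  rw [bridgeCuts, List.mem_append, List.mem_append, List.mem_map, List.mem_map, List.mem_singleton]

lemma numSep_insert [DecidableEq V] (hl : ∀ U ∈ l, v ∉ U.1) :
    numSep l (insert v A) = l.countP (fun U => by
      classical exact decide (∃ x ∈ A, x ∈ U.1)) := by
  classical
  refine List.countP_congr fun U hU => ?_
  have := hl U hU
  simp only [Separates, Finset.mem_insert, decide_eq_true_eq]
  constructor
  · rintro ⟨⟨x, rfl | hx, hxU⟩, -⟩
    · exact absurd hxU this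
    · exact ⟨x, hx, hxU⟩
  · rintro ⟨x, hx, hxU⟩
    exact ⟨⟨x, .inr hx, hxU⟩, v, .inl rfl, this⟩

/-- If `S` meets both sides, a connecting subtree has to use the new edge, so `v` and `w` count as
members of the two parts; otherwise only one side matters. -/
lemma numSep_bridgeCuts [DecidableEq V] [DecidableEq W] (hl : ∀ U ∈ l, v ∉ U.1)
    (hl' : ∀ U ∈ l', w ∉ U.1) (A : Finset V) (B : Finset W) :
    numSep (bridgeCuts l v l' w) (A.disjSum B) =
      if B = ∅ then numSep l A else if A = ∅ then numSep l' B else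
        numSep l (insert v A) + numSep l' (insert w B) + 1 := by
  have h : Separates ((Finset.univ : Finset W).map .inr) (A.disjSum B) ↔
      A.Nonempty ∧ B.Nonempty := by
    rw [separates_inr]
    simp [Finset.Nonempty, and_comm]
  rw [numSep, bridgeCuts, List.countP_append, List.countP_append, List.countP_map, List.countP_map,
    List.countP_singleton]
  simp only [Function.comp_def, separates_inl, separates_inr, h]
  by_cases hB : B = ∅
  · simp [hB, numSep, Separates]
    exact List.countP_congr fun U _ => by
        rw [Bool.and_eq_true, decide_eq_true_iff, decide_eq_true_iff]
        exact (@decide_eq_true_iff _ (Classical.propDecidable _)).symm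
  · by_cases hA : A = ∅
    · simp [hA, hB, numSep, Separates]
      exact List.countP_congr fun U _ => by
        rw [Bool.and_eq_true, decide_eq_true_iff, decide_eq_true_iff]
        exact (@decide_eq_true_iff _ (Classical.propDecidable _)).symm
    · have hA' := Finset.nonempty_iff_ne_empty.2 hA
      have hB' := Finset.nonempty_iff_ne_empty.2 hB
      rw [if_neg hB, if_neg hA, numSep_insert hl, numSep_insert hl']
      simp [hA', hB', add_assoc]

lemma sum_map_bridgeCuts (g : ℕ → ℝ) : ((bridgeCuts l v l' w).map fun U => g U.1.card).sum =
    (l.map fun U => g U.1.card).sum +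
      ((l'.map fun U => g U.1.card).sum + g (Fintype.card W)) := by
  rw [bridgeCuts, List.map_append, List.map_append, List.map_map, List.map_map, List.sum_append,
    List.sum_append, List.map_singleton, List.sum_singleton]
  simp only [Function.comp_def, Finset.card_map, Finset.card_univ]

omit [Fintype W] in
lemma connected_induce_map {G : SimpleGraph V} {X : SimpleGraph W} (f : G →g X) {s : Set V}
    (h : (G.induce s).Connected) : (X.induce (f '' s)).Connected := by
  refine h.map (SimpleGraph.induceHom f (Set.mapsTo_image f s)) ?_
  rintro ⟨_, x, hx, rfl⟩
  exact ⟨⟨x, hx⟩, rfl⟩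

lemma IsCutSystem.bridge (h : IsCutSystem G v l) (h' : IsCutSystem X w l') :
    IsCutSystem (SimpleGraph.bridge G v X w) (.inl v) (bridgeCuts l v l' w) where
  root_notMem U hU := by
    rw [mem_bridgeCuts] at hU
    rcases hU with ⟨U, hU, rfl⟩ | ⟨U, hU, rfl⟩ | rfl
    · simpa using h.root_notMem U hU
    · simp
    · simp
  eq_edge U hU a b hab ha hb := by
    rw [mem_bridgeCuts] at hU
    rcases hU with ⟨U, hU, rfl⟩ | ⟨U, hU, rfl⟩ | rfl
    · obtain ⟨y, hy, rfl⟩ := Finset.mem_map.1 ha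
      rcases b with b | b
      · have h1 : b ∉ U.1 := fun h => hb (Finset.mem_map.2 ⟨b, h, rfl⟩)
        rw [← h.eq_edge U hU _ _ (SimpleGraph.bridge_inl_inl.1 hab) hy h1]
        rfl
      · obtain ⟨h1, -⟩ := SimpleGraph.bridge_inl_inr.1 hab
        rw [h1] at hy
        exact absurd hy (h.root_notMem U hU)
    · obtain ⟨y, hy, rfl⟩ := Finset.mem_map.1 ha
      rcases b with b | b
      · obtain ⟨-, h1⟩ := SimpleGraph.bridge_inr_inl.1 hab
        rw [h1] at hy
        exact absurd hy (h'.root_notMem U hU)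
      · have h1 : b ∉ U.1 := fun h => hb (Finset.mem_map.2 ⟨b, h, rfl⟩)
        rw [← h'.eq_edge U hU _ _ (SimpleGraph.bridge_inr_inr.1 hab) hy h1]
        rfl
    · obtain ⟨y, hy, rfl⟩ := Finset.mem_map.1 ha
      rcases b with b | b
      · obtain ⟨rfl, rfl⟩ := SimpleGraph.bridge_inr_inl.1 hab
        exact Sym2.eq_swap
      · exact absurd (Finset.mem_map.2 ⟨b, Finset.mem_univ b, rfl⟩) hb
  nodup := by
    have h1 := h.nodup.map (Sym2.map.injective (Sum.inl_injective (β := W)))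
    have h2 := h'.nodup.map (Sym2.map.injective (Sum.inr_injective (α := V)))
    have h3 : ((bridgeCuts l v l' w).map Prod.snd) = (l.map Prod.snd).map (Sym2.map Sum.inl) ++
        ((l'.map Prod.snd).map (Sym2.map Sum.inr) ++ [s(Sum.inl v, Sum.inr w)]) := by
      simp only [bridgeCuts, List.map_append, List.map_map, List.map_singleton]
      rfl
    rw [h3]
    have hl : ∀ (e : Sym2 V) (x : W), (Sum.inr x : V ⊕ W) ∉ e.map Sum.inl := by
      simp [Sym2.mem_map]
    have hr : ∀ (e : Sym2 W) (x : V), (Sum.inl x : V ⊕ W) ∉ e.map Sum.inr := by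
      simp [Sym2.mem_map]
    refine List.nodup_append.2 ⟨h1, List.nodup_append.2 ⟨h2, List.nodup_singleton _, ?_⟩, ?_⟩
    · intro a ha b hb hab
      obtain ⟨e, -, rfl⟩ := List.mem_map.1 ha
      rw [List.mem_singleton] at hb
      refine hr e v ?_
      rw [hab, hb]
      exact Sym2.mem_mk_left _ _
    · intro a ha b hb hab
      obtain ⟨e, -, rfl⟩ := List.mem_map.1 ha
      rcases List.mem_append.1 hb with hb | hb
      · obtain ⟨e', -, rfl⟩ := List.mem_map.1 hb
        induction e' with
        | _ x y =>
          refine hl e x ?_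
          rw [hab]
          exact Sym2.mem_mk_left _ _
      · rw [List.mem_singleton] at hb
        refine hl e w ?_
        rw [hab, hb]
        exact Sym2.mem_mk_right _ _
  exists_connected S hS := by
    classical
    obtain ⟨A, B, rfl⟩ : ∃ A B, S = Finset.disjSum A B :=
      ⟨S.toLeft, S.toRight, S.toLeft_disjSum_toRight.symm⟩
    rw [numSep_bridgeCuts h.root_notMem h'.root_notMem]
    have hl : ∀ U : Finset V, ((U.disjSum (∅ : Finset W) : Finset (V ⊕ W)) : Set (V ⊕ W)) =
        Sum.inl '' (U : Set V) := fun U => by ext (x | x) <;> simp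
    have hr : ∀ U : Finset W, (((∅ : Finset V).disjSum U : Finset (V ⊕ W)) : Set (V ⊕ W)) =
        Sum.inr '' (U : Set W) := fun U => by ext (x | x) <;> simp
    have hm : ∀ (U : Finset V) (U' : Finset W), ((U.disjSum U' : Finset (V ⊕ W)) : Set (V ⊕ W)) =
        Sum.inl '' (U : Set V) ∪ Sum.inr '' (U' : Set W) := fun U U' => by ext (x | x) <;> simp
    let f : G →g SimpleGraph.bridge G v X w := ⟨Sum.inl, id⟩
    let f' : X →g SimpleGraph.bridge G v X w := ⟨Sum.inr, id⟩
    by_cases hB : B = ∅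
    · subst hB
      obtain ⟨U, h1, h2, h3⟩ := h.exists_connected A (by
        obtain ⟨x, hx⟩ := hS
        rcases x with x | x <;> simp at hx
        exact ⟨x, hx⟩)
      refine ⟨U.disjSum ∅, Finset.disjSum_mono h1 subset_rfl, ?_, by simpa using h3⟩
      rw [hl]
      exact connected_induce_map (X := SimpleGraph.bridge G v X w) f h2
    by_cases hA : A = ∅
    · subst hA
      obtain ⟨U, h1, h2, h3⟩ := h'.exists_connected B (Finset.nonempty_iff_ne_empty.2 hB)
      refine ⟨Finset.disjSum ∅ U, Finset.disjSum_mono subset_rfl h1, ?_, by simpa [hB] using h3⟩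
      rw [hr]
      exact connected_induce_map (X := SimpleGraph.bridge G v X w) f' h2
    · obtain ⟨U, h1, h2, h3⟩ := h.exists_connected (insert v A) (Finset.insert_nonempty _ _)
      obtain ⟨U', h4, h5, h6⟩ := h'.exists_connected (insert w B) (Finset.insert_nonempty _ _)
      refine ⟨U.disjSum U', Finset.disjSum_mono ((Finset.subset_insert _ _).trans h1)
        ((Finset.subset_insert _ _).trans h4), ?_, ?_⟩
      · rw [hm]
        exact SimpleGraph.connected_induce_union (connected_induce_map (X := SimpleGraph.bridge G v X w) f h2).preconnected
          (connected_induce_map (X := SimpleGraph.bridge G v X w) f' h5).preconnected (v := .inl v) (w := .inr w)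
          ⟨v, h1 (Finset.mem_insert_self _ _), rfl⟩ ⟨w, h4 (Finset.mem_insert_self _ _), rfl⟩
          (SimpleGraph.bridge_inl_inr.2 ⟨rfl, rfl⟩)
      · rw [Finset.card_disjSum, h3, h6, if_neg hB, if_neg hA]
        ring

omit [Fintype W] in
-- A connected subgraph containing `S` crosses every cut that separates `S`. There is only one edge
-- at which this is possible, and these edges are distinct for distinct cuts.
lemma IsCutSystem.numSep_le_ncard [Finite V] (h : IsCutSystem G v l) (S : Finset V)
    (K : G.Subgraph) (hK : K.coe.Connected) (hS : (S : Set V) ⊆ K.verts) :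
    numSep l S ≤ K.edgeSet.ncard := by
  classical
  set m := (l.filter fun U => Separates U.1 S).map Prod.snd with hm
  have h1 : m.Nodup := h.nodup.sublist (List.filter_sublist.map _)
  have h2 : numSep l S = m.toFinset.card := by
    rw [List.toFinset_card_of_nodup h1, hm, List.length_map, numSep, List.countP_eq_length_filter]
  rw [h2, ← Set.ncard_coe_finset]
  refine Set.ncard_le_ncard (fun e he => ?_) (Set.toFinite _)
  rw [Finset.mem_coe, List.mem_toFinset, hm, List.mem_map] at he
  obtain ⟨U, hU, rfl⟩ := he
  rw [List.mem_filter, decide_eq_true_iff] at hU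
  obtain ⟨hU, ⟨x, hx, hxU⟩, ⟨y, hy, hyU⟩⟩ := hU
  obtain ⟨p⟩ := hK.preconnected ⟨x, hS hx⟩ ⟨y, hS hy⟩
  obtain ⟨d, -, hd1, hd2⟩ := p.exists_boundary_dart {z | (z : V) ∈ U.1} hxU hyU
  have hadj : K.Adj d.fst d.snd := d.adj
  rw [← h.eq_edge U hU _ _ hadj.adj_sub hd1 hd2]
  exact hadj

end

lemma SimpleGraph.IsTree.exists_subgraph {V : Type} [Finite V] {G : SimpleGraph V} (hG : G.IsTree)
    {U : Finset V} (hU : (G.induce (U : Set V)).Connected) :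
    ∃ K : G.Subgraph, K.coe.IsTree ∧ K.verts = U ∧ K.edgeSet.ncard + 1 = U.card := by
  classical
  have := Fintype.ofFinite V
  have hT : ((⊤ : G.Subgraph).induce (U : Set V)).coe.IsTree := by
    rw [← SimpleGraph.induce_eq_coe_induce_top]
    exact ⟨hU, hG.isAcyclic.induce _⟩
  refine ⟨_, hT, rfl, ?_⟩
  rw [← SimpleGraph.Subgraph.image_coe_edgeSet_coe,
    Set.ncard_image_of_injective _ (Sym2.map.injective Subtype.val_injective),
    ← SimpleGraph.coe_edgeFinset, Set.ncard_coe_finset, hT.card_edgeFinset,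
    ← Nat.card_eq_fintype_card]
  exact (Nat.card_coe_set_eq _).trans (Set.ncard_coe_finset U)

lemma FinTree.steinerDist_eq_numSep (T : FinTree) {r : T.V} {l : List (Finset T.V × Sym2 T.V)}
    (h : IsCutSystem T.graph r l) {S : Finset T.V} (hS : S.Nonempty) :
    steinerDist T S = numSep l S := by
  obtain ⟨U, h1, h2, h3⟩ := h.exists_connected S hS
  obtain ⟨K, h4, h5, h6⟩ := T.isTree.exists_subgraph h2
  have hmem : K.edgeSet.ncard ∈ {m | ∃ K : T.graph.Subgraph, K.coe.IsTree ∧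
      (S : Set T.V) ⊆ K.verts ∧ K.edgeSet.ncard = m} := ⟨K, h4, by rw [h5]; exact_mod_cast h1, rfl⟩
  refine le_antisymm ((Nat.sInf_le hmem).trans (by omega)) (le_csInf ⟨_, hmem⟩ ?_)
  rintro _ ⟨K, h7, h8, rfl⟩
  exact h.numSep_le_ncard S K h7.connected h8

namespace RTree

/-- The vertex sets of the branches, with the edges to their parents. -/
def cuts : (t : RTree) → List (Finset t.Vert × Sym2 t.Vert)
  | leaf => []
  | attach t c => bridgeCuts t.cuts t.root c.cuts c.root

lemma isCutSystem_cuts : ∀ t : RTree, IsCutSystem t.graph t.root t.cuts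
  | leaf => by
    refine ⟨by simp [cuts], by simp [cuts], List.nodup_nil, fun S hS => ⟨S, subset_rfl, ?_, ?_⟩⟩
    · have : Nonempty (S : Set leaf.Vert) := hS.to_subtype
      have : Subsingleton (S : Set leaf.Vert) :=
        ⟨fun x y => Subtype.ext (Subsingleton.elim (α := Unit) _ _)⟩
      exact ⟨fun x y => by rw [Subsingleton.elim x y]⟩
    · exact Finset.card_eq_one.2 ((Finset.card_eq_one.1 (le_antisymm
        (Finset.card_le_one.2 fun x _ y _ => Subsingleton.elim (α := Unit) x y) hS.card_pos)))
  | attach t c => (isCutSystem_cuts t).bridge (isCutSystem_cuts c)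

/-- The sum of the values of `g` at the sizes of the branches. -/
def cutSum (g : ℕ → ℝ) : RTree → ℝ
  | leaf => 0
  | attach t c => cutSum g t + (cutSum g c + g c.size)

lemma sum_map_cuts (g : ℕ → ℝ) : ∀ t : RTree,
    (t.cuts.map fun U => g U.1.card).sum = cutSum g t
  | leaf => rfl
  | attach t c => by
    rw [cutSum, ← sum_map_cuts g t, ← sum_map_cuts g c]
    refine (sum_map_bridgeCuts g).trans ?_
    rw [card_vert]

/-- The number of `k`-subsets of an `n`-set that meet an `m`-subset and its complement. -/
noncomputable def numSplit (n k m : ℕ) : ℝ :=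
  n.choose k - (m.choose k + (n - m).choose k)

end RTree

lemma card_filter_separates {V : Type} [Fintype V] {k : ℕ} (hk : 1 ≤ k) (U : Finset V)
    [DecidablePred (Separates U)] :
    (((Finset.univ.powersetCard k).filter (Separates U)).card : ℝ) =
      RTree.numSplit (Fintype.card V) k U.card := by
  classical
  have h1 : (Finset.univ.powersetCard k).filter (fun S => ¬ Separates U S) =
      U.powersetCard k ∪ Uᶜ.powersetCard k := by
    ext S
    rw [Finset.mem_filter, Finset.mem_union, Separates, Finset.mem_powersetCard_univ]
    simp only [Finset.mem_powersetCard, Finset.subset_iff, Finset.mem_compl]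
    push Not
    constructor
    · rintro ⟨h1, h2⟩
      by_cases h : ∃ x ∈ S, x ∈ U
      · exact .inl ⟨h2 h, h1⟩
      · push Not at h
        exact .inr ⟨h, h1⟩
    · rintro (⟨h1, h2⟩ | ⟨h1, h2⟩)
      · exact ⟨h2, fun _ => h1⟩
      · exact ⟨h2, fun ⟨x, hx, hxU⟩ => absurd hxU (h1 hx)⟩
  have h2 : Disjoint (U.powersetCard k) (Uᶜ.powersetCard k) := by
    rw [Finset.disjoint_left]
    intro S hS hS'
    rw [Finset.mem_powersetCard] at hS hS'
    obtain ⟨x, hx⟩ := Finset.card_pos.1 (by omega : 0 < S.card)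
    exact Finset.mem_compl.1 (hS'.1 hx) (hS.1 hx)
  have h3 := Finset.card_filter_add_card_filter_not (s := (Finset.univ : Finset V).powersetCard k)
    (Separates U)
  rw [h1, Finset.card_union_of_disjoint h2, Finset.card_powersetCard, Finset.card_powersetCard,
    Finset.card_powersetCard, Finset.card_compl, Finset.card_univ] at h3
  rw [RTree.numSplit, ← h3]
  push_cast
  ring

lemma sum_countP {α β : Type} (l : List α) (s : Finset β) (p : α → β → Prop)
    [∀ a, DecidablePred (p a)] : ∑ b ∈ s, l.countP (fun a => p a b) =
      (l.map fun a => (s.filter (p a)).card).sum := by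
  induction l with
  | nil => simp
  | cons a l ih =>
    simp only [List.countP_cons, Finset.sum_add_distrib, ih, List.map_cons, List.sum_cons,
      Finset.card_filter, decide_eq_true_eq]
    rw [add_comm]

/-- Double counting: each edge contributes the number of `k`-sets with vertices on both sides of it.
-/
lemma RTree.steinerWiener_toFinTree {k : ℕ} (hk : 1 ≤ k) (t : RTree) :
    (steinerWiener k t.toFinTree : ℝ) = cutSum (numSplit t.size k) t := by
  classical
  have h1 : steinerWiener k t.toFinTree =
      ∑ S ∈ (Finset.univ : Finset t.Vert).powersetCard k, numSep t.cuts S := by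
    refine Finset.sum_congr rfl fun S hS => ?_
    refine t.toFinTree.steinerDist_eq_numSep t.isCutSystem_cuts ?_
    exact Finset.card_pos.1 (lt_of_lt_of_eq hk (Finset.mem_powersetCard.1 hS).2.symm)
  have h2 : ∀ S : Finset t.Vert, numSep t.cuts S = t.cuts.countP fun U => Separates U.1 S :=
    fun S => by rw [numSep]
  rw [h1, ← sum_map_cuts]
  simp only [h2]
  rw [sum_countP t.cuts _ (fun U S => Separates U.1 S), Nat.cast_list_sum, List.map_map]
  refine congrArg List.sum (List.map_congr_left fun U _ => ?_)
  rw [Function.comp_apply, card_filter_separates hk, card_vert]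

open RTree

/-! ### The Steiner Wiener index -/

lemma FinTree.steinerDist_map_le {T T' : FinTree} (φ : T.graph ≃g T'.graph)
    (S : Finset T.V) : steinerDist T' (S.map φ.toEquiv.toEmbedding) ≤ steinerDist T S := by
  have hne : {m | ∃ K : T.graph.Subgraph, K.coe.IsTree ∧ (S : Set T.V) ⊆ K.verts ∧
      K.edgeSet.ncard = m}.Nonempty := by
    have hU : (T.graph.induce ((Finset.univ : Finset T.V) : Set T.V)).Connected := by
      rw [Finset.coe_univ]
      exact (SimpleGraph.Iso.connected_iff (SimpleGraph.induceUnivIso T.graph)).2 T.isTree.connected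
    obtain ⟨K, h1, h2, -⟩ := T.isTree.exists_subgraph hU
    exact ⟨_, K, h1, by simp [h2], rfl⟩
  obtain ⟨K, h1, h2, h3⟩ := Nat.sInf_mem hne
  refine Nat.sInf_le ⟨K.map φ.toHom, ?_, ?_, ?_⟩
  · exact (SimpleGraph.Iso.isTree_iff (φ.toCopy.isoSubgraphMap K)).1 h1
  · rw [Finset.coe_map]
    exact Set.image_mono h2
  · rw [SimpleGraph.Subgraph.edgeSet_map]
    exact (Set.ncard_image_of_injective _ (Sym2.map.injective φ.injective)).trans h3

lemma isTreeInvariant_steinerWiener (k : ℕ) :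
    IsTreeInvariant fun T => (steinerWiener k T : ℝ) := by
  have key : ∀ {T T' : FinTree}, (T.graph ≃g T'.graph) → steinerWiener k T' ≤ steinerWiener k T := by
    intro T T' φ
    have h1 : (Finset.univ : Finset T'.V) = Finset.univ.map φ.toEquiv.toEmbedding := by simp
    rw [steinerWiener, h1, Finset.powersetCard_map, Finset.sum_map]
    exact Finset.sum_le_sum fun S _ => FinTree.steinerDist_map_le φ S
  rintro T T' ⟨φ⟩
  exact congrArg Nat.cast (le_antisymm (key φ.symm) (key φ))

namespace RTree

lemma cutSum_node (g : ℕ → ℝ) : ∀ ts : List RTree,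
    cutSum g (node ts) = (ts.map fun t => cutSum g t + g t.size).sum
  | [] => rfl
  | c :: ts => by
    rw [node, cutSum, cutSum_node g ts, List.map_cons, List.sum_cons, add_comm]

lemma size_node : ∀ ts : List RTree, (node ts).size = (ts.map size).sum + 1
  | [] => rfl
  | c :: ts => by
    rw [node, size, size_node ts, List.map_cons, List.sum_cons]
    ring

lemma exists_size_plug : ∀ F : List (List RTree), ∃ c, ∀ x, (plug F x).size = c + x.size
  | [] => ⟨0, fun x => (zero_add _).symm⟩
  | F :: Fs => by
    obtain ⟨c, hc⟩ := exists_size_plug Fs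
    exact ⟨(node F).size + c, fun x => by rw [plug, size, hc, add_assoc]⟩

/-- Only the edges on the path to the root of `x` notice the size of `x`. Each contributes a
translate of `g`, so `ψ` inherits concavity. -/
lemma exists_cutSum_plug {g : ℕ → ℝ} (hg : Antitone fun m => g (m + 1) - g m) :
    ∀ F : List (List RTree), ∃ (C : ℝ) (ψ : ℕ → ℝ), (Antitone fun m => ψ (m + 1) - ψ m) ∧
      ∀ x, cutSum g (plug F x) = C + cutSum g x + ψ x.size
  | [] => ⟨0, fun _ => 0, fun _ _ _ => le_rfl, fun x => by simp [plug]⟩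
  | F :: Fs => by
    obtain ⟨C, ψ, h1, h2⟩ := exists_cutSum_plug hg Fs
    obtain ⟨c, hc⟩ := exists_size_plug Fs
    refine ⟨cutSum g (node F) + C, fun m => ψ m + g (c + m), fun a b hab => ?_, fun x => ?_⟩
    · have h3 := h1 hab
      have h4 := hg (Nat.add_le_add_left hab c)
      simp only [add_assoc] at h3 h4 ⊢
      linarith
    · rw [plug, cutSum, h2, hc]
      ring

lemma numSplit_succ_sub {n k : ℕ} (hk : 1 ≤ k) (m : ℕ) :
    numSplit n (k + 1) (m + 1) - numSplit n (k + 1) m = (n - (m + 1)).choose k - m.choose k := by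
  have h : (n - m).choose (k + 1) = (n - (m + 1)).choose k + (n - (m + 1)).choose (k + 1) := by
    rcases Nat.lt_or_ge m n with hm | hm
    · rw [show n - m = n - (m + 1) + 1 by omega, Nat.choose_succ_succ]
    -- Beyond `n` both truncated differences are `0`, and `Nat.choose 0 k` vanishes only for `k ≥
    -- 1`.
    · rw [Nat.sub_eq_zero_of_le hm, Nat.sub_eq_zero_of_le (hm.trans (Nat.le_succ m))]
      simp [Nat.choose_eq_zero_of_lt hk]
  rw [numSplit, numSplit, h, Nat.choose_succ_succ m]
  push_cast
  ring

lemma antitone_numSplit {n k : ℕ} (hk : 2 ≤ k) :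
    Antitone fun m => numSplit n k (m + 1) - numSplit n k m := by
  obtain ⟨k, rfl⟩ : ∃ j, k = j + 1 := ⟨k - 1, by omega⟩
  intro a b hab
  dsimp only
  rw [numSplit_succ_sub (by omega), numSplit_succ_sub (by omega)]
  refine sub_le_sub ?_ ?_
  · exact_mod_cast Nat.choose_le_choose k (by omega)
  · exact_mod_cast Nat.choose_le_choose k hab

/-- A concave sequence is nonincreasing from `x` on if its increment at `x` is nonpositive, and
nondecreasing up to `x` otherwise. -/
lemma le_or_le_of_antitone_sub {ψ : ℕ → ℝ} (h : Antitone fun m => ψ (m + 1) - ψ m) {a x b : ℕ}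
    (hax : a ≤ x) (hxb : x ≤ b) : ψ a ≤ ψ x ∨ ψ b ≤ ψ x := by
  rcases le_total (ψ (x + 1) - ψ x) 0 with h0 | h0
  · right
    induction b, hxb using Nat.le_induction with
    | base => exact le_rfl
    | succ b hb ih =>
      have : ψ (b + 1) - ψ b ≤ ψ (x + 1) - ψ x := h hb
      linarith
  · left
    refine monotoneOn_of_le_succ Set.ordConnected_Iic (fun i _ _ hi => ?_)
      (Set.mem_Iic.2 hax) (Set.mem_Iic.2 le_rfl) hax
    have : ψ (x + 1) - ψ x ≤ ψ (i + 1) - ψ i :=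
      h (by have := Set.mem_Iic.1 hi; rw [Nat.succ_eq_succ] at this; omega)
    rw [Nat.succ_eq_succ]
    change ψ i ≤ ψ (i + 1)
    linarith

end RTree

/-- The contributions of the branches do not depend on where they are attached, since the total
number of vertices is the same. What remains is a concave function of the number of vertices in the
branches at `w`, which lies between the values of the two extremal distributions. -/
theorem minCompatible_steinerWiener {k : ℕ} (hk : 2 ≤ k) :
    MinCompatible (fun X => (X.toRTree.size : ℝ)) fun T => (steinerWiener k T : ℝ) := by
  refine minCompatible_of_exchange (σ := fun t => (t.size : ℝ))
    (isTreeInvariant_steinerWiener k) fun F L R Ts s hp hs hL hR => ?_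
  obtain ⟨h1, h2, h3⟩ := sums_of_distribution (fun t => Nat.cast_nonneg _) hp hs hL hR
  have hc : ∀ ts : List RTree, (ts.map fun t => (t.size : ℝ)).sum = ((ts.map size).sum : ℕ) :=
    fun ts => by rw [Nat.cast_list_sum, List.map_map]; rfl
  simp only [hc] at h1 h2 h3
  norm_cast at h1 h2 h3
  obtain ⟨c, hsize⟩ := exists_size_plug F
  set n := ((Ts.take s).map size).sum + ((Ts.drop s).map size).sum + 2 + c with hn
  have h4 : ∀ L R : List RTree, (L.map size).sum + (R.map size).sum =
      ((Ts.take s).map size).sum + ((Ts.drop s).map size).sum →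
      (plug (L :: F) (node R)).size = n := by
    intro L R h
    rw [plug, size, hsize, size_node, size_node]
    omega
  obtain ⟨C, ψ, h5, h6⟩ := exists_cutSum_plug (antitone_numSplit (n := n) hk) ([] :: F)
  have h7 : ∀ L R : List RTree, cutSum (numSplit n k) (plug (L :: F) (node R)) =
      ((L ++ R).map fun t => cutSum (numSplit n k) t + numSplit n k t.size).sum +
        (C + ψ ((R.map size).sum + 1)) := by
    intro L R
    have := h6 (node R)
    rw [plug, cutSum, cutSum_node _ [], cutSum_node _ R, size_node, List.map_nil, List.sum_nil,
      zero_add] at this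
    rw [plug, cutSum, this, cutSum_node, List.map_append, List.sum_append]
    ring
  rw [steinerWiener_toFinTree (by omega), steinerWiener_toFinTree (by omega),
    steinerWiener_toFinTree (by omega), h4 _ _ rfl, h4 _ _ (add_comm _ _), h4 _ _ h1, h7, h7, h7,
    (hp.map _).sum_eq, List.take_append_drop,
    ((List.perm_append_comm (l₁ := Ts.drop s) (l₂ := Ts.take s)).map _).sum_eq,
    List.take_append_drop, add_le_add_iff_left, add_le_add_iff_left, add_le_add_iff_left,
    add_le_add_iff_left]
  exact le_or_le_of_antitone_sub h5 (by omega) (by omega)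

theorem increasingRule_size : IncreasingRule fun X => (X.toRTree.size : ℝ) := by
  refine ⟨fun S => S.sum + 1, hasRecurrence_of_node (σ := fun t => (t.size : ℝ))
    (fun h => congrArg Nat.cast h.size_eq) (fun ts => ?_), fun S X Y hXY => ?_, fun S X => ?_,
    fun X Y hX hY => ?_⟩
  · rw [size_node, Multiset.sum_coe, Nat.cast_add, Nat.cast_list_sum, List.map_map, Nat.cast_one]
    rfl
  · simpa using hXY
  · simpa using X.toRTree.size_pos
  · dsimp only
    rw [X.size_toRTree, Y.size_toRTree]
    exact_mod_cast hX.trans_lt hY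

/-! ### The Wiener index -/

lemma FinTree.steinerDist_pair (T : FinTree) {S : Finset T.V} {u v : T.V}
    (hS : ∀ x, x ∈ S ↔ x = u ∨ x = v) : steinerDist T S = T.graph.dist u v := by
  classical
  obtain ⟨p, hp, hlen⟩ := T.isTree.connected.exists_path_of_dist u v
  have hmem : p.toSubgraph.edgeSet.ncard ∈ {m | ∃ K : T.graph.Subgraph, K.coe.IsTree ∧
      (S : Set T.V) ⊆ K.verts ∧ K.edgeSet.ncard = m} := by
    refine ⟨p.toSubgraph, ⟨p.toSubgraph_connected.coe, T.isTree.isAcyclic.subgraph _⟩, ?_, rfl⟩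
    intro x hx
    rcases (hS x).1 hx with rfl | rfl
    · exact p.start_mem_verts_toSubgraph
    · exact p.end_mem_verts_toSubgraph
  refine le_antisymm ((Nat.sInf_le hmem).trans ?_) (le_csInf ⟨_, hmem⟩ ?_)
  · rw [← hlen, ← p.length_edges, p.edgeSet_toSubgraph]
    refine le_trans (le_of_eq ?_) p.edges.toFinset_card_le
    rw [← Set.ncard_coe_finset, List.coe_toFinset]
    rfl
  · rintro _ ⟨K, h1, h2, rfl⟩
    obtain ⟨q, hq⟩ := h1.connected.exists_isPath ⟨u, h2 ((hS u).2 (.inl rfl))⟩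
      ⟨v, h2 ((hS v).2 (.inr rfl))⟩
    refine (SimpleGraph.dist_le (q.map K.hom)).trans ?_
    rw [SimpleGraph.Walk.length_map, ← SimpleGraph.Subgraph.image_coe_edgeSet_coe,
      Set.ncard_image_of_injective _ (Sym2.map.injective Subtype.val_injective), ← q.length_edges,
      ← List.toFinset_card_of_nodup hq.isTrail.edges_nodup, ← Set.ncard_coe_finset]
    refine Set.ncard_le_ncard (fun e he => ?_) (Set.toFinite _)
    rw [List.coe_toFinset] at he
    exact q.edges_subset_edgeSet he

lemma wienerIndex_eq_steinerWiener (T : FinTree) : wienerIndex T = steinerWiener 2 T := by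
  classical
  rw [wienerIndex, ← Finset.sum_filter_add_sum_filter_not _ (fun e : Sym2 T.V => e.IsDiag),
    Finset.sum_eq_zero, zero_add, steinerWiener]
  · refine Finset.sum_nbij (fun e => e.toFinset) (fun e he => ?_) (fun e _ e' _ h => ?_)
      (fun S hS => ?_) fun e he => ?_
    · rw [Finset.mem_powersetCard_univ]
      exact Sym2.card_toFinset_of_not_isDiag _ (Finset.mem_filter.1 he).2
    · refine Sym2.ext fun x => ?_
      rw [← Sym2.mem_toFinset, ← Sym2.mem_toFinset]
      exact iff_of_eq (congrArg (x ∈ ·) h)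
    · rw [Finset.mem_coe, Finset.mem_powersetCard_univ, Finset.card_eq_two] at hS
      obtain ⟨u, v, huv, rfl⟩ := hS
      exact ⟨s(u, v), by simpa using huv, by ext; simp⟩
    · induction e with
      | _ u v => exact (T.steinerDist_pair (by simp)).symm
  · intro e he
    induction e with
    | _ u v =>
      have : u = v := by simpa using (Finset.mem_filter.1 he).2
      subst this
      exact SimpleGraph.dist_self

open RTree

/-! ### Classes of trees -/

lemma FinTree.mem_degSeq {T : FinTree} {x : ℕ} : x ∈ T.degSeq ↔ ∃ v, T.deg v = x := by
  rw [FinTree.degSeq, Multiset.mem_sort, Multiset.mem_map]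
  simp

lemma FinTree.ncard_deg (T : FinTree) (p : ℕ → Prop) [DecidablePred p] :
    {v | p (T.deg v)}.ncard = T.degSeq.countP p := by
  classical
  rw [← Multiset.coe_countP, FinTree.degSeq, Multiset.sort_eq, Multiset.countP_map]
  change _ = (Finset.univ.filter fun v => p (T.deg v)).card
  rw [← Set.ncard_coe_finset, Finset.coe_filter_univ]

lemma FinTree.one_le_of_mem_degSeq {T : FinTree} (hT : 2 ≤ T.order) {x : ℕ} (hx : x ∈ T.degSeq) :
    1 ≤ x := by
  obtain ⟨t, ⟨φ⟩⟩ := T.exists_rtree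
  have h1 : T.order = t.size := (FinTree.order_eq_of_iso (T' := t.toFinTree) φ).trans t.card_vert
  rw [FinTree.degSeq_eq_of_iso (T := T) (T' := t.toFinTree) φ, degSeq_toFinTree,
    Multiset.mem_sort] at hx
  refine one_le_of_mem_degs ?_ hx
  rintro rfl
  rw [h1] at hT
  exact absurd hT (by decide)

lemma FinTree.sum_degSeq (T : FinTree) : T.degSeq.sum + 2 = 2 * T.order := by
  rw [← T.length_degSeq]
  exact IsTreeDegSeq.sum_add_two ⟨T, rfl⟩

lemma majorises_of_drop {B D : List ℕ} (h1 : B.length = D.length) (h2 : B.sum = D.sum)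
    (h : ∀ k, 1 ≤ k → k < B.length → (B.drop k).sum ≤ (D.drop k).sum) : Majorises B D := by
  refine ⟨h1, h2, fun k hk hk' => ?_⟩
  have h3 := B.sum_take_add_sum_drop k
  have h4 := D.sum_take_add_sum_drop k
  have h5 := h k hk hk'
  omega

lemma length_add_le_sum {l : List ℕ} (h : ∀ x ∈ l, 1 ≤ x) :
    l.length + 2 * l.countP (3 ≤ ·) ≤ l.sum := by
  induction l with
  | nil => simp
  | cons a l ih =>
    have h1 := ih fun x hx => h x (List.mem_cons_of_mem _ hx)
    have h2 := h a List.mem_cons_self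
    rw [List.length_cons, List.sum_cons, List.countP_cons]
    split_ifs with h3
    · have : 3 ≤ a := by simpa using h3
      omega
    · omega

lemma two_mul_length_le_sum_add_countP {l : List ℕ} (h : ∀ x ∈ l, 1 ≤ x) :
    2 * l.length ≤ l.sum + l.countP (· = 1) := by
  induction l with
  | nil => simp
  | cons a l ih =>
    have h1 := ih fun x hx => h x (List.mem_cons_of_mem _ hx)
    have h2 := h a List.mem_cons_self
    rw [List.length_cons, List.sum_cons, List.countP_cons]
    split_ifs with h3
    · omega
    · have : a ≠ 1 := by simpa using h3
      omega

lemma isLeast_of_cast {f : FinTree → ℕ} {A : Set FinTree} {a : ℕ}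
    (h : IsLeast ((fun T => (f T : ℝ)) '' A) a) : IsLeast (f '' A) a := by
  simpa [IsLeast, lowerBounds] using h

section

variable {n : ℕ} {A : Set FinTree} {B : List ℕ}

lemma exists_isGreedyTree_isLeast (hB : B.Pairwise (· ≥ ·)) (h1 : ∀ x ∈ B, 1 ≤ x)
    (hs : B.sum + 2 = 2 * B.length) (hmem : ∀ T : FinTree, T.degSeq = B → T ∈ A)
    (hA : ∀ T ∈ A, T.order = n) (hAB : ∀ T ∈ A, Majorises B T.degSeq) :
    ∃ G ∈ A, IsGreedyTree B G ∧ ∀ k, 2 ≤ k → IsLeast (steinerWiener k '' A) (steinerWiener k G) := by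
  obtain ⟨G, hG, hGB⟩ := exists_isGreedyTree hB h1 hs
  exact ⟨G, hmem G hGB, hG, fun k hk => isLeast_of_cast (isLeast_greedy hA ⟨G, hGB⟩ hAB
    (isTreeInvariant_steinerWiener k) (minCompatible_steinerWiener hk) increasingRule_size
    (hmem G hGB) hG)⟩

lemma exists_isMTree_isLeast (hB : B.Pairwise (· ≥ ·)) (h1 : ∀ x ∈ B, 1 ≤ x)
    (hs : B.sum + 2 = 2 * B.length) (hmem : ∀ T : FinTree, T.degSeq = B → T ∈ A)
    (hA : ∀ T ∈ A, T.order = n) (hAB : ∀ T ∈ A, Majorises B T.degSeq) :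
    ∃ M ∈ A, IsMTree B M ∧ IsLeast (solvability '' A) (solvability M) := by
  obtain ⟨M, hM, hMB⟩ := exists_isMTree hB h1 hs
  exact ⟨M, hmem M hMB, hM, isLeast_of_cast (isLeast_mTree hA ⟨M, hMB⟩ hAB
    isTreeInvariant_solvability minCompatible_solvability decreasingRule_solRho (hmem M hMB) hM)⟩

end

section

variable {n d r : ℕ}

lemma exists_boundedDegreeSeq_eq (hn : 2 ≤ n) (hr : 1 ≤ r) (hrd : r < d)
    (h : r ≡ n - 1 [MOD d - 1]) : ∃ q, q * d + r + (n - 1 - q) + 2 = 2 * n ∧ q + 1 ≤ n ∧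
      boundedDegreeSeq n d r = List.replicate q d ++ r :: List.replicate (n - 1 - q) 1 := by
  -- Otherwise `1 ≤ n - 1 < r ≤ d - 1`, and two such numbers are not congruent modulo `d - 1`.
  have hrn : r ≤ n - 1 := by
    by_contra! hlt
    rcases Nat.lt_or_ge r (d - 1) with h1 | h1
    · have := h.eq_of_lt_of_lt h1 (by omega)
      omega
    · have h2 : r = d - 1 := by omega
      rw [h2] at h
      have h3 : (d - 1) ∣ n - 1 := (Nat.modEq_zero_iff_dvd.1 (h.symm.trans (by simp [Nat.ModEq])))
      have := Nat.le_of_dvd (by omega) h3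
      omega
  obtain ⟨q, hq⟩ := (Nat.modEq_iff_dvd' hrn).1 h
  obtain ⟨e, rfl⟩ : ∃ e, d = e + 2 := ⟨d - 2, by omega⟩
  have hq' : (n - 1 - r) / (e + 2 - 1) = q := by
    rw [hq, Nat.mul_div_cancel_left _ (by omega)]
  rw [show e + 2 - 1 = e + 1 by omega] at hq
  have h1 : q * (e + 2) = (e + 1) * q + q := by ring
  have h2 : (e + 1) * q = e * q + q := by ring
  exact ⟨q, by omega, by omega, by rw [boundedDegreeSeq, hq']⟩

end

theorem exists_boundedDegreeTrees_isLeast {n d r : ℕ} (hn : 2 ≤ n) (hr : 1 ≤ r) (hrd : r < d)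
    (h : r ≡ n - 1 [MOD d - 1]) :
    (∃ G ∈ boundedDegreeTrees n d, IsGreedyTree (boundedDegreeSeq n d r) G ∧
      ∀ k, 2 ≤ k → IsLeast (steinerWiener k '' boundedDegreeTrees n d) (steinerWiener k G)) ∧
    (∃ M ∈ boundedDegreeTrees n d, IsMTree (boundedDegreeSeq n d r) M ∧
      IsLeast (solvability '' boundedDegreeTrees n d) (solvability M)) := by
  obtain ⟨q, h1, h2, h3⟩ := exists_boundedDegreeSeq_eq hn hr hrd h
  rw [h3]
  set B := List.replicate q d ++ r :: List.replicate (n - 1 - q) 1 with hB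
  have hlen : B.length = n := by
    simp [hB]
    omega
  have hsum : B.sum + 2 = 2 * n := by
    simp [hB]
    omega
  have hpw : B.Pairwise (· ≥ ·) := by
    simp [hB, List.pairwise_append, List.pairwise_replicate]
    grind
  have hone : ∀ x ∈ B, 1 ≤ x := by
    simp [hB]
    grind
  have hmem : ∀ T : FinTree, T.degSeq = B → T ∈ boundedDegreeTrees n d := by
    intro T hT
    refine ⟨by rw [← T.length_degSeq, hT, hlen], fun v => ?_⟩
    have hv : T.deg v ∈ B := hT ▸ FinTree.mem_degSeq.2 ⟨v, rfl⟩
    simp [hB] at hv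
    omega
  have hAB : ∀ T ∈ boundedDegreeTrees n d, Majorises B T.degSeq := by
    rintro T ⟨hT, hdeg⟩
    have h4 := T.sum_degSeq
    have h5 := T.length_degSeq
    refine ⟨by omega, by omega, fun k hk hk' => ?_⟩
    -- The first `q` partial sums of `B` are the largest ones that the degree bound permits; beyond
    -- the entry `r` the tail of `B` consists of ones, so its sum is the least possible.
    rcases le_or_gt k q with hkq | hkq
    · have h6 : B.take k = List.replicate k d := by
        rw [hB, List.take_append_of_le_length (by simpa using hkq), List.take_replicate,
          min_eq_left hkq]
      rw [h6, List.sum_replicate]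
      refine (List.sum_le_card_nsmul _ d fun x hx => ?_).trans
        (Nat.mul_le_mul_right d (List.length_take_le _ _))
      obtain ⟨v, rfl⟩ := FinTree.mem_degSeq.1 (List.mem_of_mem_take hx)
      exact hdeg v
    · have h6 := length_add_le_sum (l := T.degSeq.drop k) fun x hx =>
        T.one_le_of_mem_degSeq (by omega) (List.mem_of_mem_drop hx)
      have h7 : (B.drop k).sum = n - k := by
        obtain ⟨j, rfl⟩ : ∃ j, k = q + (j + 1) := ⟨k - q - 1, by omega⟩
        rw [hB, List.drop_append, List.drop_eq_nil_of_le (by simp), List.length_replicate,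
          Nat.add_sub_cancel_left, List.drop_succ_cons]
        simp
        omega
      have h8 := B.sum_take_add_sum_drop k
      have h9 := T.degSeq.sum_take_add_sum_drop k
      rw [List.length_drop] at h6
      omega
  have hA : ∀ T ∈ boundedDegreeTrees n d, T.order = n := fun T hT => hT.1
  have hs : B.sum + 2 = 2 * B.length := by omega
  exact ⟨exists_isGreedyTree_isLeast hpw hone hs hmem hA hAB,
    exists_isMTree_isLeast hpw hone hs hmem hA hAB⟩

theorem exists_treesWithLeaves_isLeast {n l : ℕ} (hl : 2 ≤ l) (hln : l < n) :
    (∃ G ∈ treesWithLeaves n l, IsGreedyTree (leavesSeq n l) G ∧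
      ∀ k, 2 ≤ k → IsLeast (steinerWiener k '' treesWithLeaves n l) (steinerWiener k G)) ∧
    (∃ M ∈ treesWithLeaves n l, IsMTree (leavesSeq n l) M ∧
      IsLeast (solvability '' treesWithLeaves n l) (solvability M)) := by
  have hlen : (leavesSeq n l).length = n := by
    simp [leavesSeq]
    omega
  have hsum : (leavesSeq n l).sum + 2 = 2 * n := by
    simp [leavesSeq]
    omega
  have hpw : (leavesSeq n l).Pairwise (· ≥ ·) := by
    simp [leavesSeq, List.pairwise_append, List.pairwise_replicate]
    grind
  have hone : ∀ x ∈ leavesSeq n l, 1 ≤ x := by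
    simp [leavesSeq]
    grind
  have hmem : ∀ T : FinTree, T.degSeq = leavesSeq n l → T ∈ treesWithLeaves n l := by
    intro T hT
    refine ⟨by rw [← T.length_degSeq, hT, hlen], ?_⟩
    rw [T.ncard_deg (· = 1), hT]
    rw [leavesSeq, List.countP_cons, List.countP_append, List.countP_replicate,
      List.countP_replicate]
    simp
    omega
  have hAB : ∀ T ∈ treesWithLeaves n l, Majorises (leavesSeq n l) T.degSeq := by
    rintro T ⟨hT, hdeg⟩
    have h4 := T.sum_degSeq
    have h5 := T.length_degSeq
    rw [T.ncard_deg (· = 1)] at hdeg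
    refine majorises_of_drop (by omega) (by omega) fun k hk hk' => ?_
    have h6 : ∀ x ∈ T.degSeq.drop k, 1 ≤ x := fun x hx =>
      T.one_le_of_mem_degSeq (by omega) (List.mem_of_mem_drop hx)
    -- A tail of length `m` with at most `l` ones has sum at least `m` and at least `2 * m - l`; the
    -- larger of these is the sum of the tail of `B`.
    have h7 := two_mul_length_le_sum_add_countP h6
    have h8 := length_add_le_sum h6
    have h9 : (T.degSeq.drop k).countP (· = 1) ≤ T.degSeq.countP (· = 1) :=
      (List.drop_sublist _ _).countP_le
    rw [List.length_drop] at h7 h8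
    obtain ⟨j, rfl⟩ : ∃ j, k = j + 1 := ⟨k - 1, by omega⟩
    simp [leavesSeq, List.drop_append]
    omega
  have hA : ∀ T ∈ treesWithLeaves n l, T.order = n := fun T hT => hT.1
  have hs : (leavesSeq n l).sum + 2 = 2 * (leavesSeq n l).length := by omega
  exact ⟨exists_isGreedyTree_isLeast hpw hone hs hmem hA hAB,
    exists_isMTree_isLeast hpw hone hs hmem hA hAB⟩

theorem exists_treesWithBranching_isLeast {n r : ℕ} (hr : 1 ≤ r) (hrn : 2 * r + 2 ≤ n) :
    ∃ G ∈ treesWithBranching n r, IsGreedyTree (branchingSeq n r) G ∧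
      IsLeast (wienerIndex '' treesWithBranching n r) (wienerIndex G) := by
  have hlen : (branchingSeq n r).length = n := by
    simp [branchingSeq]
    omega
  have hsum : (branchingSeq n r).sum + 2 = 2 * n := by
    simp [branchingSeq]
    omega
  have hpw : (branchingSeq n r).Pairwise (· ≥ ·) := by
    simp [branchingSeq, List.pairwise_append, List.pairwise_replicate]
    grind
  have hone : ∀ x ∈ branchingSeq n r, 1 ≤ x := by
    simp [branchingSeq]
    grind
  have hmem : ∀ T : FinTree, T.degSeq = branchingSeq n r → T ∈ treesWithBranching n r := by
    intro T hT
    refine ⟨by rw [← T.length_degSeq, hT, hlen], ?_⟩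
    rw [T.ncard_deg (3 ≤ ·), hT]
    rw [branchingSeq, List.countP_cons, List.countP_append, List.countP_replicate,
      List.countP_replicate]
    have : 3 ≤ n + 1 - 2 * r := by omega
    simp [this]
    omega
  have hAB : ∀ T ∈ treesWithBranching n r, Majorises (branchingSeq n r) T.degSeq := by
    rintro T ⟨hT, hdeg⟩
    have h4 := T.sum_degSeq
    have h5 := T.length_degSeq
    rw [T.ncard_deg (3 ≤ ·)] at hdeg
    refine majorises_of_drop (by omega) (by omega) fun k hk hk' => ?_
    have h6 : ∀ x ∈ T.degSeq.drop k, 1 ≤ x := fun x hx =>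
      T.one_le_of_mem_degSeq (by omega) (List.mem_of_mem_drop hx)
    have h8 := length_add_le_sum h6
    -- At most `k` of the `r` entries that are at least `3` are among the first `k`, and each of the
    -- others raises the sum of the tail by at least `2` above its length.
    have h9 : T.degSeq.countP (3 ≤ ·) ≤ k + (T.degSeq.drop k).countP (3 ≤ ·) := by
      conv_lhs => rw [← List.take_append_drop k T.degSeq, List.countP_append]
      have := (List.countP_le_length (p := fun x => decide (3 ≤ x)) (l := T.degSeq.take k)).trans
        (List.length_take_le _ _)
      omega
    rw [List.length_drop] at h8
    obtain ⟨j, rfl⟩ : ∃ j, k = j + 1 := ⟨k - 1, by omega⟩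
    simp [branchingSeq, List.drop_append]
    omega
  obtain ⟨G, h1, h2, h3⟩ := exists_isGreedyTree_isLeast hpw hone (by omega) hmem
    (fun T hT => hT.1) hAB
  have h4 : wienerIndex = steinerWiener 2 := funext wienerIndex_eq_steinerWiener
  exact ⟨G, h1, h2, h4 ▸ h3 2 le_rfl⟩

theorem corollary3p11 :
    -- classes of trees whose degree sequences are majorised by `B`
    (∀ (n : ℕ) (A : Set FinTree) (B : List ℕ),
      (∀ T ∈ A, T.order = n) → IsTreeDegSeq B → (∀ T ∈ A, Majorises B T.degSeq) →
      ∀ (ρ : FinRootedTree → ℝ) (I : FinTree → ℝ), IsTreeInvariant I →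
        (MaxCompatible ρ I →
          (IncreasingRule ρ → ∀ G ∈ A, IsGreedyTree B G → IsGreatest (I '' A) (I G)) ∧
          (DecreasingRule ρ → ∀ M ∈ A, IsMTree B M → IsGreatest (I '' A) (I M))) ∧
        (MinCompatible ρ I →
          (IncreasingRule ρ → ∀ G ∈ A, IsGreedyTree B G → IsLeast (I '' A) (I G)) ∧
          (DecreasingRule ρ → ∀ M ∈ A, IsMTree B M → IsLeast (I '' A) (I M)))) ∧
    -- trees with bounded degrees
    (∀ n d r : ℕ, 2 ≤ n → 1 ≤ r → r < d → r ≡ n - 1 [MOD d - 1] →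
      (∃ G ∈ boundedDegreeTrees n d, IsGreedyTree (boundedDegreeSeq n d r) G ∧
        ∀ k, 2 ≤ k → IsLeast (steinerWiener k '' boundedDegreeTrees n d) (steinerWiener k G)) ∧
      (∃ M ∈ boundedDegreeTrees n d, IsMTree (boundedDegreeSeq n d r) M ∧
        IsLeast (solvability '' boundedDegreeTrees n d) (solvability M))) ∧
    -- trees with a given number of leaves
    (∀ n l : ℕ, 2 ≤ l → l < n →
      (∃ G ∈ treesWithLeaves n l, IsGreedyTree (leavesSeq n l) G ∧
        ∀ k, 2 ≤ k → IsLeast (steinerWiener k '' treesWithLeaves n l) (steinerWiener k G)) ∧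
      (∃ M ∈ treesWithLeaves n l, IsMTree (leavesSeq n l) M ∧
        IsLeast (solvability '' treesWithLeaves n l) (solvability M))) ∧
    -- trees with a given number of branching vertices
    (∀ n r : ℕ, 1 ≤ r → 2 * r + 2 ≤ n →
      ∃ G ∈ treesWithBranching n r, IsGreedyTree (branchingSeq n r) G ∧
        IsLeast (wienerIndex '' treesWithBranching n r) (wienerIndex G)) := by
  refine ⟨fun n A B hA hB hAB ρ I hI => ⟨fun h =>
      ⟨fun hρ G hG hBG => isGreatest_greedy hA hB hAB hI h hρ hG hBG,
        fun hρ M hM hBM => isGreatest_mTree hA hB hAB hI h hρ hM hBM⟩,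
    fun h => ⟨fun hρ G hG hBG => isLeast_greedy hA hB hAB hI h hρ hG hBG,
        fun hρ M hM hBM => isLeast_mTree hA hB hAB hI h hρ hM hBM⟩⟩, ?_, ?_, ?_⟩
  · exact fun n d r => exists_boundedDegreeTrees_isLeast
  · exact fun n l => exists_treesWithLeaves_isLeast
  · exact fun n r => exists_treesWithBranching_isLeast
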